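/- **Setup.** Let $(M,d)$ be a metric space with a Borel probability measure $m$, and $T\colon M\to M$ a (measurable) nonsingular map. Assume there are a measurable $Y\subset M$ with $m(Y)>0$ and $\operatorname{diam}Y\le 1$, an at most countable partition $\alpha$ of $Y$ modulo null sets into measurable sets $a$ with $m(a)>0$, and a measurable $\tau\colon Y\to\{1,2,\dots\}$ with $\int_Y\tau\,dm<\infty$, constant $=\tau(a)$ on each $a\in\alpha$, with $T^{\tau(a)}a\subset Y$. Put $F(y)=T^{\tau(y)}(y)$. Assume that for constants $\lambda>1$, $\hat K\ge 0$ and every $a\in\alpha$: $F$ restricts to a measure-theoretic bijection from $a$ onto $Y$; $d(Fx,Fy)\ge\lambda d(x,y)$ for $x,y\in a$; and the inverse Jacobian $\zeta_m=\frac{dm}{dm\circ F}$ satisfies $|\log\zeta_m(x)-\log\zeta_m(y)|\le\hat K d(Fx,Fy)$ for $x,y\in a$. Then $T$ is called nonuniformly expanding. **The invariant measure.** There is a continuous function $K_0(\lambda,\hat K)$ on $\{\lambda>1,\hat K\ge0\}$ such that for every nonuniformly expanding $T$ with constants $\lambda,\hat K$ there is a unique $F$-invariant probability measure $\mu$ on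 $Y$ absolutely continuous with respect to $m$, and with $K=K_0(\lambda,\hat K)>0$ and $m_Y=m(\,\cdot\cap Y)/m(Y)$, $$K^{-1}\le\frac{d\mu}{dm_Y}\le K,\qquad |\log\zeta(x)-\log\zeta(y)|\le K\,d(Fx,Fy)\quad(x,y\in a\in\alpha),\qquad \zeta=\frac{d\mu}{d\mu\circ F}.\tag{1}$$ **Forward regular measures.** Let $K\ge0$ be any constant for which the distortion bound for $\zeta$ in (1) holds, and let $R'>K\lambda/(\lambda-1)$. A probability measure $\rho$ on $M$ is *regular* if it is supported on $Y$ and $d\rho=\phi\,d\mu$ with $\phi\colon Y\to(0,\infty)$ and $|\log\phi(x)-\log\phi(y)|\le R'd(x,y)$ for all $x,y\in Y$. A probability measure $\rho$ on $M$ is *forward regular* if $\rho=\int_E\rho_z\,d\varkappa(z)$ for a probability space $(E,\varkappa)$ and a measurable family $\{\rho_z\}$ of probability measures on $M$, and there is a measurable *jump function* $r\colon E\to\{0,1,2,\dots\}$ such that $T^{r(z)}_*\rho_z$ is regular for every $z\in E$. **Theorem.** Let $\rho_1,\rho_2$ be forward regular, with disintegrations $\rho_j=\int_{E_j}\rho_{j,z}\,d\varkappa_j(z)$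 and jump functions $r_j$. Let $v\colon M\to\mathbb R^d$ be bounded and measurable, $|v|_\infty=\sup_{x\in M}|v(x)|$ and $v_n=\sum_{k=0}^{n-1}v\circ T^k$. Then there are a probability space $(\Omega,\mathbb P)$ and processes $\{X_n,n\ge0\}$, $\{Y_n,n\ge0\}$ on it, equal in distribution to $\{v_n,n\ge0\}$ on $(M,\rho_1)$ and on $(M,\rho_2)$ respectively, such that $Z=\sup_{n\ge0}|X_n-Y_n|$ is finite almost surely. Moreover, this coupling satisfies: (a) If for some $\beta>1$, $C_\beta>0$ we have $\varkappa_1(r_1\ge n)\le C_\beta n^{-\beta}$, $\varkappa_2(r_2\ge n)\le C_\beta n^{-\beta}$ and $\mu(\tau\ge n)\le C_\beta n^{-\beta}$ for all $n\ge1$, then $\mathbb P(Z\ge x)\le Cx^{-\beta}$ for all $x>0$. (b) If for some $\beta>1$, $C_\beta>0$ we have $\int r_1^\beta\,d\varkappa_1\le C_\beta$, $\int r_2^\beta\,d\varkappa_2\le C_\beta$ and $\int\tau^\beta\,d\mu\le C_\beta$, then $\int Z^\beta\,d\mathbb P\le C$. (c) If for some $\alpha>0$, $\gamma\in(0,1]$,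 $C_{\alpha,\gamma}>0$ we have $\varkappa_1(r_1\ge n)\le C_{\alpha,\gamma}e^{-\alpha n^\gamma}$, $\varkappa_2(r_2\ge n)\le C_{\alpha,\gamma}e^{-\alpha n^\gamma}$ and $\mu(\tau\ge n)\le C_{\alpha,\gamma}e^{-\alpha n^\gamma}$ for all $n\ge1$, then $\mathbb P(Z\ge x)\le Ce^{-Ax^\gamma}$ for all $x>0$, with $C>0$ and $A>0$. In (a) and (b) the constant $C$ is a continuous function of $(\lambda,K,R',\beta,C_\beta,|v|_\infty)$ only; in (c) the constants $C$ and $A$ are continuous functions of $(\lambda,K,R',\alpha,\gamma,C_{\alpha,\gamma},|v|_\infty)$ only. -/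

import Mathlib

open MeasureTheory ProbabilityTheory Set
open scoped ENNReal

universe u w₁ w₂

namespace NUE

section Setup

variable {M : Type u}

/-- The induced map `F y = T^{τ(y)} y`. -/
def inducedMap (T : M → M) (τ : M → ℕ) (y : M) : M := T^[τ y] y

variable [MeasurableSpace M]

/-- `F` restricts to a measure-theoretic bijection from `a` onto `Y`: after removing null sets it
is a bijection that is measurable together with its inverse. (Measurability of `F` itself is part
of the setting in which this is used.) -/
def MeasureBijOn (m : Measure M) (F : M → M) (a Y : Set M) : Prop :=
  ∃ a' Y' : Set M, a' ⊆ a ∧ Y' ⊆ Y ∧ MeasurableSet a' ∧ MeasurableSet Y' ∧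
    m (a \ a') = 0 ∧ m (Y \ Y') = 0 ∧ BijOn F a' Y' ∧
    ∀ A ⊆ a', MeasurableSet A → MeasurableSet (F '' A)

/-- `ζ` is (a version of) the inverse Jacobian `dν / (dν ∘ F)` on the set `a`, where
`(ν ∘ F)(A) = ν (F A)` for `A ⊆ a`. As `0 < ζ < ∞`, the relation `dν = ζ d(ν ∘ F)` on `a` is
the same as `d(ν ∘ F) = ζ⁻¹ dν`, which is how it is written here. -/
def IsInverseJacobianOn (ν : Measure M) (F : M → M) (ζ : M → ℝ) (a : Set M) : Prop :=
  (∀ x ∈ a, 0 < ζ x) ∧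
    ∀ A ⊆ a, MeasurableSet A → ν (F '' A) = ∫⁻ x in A, ENNReal.ofReal (ζ x)⁻¹ ∂ν

variable [MetricSpace M]

/-- The inverse Jacobian of `F` with respect to `ν` satisfies
`|log ζ(x) - log ζ(y)| ≤ K d(F x, F y)` for `x, y` in the same element of `α`. -/
def HasDistortion (ν : Measure M) (F : M → M) (α : Set (Set M)) (K : ℝ) : Prop :=
  ∃ ζ : M → ℝ, Measurable ζ ∧ ∀ a ∈ α, IsInverseJacobianOn ν F ζ a ∧
    ∀ x ∈ a, ∀ y ∈ a, |Real.log (ζ x) - Real.log (ζ y)| ≤ K * dist (F x) (F y)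

/-- `T` is nonuniformly expanding on the space `(M, d, m)`, with inducing set `Y` of diameter at
most `1`, partition `α` of `Y` modulo null sets, return time `τ`, expansion constant `lam` and
distortion constant `Khat` (with Hölder exponent `1`). Only the values of `τ` on `Y` matter. -/
structure IsNonuniformlyExpanding (m : Measure M) (T : M → M) (Y : Set M) (α : Set (Set M))
    (τ : M → ℕ) (lam Khat : ℝ) : Prop where
  nonsingular : Measure.QuasiMeasurePreserving T m m
  measurableSet_base : MeasurableSet Y
  base_pos : 0 < m Y
  dist_le_one : ∀ x ∈ Y, ∀ y ∈ Y, dist x y ≤ 1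
  countable_partition : α.Countable
  measurableSet_of_mem : ∀ a ∈ α, MeasurableSet a
  subset_base : ∀ a ∈ α, a ⊆ Y
  pairwiseDisjoint : α.PairwiseDisjoint id
  cover : m (Y \ ⋃₀ α) = 0
  measurable_return : Measurable τ
  return_pos : ∀ y ∈ Y, 1 ≤ τ y
  return_integrable : ∫⁻ y in Y, (τ y : ℝ≥0∞) ∂m < ∞
  elem_pos : ∀ a ∈ α, 0 < m a
  return_const : ∀ a ∈ α, ∃ n : ℕ, ∀ y ∈ a, τ y = n
  mapsTo : ∀ a ∈ α, MapsTo (inducedMap T τ) a Y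
  one_lt_lam : 1 < lam
  Khat_nonneg : 0 ≤ Khat
  bijOn : ∀ a ∈ α, MeasureBijOn m (inducedMap T τ) a Y
  expanding : ∀ a ∈ α, ∀ x ∈ a, ∀ y ∈ a,
    lam * dist x y ≤ dist (inducedMap T τ x) (inducedMap T τ y)
  distortion : HasDistortion m (inducedMap T τ) α Khat

/-- `μ` is an `F`-invariant probability measure on `Y`, absolutely continuous with respect
to `m`; it is viewed as a measure on `M` supported on `Y`. -/
structure IsACIP (m : Measure M) (Y : Set M) (F : M → M) (μ : Measure M) : Prop where
  isProbabilityMeasure : IsProbabilityMeasure μ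
  supported : μ Yᶜ = 0
  absolutelyContinuous : μ ≪ m
  invariant : MeasurePreserving F μ μ

/-- Regular probability measures: `dρ = φ dμ` with `φ : Y → (0, ∞)` such that the Lipschitz
seminorm of `log φ` on `Y` is at most `R`. (`ρ` is supported on `Y` because `μ` is.) -/
def IsRegular (μ : Measure M) (Y : Set M) (R : ℝ) (ρ : Measure M) : Prop :=
  IsProbabilityMeasure ρ ∧ ρ Yᶜ = 0 ∧
    ∃ φ : M → ℝ, (∀ x ∈ Y, 0 < φ x) ∧
      (∀ x ∈ Y, ∀ y ∈ Y, |Real.log (φ x) - Real.log (φ y)| ≤ R * dist x y) ∧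
      ρ = μ.withDensity (fun x => ENNReal.ofReal (φ x))

/-- `ρ` is forward regular with disintegration `ρ = ∫ ρ_z dϰ(z)` over the probability space
`(E, ϰ)` and jump function `r`. -/
structure IsForwardRegular {E : Type*} [MeasurableSpace E] (T : M → M) (μ : Measure M)
    (Y : Set M) (R : ℝ) (ρ : Measure M) (ϰ : Measure E) (ρz : Kernel E M) (r : E → ℕ) :
    Prop where
  isProbabilityMeasure : IsProbabilityMeasure ϰ
  isMarkovKernel : IsMarkovKernel ρz
  measurable_jump : Measurable r
  disintegration : ρ = ϰ.bind ρz
  regular : ∀ z, IsRegular μ Y R ((ρz z).map T^[r z])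

end Setup

/-- `Z = sup_n |X_n - X'_n|`, with values in `[0, ∞]`. -/
noncomputable def supDist {Ω : Type*} {d : ℕ} (X X' : ℕ → Ω → EuclideanSpace ℝ (Fin d))
    (ω : Ω) : ℝ≥0∞ :=
  ⨆ n, ‖X n ω - X' n ω‖ₑ

/-- Admissible parameters `(λ, K, R', β, C_β, |v|_∞)` in the polynomial cases. -/
def polyParams : Set (ℝ × ℝ × ℝ × ℝ × ℝ × ℝ) :=
  {(lam, K, R, β, c, V) | 1 < lam ∧ 0 ≤ K ∧ K * lam / (lam - 1) < R ∧ 1 < β ∧ 0 < c ∧ 0 ≤ V}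

/-- Admissible parameters `(λ, K, R', α, γ, C_{α,γ}, |v|_∞)` in the (stretched) exponential
case. -/
def expParams : Set (ℝ × ℝ × ℝ × ℝ × ℝ × ℝ × ℝ) :=
  {(lam, K, R, a, γ, c, V) | 1 < lam ∧ 0 ≤ K ∧ K * lam / (lam - 1) < R ∧
    0 < a ∧ 0 < γ ∧ γ ≤ 1 ∧ 0 < c ∧ 0 ≤ V}

end NUE

namespace NUE

/-! ### Log-Lipschitz measures and their contraction under the induced map -/

section Regularity

variable {M : Type u} [MeasurableSpace M] [MetricSpace M]

/-! Everything rests on one contraction. A density on `Y` whose logarithm is `R`-Lipschitz, pushed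
through a branch of `F`, has log-Lipschitz constant `K + R / lam`: expansion divides the old
constant by `lam` and distortion adds `K`. Since `R > K * lam / (lam - 1)`, this is strictly below
`R`, and the slack allows a fixed fraction ξ (`splitRate`) of the mass to be removed as a multiple
of the reference measure, with a remainder that again has constant `R` (`LogLip.sub_smul`).
Regularity is expressed by masses of sets (`LogLip`), a condition linear in the measure, so it
passes to countable sums and mixtures with no choice of densities.

Coupling. From a forward regular measure, at every return to `Y` the fraction ξ of what is left is
declared regenerated: its image at that time is a multiple of `μ`. Lifting the removed pieces back
to the starting points decomposes `ρ` as the sum of measures `Θ n` whose images under `T^[n]` add up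
to `μ` (`exists_regeneration`). The regeneration time `N` is the initial jump plus a geometric
number of return times, each with conditional law at most `exp R` times the law of `τ` under `μ`, so
it inherits the tails and moments of the jump function and of `τ`. The Birkhoff sums of `x` and of
`T^[N] x` differ by at most `2 V N`, uniformly in time, and the sums started at `T^[N] x` have the
law of the process under `μ`, whichever of the two measures one started from. Gluing along this
common marginal gives `Z ≤ 2 V (N₁ + N₂)`.

Invariant measure. With normalized `m` on `Y` as reference measure `m_Y`, the same splitting gives
measures with `F_* η_k = ξ (1 - ξ)^k m_Y + η_{k+1}`, and `ξ ∑ η_k` is invariant. Its regularity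
yields the two-sided density bounds; averages over small cylinders produce a pointwise log-Lipschitz
density (`IsMarkovBase.exists_density`) and hence the distortion bound. Repeated splitting also
forces a strictly invariant set to have measure 0 or 1 (`IsMarkovBase.measure_invariant_le`,
`IsMarkovBase.ergodic`), which gives uniqueness. -/

lemma setLIntegral_mul_le {M : Type*} [MeasurableSpace M] {μ : Measure M} {A B : Set M}
    (hA : MeasurableSet A) (hB : MeasurableSet B) {f : M → ℝ≥0∞} {c : ℝ≥0∞} (hc : c ≠ ∞)
    (h : ∀ x ∈ A, ∀ y ∈ B, f x ≤ c * f y) :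
    (∫⁻ x in A, f x ∂μ) * μ B ≤ c * (μ A * ∫⁻ x in B, f x ∂μ) := by
  calc (∫⁻ x in A, f x ∂μ) * μ B ≤ ∫⁻ x in A, f x * μ B ∂μ := lintegral_mul_const_le _ _
    _ ≤ ∫⁻ _ in A, c * ∫⁻ y in B, f y ∂μ ∂μ := by
        refine setLIntegral_mono' hA fun x hx => ?_
        rw [← setLIntegral_const, ← lintegral_const_mul' _ _ hc]
        exact setLIntegral_mono' hB fun y hy => h x hx y hy
    _ = _ := by rw [setLIntegral_const]; ring

/-- A measure `ν` on `Y` whose density with respect to `μ` has an `R`-Lipschitz logarithm,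
expressed without densities: the averages of the density over two sets of points at
distance at most `δ` differ by a factor of at most `exp (R δ)`. -/
def LogLip (μ : Measure M) (Y : Set M) (R : ℝ) (ν : Measure M) : Prop :=
  ν Yᶜ = 0 ∧ ∀ A B : Set M, MeasurableSet A → MeasurableSet B → A ⊆ Y → B ⊆ Y →
    ∀ δ : ℝ, 0 ≤ δ → δ ≤ 1 → (∀ x ∈ A, ∀ y ∈ B, dist x y ≤ δ) →
      ν A * μ B ≤ ENNReal.ofReal (Real.exp (R * δ)) * (ν B * μ A)

/-- `F` is a full-branch Markov map on `Y` with bounded distortion with respect to the probability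
measure `μ`, which need not be invariant. -/
structure IsMarkovBase (μ : Measure M) (Y : Set M) (F : M → M) (α : Set (Set M))
    (lam K : ℝ) : Prop where
  isProbabilityMeasure : IsProbabilityMeasure μ
  measurableSet_base : MeasurableSet Y
  supported : μ Yᶜ = 0
  dist_le_one : ∀ x ∈ Y, ∀ y ∈ Y, dist x y ≤ 1
  countable_partition : α.Countable
  measurableSet_of_mem : ∀ a ∈ α, MeasurableSet a
  subset_base : ∀ a ∈ α, a ⊆ Y
  pairwiseDisjoint : α.PairwiseDisjoint id
  cover : μ (Y \ ⋃₀ α) = 0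
  measurable_map : Measurable F
  mapsTo : ∀ a ∈ α, MapsTo F a Y
  image_ae : ∀ a ∈ α, μ (Y \ F '' a) = 0
  one_lt_lam : 1 < lam
  K_nonneg : 0 ≤ K
  expanding : ∀ a ∈ α, ∀ x ∈ a, ∀ y ∈ a, lam * dist x y ≤ dist (F x) (F y)
  distortion : HasDistortion μ F α K

variable {μ ν : Measure M} {Y : Set M} {F : M → M} {α : Set (Set M)} {lam K R R₁ : ℝ}

lemma LogLip.smul (h : LogLip μ Y R ν) (c : ℝ≥0∞) : LogLip μ Y R (c • ν) := by
  refine ⟨by simp [h.1], fun A B hA hB hAY hBY δ h0 h1 hd => ?_⟩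
  have := mul_le_mul_right (h.2 A B hA hB hAY hBY δ h0 h1 hd) c
  simp only [Measure.smul_apply, smul_eq_mul]
  calc c * ν A * μ B = c * (ν A * μ B) := by ring
    _ ≤ _ := this
    _ = _ := by ring

/-- The defining inequality is linear in `ν`, so it adds up. This is the advantage of masses over
logarithms of densities. -/
lemma LogLip.sum {ι : Type*} {ν : ι → Measure M} (hY : MeasurableSet Y)
    (h : ∀ i, LogLip μ Y R (ν i)) : LogLip μ Y R (Measure.sum ν) := by
  refine ⟨?_, fun A B hA hB hAY hBY δ h0 h1 hd => ?_⟩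
  · rw [Measure.sum_apply _ hY.compl]
    simp [fun i => (h i).1]
  · rw [Measure.sum_apply _ hA, Measure.sum_apply _ hB, ← ENNReal.tsum_mul_right,
      ← ENNReal.tsum_mul_right, ← ENNReal.tsum_mul_left]
    exact ENNReal.tsum_le_tsum fun i => (h i).2 A B hA hB hAY hBY δ h0 h1 hd

lemma LogLip.measure_inter (h : LogLip μ Y R ν) (A : Set M) : ν (A ∩ Y) = ν A :=
  measure_inter_conull h.1

lemma LogLip.measure_base (h : LogLip μ Y R ν) : ν Y = ν univ := by
  rw [← h.measure_inter univ, univ_inter]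

lemma logLip_self (h0 : μ Yᶜ = 0) (hR : 0 ≤ R) : LogLip μ Y R μ := by
  refine ⟨h0, fun A B hA hB hAY hBY δ h0 h1 hd => ?_⟩
  have : (1 : ℝ≥0∞) ≤ ENNReal.ofReal (Real.exp (R * δ)) := by
    rw [ENNReal.one_le_ofReal]
    exact Real.one_le_exp (by positivity)
  calc μ A * μ B = 1 * (μ B * μ A) := by ring
    _ ≤ _ := by gcongr

namespace IsMarkovBase

variable (hb : IsMarkovBase μ Y F α lam K)
include hb

lemma measure_base : μ Y = 1 := by
  have := hb.isProbabilityMeasure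
  rw [← measure_univ (μ := μ), ← univ_inter Y]
  exact measure_inter_conull hb.supported

/-- Comparison with the whole of `Y` at scale 1, since `Y` has diameter at most 1. Together with
`le_smul'` it pins the density between `exp (-R)` and `exp R` times the total mass. -/
lemma le_smul (h : LogLip μ Y R ν) :
    ν ≤ (ENNReal.ofReal (Real.exp R) * ν univ) • μ := by
  refine Measure.le_intro fun A hA _ => ?_
  have hm := hA.inter hb.measurableSet_base
  have := h.2 _ _ hm hb.measurableSet_base inter_subset_right subset_rfl 1 zero_le_one le_rfl
    fun x hx y hy => hb.dist_le_one x hx.2 y hy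
  rw [hb.measure_base, h.measure_inter, mul_one, mul_one, h.measure_base,
    measure_inter_conull hb.supported] at this
  simpa [mul_assoc] using this

lemma le_smul' (h : LogLip μ Y R ν) {A : Set M} (hA : MeasurableSet A) :
    ν univ * μ A ≤ ENNReal.ofReal (Real.exp R) * ν A := by
  have hm := hA.inter hb.measurableSet_base
  have := h.2 _ _ hb.measurableSet_base hm subset_rfl inter_subset_right 1 zero_le_one le_rfl
    fun x hx y hy => hb.dist_le_one x hx y hy.2
  rwa [hb.measure_base, h.measure_inter, mul_one, mul_one, h.measure_base,
    measure_inter_conull hb.supported] at this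

lemma absolutelyContinuous (h : LogLip μ Y R ν) : ν ≪ μ :=
  (Measure.absolutelyContinuous_of_le (hb.le_smul h)).trans Measure.smul_absolutelyContinuous

lemma measure_image {a A : Set M} (ha : a ∈ α) (hAY : A ⊆ Y) :
    μ (F '' (a ∩ F ⁻¹' A)) = μ A := by
  rw [image_inter_preimage]
  refine le_antisymm (measure_mono inter_subset_right) ?_
  calc μ A ≤ μ (F '' a ∩ A ∪ Y \ F '' a) := measure_mono fun x hx => by
        by_cases h : x ∈ F '' a
        · exact .inl ⟨h, hx⟩
        · exact .inr ⟨hAY hx, h⟩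
    _ ≤ μ (F '' a ∩ A) + μ (Y \ F '' a) := measure_union_le _ _
    _ = _ := by rw [hb.image_ae a ha, add_zero]

/-- On one branch `μ A` and `μ B` are the integrals of `ζ⁻¹` over the two preimages, and the
distortion bound makes the values of `ζ⁻¹` on them comparable up to `exp (K * δ)`. -/
lemma measure_preimage_mul_le {a A B : Set M} (ha : a ∈ α) (hA : MeasurableSet A)
    (hB : MeasurableSet B) (hAY : A ⊆ Y) (hBY : B ⊆ Y) {δ : ℝ}
    (hd : ∀ x ∈ A, ∀ y ∈ B, dist x y ≤ δ) :
    μ (a ∩ F ⁻¹' A) * μ B ≤ ENNReal.ofReal (Real.exp (K * δ)) * (μ (a ∩ F ⁻¹' B) * μ A) := by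
  obtain ⟨ζ, hζ, hdist⟩ := hb.distortion
  obtain ⟨⟨hpos, hJ⟩, hlip⟩ := hdist a ha
  have hma := hb.measurableSet_of_mem a ha
  have hA' := hma.inter (hb.measurable_map hA)
  have hB' := hma.inter (hb.measurable_map hB)
  have eA := hJ _ inter_subset_left hA'
  have eB := hJ _ inter_subset_left hB'
  rw [hb.measure_image ha hAY] at eA
  rw [hb.measure_image ha hBY] at eB
  rw [eA, eB]
  refine (mul_comm _ _).trans_le ((setLIntegral_mul_le hB' hA' ENNReal.ofReal_ne_top
    fun x hx y hy => ?_))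
  rw [← ENNReal.ofReal_mul (Real.exp_pos _).le]
  refine ENNReal.ofReal_le_ofReal ?_
  have hx0 := hpos x hx.1
  have hy0 := hpos y hy.1
  have h1 := (abs_le.1 (hlip y hy.1 x hx.1)).2
  have h2 : K * dist (F y) (F x) ≤ K * δ :=
    mul_le_mul_of_nonneg_left (hd _ hy.2 _ hx.2) hb.K_nonneg
  rw [← Real.exp_log (inv_pos.2 hx0), ← Real.exp_log (inv_pos.2 hy0), ← Real.exp_add,
    Real.exp_le_exp, Real.log_inv, Real.log_inv]
  linarith

/-- The push-forward by one branch improves the regularity. -/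
lemma logLip_map_restrict (h : LogLip μ Y R ν) {a : Set M} (ha : a ∈ α) :
    LogLip μ Y (K + R / lam) ((ν.restrict a).map F) := by
  have hma := hb.measurableSet_of_mem a ha
  have hlam : 0 < lam := zero_lt_one.trans hb.one_lt_lam
  have hprob := hb.isProbabilityMeasure
  have key : ∀ A, MeasurableSet A → (ν.restrict a).map F A = ν (a ∩ F ⁻¹' A) := fun A hA => by
    rw [Measure.map_apply hb.measurable_map hA, Measure.restrict_apply (hb.measurable_map hA),
      inter_comm]
  refine ⟨?_, fun A B hA hB hAY hBY δ h0 h1 hd => ?_⟩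
  · rw [key _ hb.measurableSet_base.compl]
    convert! measure_empty (μ := ν)
    exact eq_empty_of_forall_notMem fun x hx => hx.2 (hb.mapsTo a ha hx.1)
  rw [key A hA, key B hB]
  have hA' := hma.inter (hb.measurable_map hA)
  have hB' := hma.inter (hb.measurable_map hB)
  -- Expansion puts the two preimages within `δ / lam` of each other; this is where `R` improves to
  -- `R / lam`.
  have e1 := h.2 _ _ hA' hB' (inter_subset_left.trans (hb.subset_base a ha))
    (inter_subset_left.trans (hb.subset_base a ha)) (δ / lam) (by positivity)
    ((div_le_self h0 hb.one_lt_lam.le).trans h1) fun x hx y hy => by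
      rw [le_div_iff₀' hlam]
      exact (hb.expanding a ha x hx.1 y hy.1).trans (hd _ hx.2 _ hy.2)
  have e2 := hb.measure_preimage_mul_le ha hA hB hAY hBY hd
  have hac := hb.absolutelyContinuous h
  rcases eq_or_ne (μ (a ∩ F ⁻¹' A)) 0 with hzA | hzA
  · rw [hac hzA]; simp
  rcases eq_or_ne (μ (a ∩ F ⁻¹' B)) 0 with hzB | hzB
  · have : μ (a ∩ F ⁻¹' A) * μ B = 0 := by
      refine le_antisymm (e2.trans ?_) zero_le
      simp [hzB]
    rcases mul_eq_zero.1 this with h' | h'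
    · exact absurd h' hzA
    · simp [h']
  -- The ratio of pushed mass to `μ A` is the average density on the preimage times the Jacobian
  -- ratio. Multiplying by the masses of both preimages, nonzero by the case splits above, separates
  -- the two factors.
  refine (ENNReal.mul_le_mul_iff_left (mul_ne_zero hzA hzB)
    (ENNReal.mul_ne_top (measure_ne_top _ _) (measure_ne_top _ _))).1 ?_
  have hexp : ENNReal.ofReal (Real.exp ((K + R / lam) * δ)) =
      ENNReal.ofReal (Real.exp (K * δ)) * ENNReal.ofReal (Real.exp (R * (δ / lam))) := by
    rw [← ENNReal.ofReal_mul (Real.exp_pos _).le, ← Real.exp_add]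
    ring_nf
  calc ν (a ∩ F ⁻¹' A) * μ B * (μ (a ∩ F ⁻¹' A) * μ (a ∩ F ⁻¹' B))
      = (ν (a ∩ F ⁻¹' A) * μ (a ∩ F ⁻¹' B)) * (μ (a ∩ F ⁻¹' A) * μ B) := by ring
    _ ≤ (ENNReal.ofReal (Real.exp (R * (δ / lam))) * (ν (a ∩ F ⁻¹' B) * μ (a ∩ F ⁻¹' A))) *
        (ENNReal.ofReal (Real.exp (K * δ)) * (μ (a ∩ F ⁻¹' B) * μ A)) := mul_le_mul' e1 e2
    _ = _ := by rw [hexp]; ring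

/-- The push-forward of the part of a regular measure on a union of elements of the partition. -/
lemma logLip_map_restrict_of_forall (h : LogLip μ Y R ν) {S : Set M}
    (hα : ∀ a ∈ α, a ⊆ S ∨ Disjoint a S) :
    LogLip μ Y (K + R / lam) ((ν.restrict S).map F) := by
  set α' : Set (Set M) := {a ∈ α | a ⊆ S}
  have hα' : α'.Countable := hb.countable_partition.mono (sep_subset _ _)
  have hU : MeasurableSet (⋃₀ α') :=
    .sUnion hα' fun a ha => hb.measurableSet_of_mem a ha.1
  have hnull : ν (S \ ⋃₀ α') = 0 := by
    have h1 : S \ ⋃₀ α' ⊆ Yᶜ ∪ (Y \ ⋃₀ α) := fun x hx => by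
      by_cases hxY : x ∈ Y
      · refine .inr ⟨hxY, fun ⟨a, ha, hxa⟩ => hx.2 ⟨a, ⟨ha, ?_⟩, hxa⟩⟩
        exact (hα a ha).resolve_right fun hdis => hdis.notMem_of_mem_left hxa hx.1
      · exact .inl hxY
    exact measure_mono_null h1 (measure_union_null h.1 (hb.absolutelyContinuous h hb.cover))
  have e : ν.restrict S = Measure.sum fun a : α' => ν.restrict a := by
    have : Countable α' := hα'.to_subtype
    rw [← Measure.restrict_iUnion (s := fun a : α' => (a : Set M)) (fun a b hab =>
      hb.pairwiseDisjoint a.2.1 b.2.1 (Subtype.coe_ne_coe.2 hab))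
      (fun a => hb.measurableSet_of_mem a a.2.1), ← sUnion_eq_iUnion]
    refine Measure.restrict_congr_set ?_
    refine (ae_eq_set.2 ⟨hnull, ?_⟩)
    rw [sdiff_eq_empty.2 (sUnion_subset fun a ha => ha.2), measure_empty]
  rw [e, Measure.map_sum hb.measurable_map.aemeasurable]
  exact .sum hb.measurableSet_base fun a => hb.logLip_map_restrict h a.2.1

end IsMarkovBase

/-- The proportion of a regular measure that is removed at each return. -/
noncomputable def splitRate (lam K R : ℝ) : ℝ :=
  Real.exp (-(K + R / lam) - R) * (R - (K + R / lam)) / R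

/-- Subtracting `c • μ` with `c` small relative to the density worsens the log-Lipschitz constant
only slightly, and the gap `R - R₁` absorbs this. The value of `ξ` solves `ξ * exp R₁ * (R * exp R)
= R - R₁`, which is what the comparison at scale `δ` needs. -/
lemma LogLip.sub_smul [IsFiniteMeasure ν] (hb : IsMarkovBase μ Y F α lam K)
    (h : LogLip μ Y R₁ ν) (h0 : 0 ≤ R₁) (hR : R₁ < R) {ξ : ℝ}
    (hξ : ξ = Real.exp (-R₁ - R) * (R - R₁) / R) :
    (ENNReal.ofReal ξ * ν univ) • μ ≤ ν ∧
      LogLip μ Y R (ν - (ENNReal.ofReal ξ * ν univ) • μ) := by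
  have hprob := hb.isProbabilityMeasure
  have hR0 : 0 < R := h0.trans_lt hR
  have hξ0 : 0 ≤ ξ := by
    rw [hξ]; have := sub_pos.2 hR; positivity
  have hξ1 : ξ * Real.exp R₁ ≤ 1 := by
    rw [hξ]
    have e1 : Real.exp (-R₁ - R) * Real.exp R₁ = Real.exp (-R) := by
      rw [← Real.exp_add]; ring_nf
    calc Real.exp (-R₁ - R) * (R - R₁) / R * Real.exp R₁
        = (Real.exp (-R₁ - R) * Real.exp R₁) * ((R - R₁) / R) := by ring
      _ = Real.exp (-R) * ((R - R₁) / R) := by rw [e1]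
      _ ≤ 1 * 1 := mul_le_mul (Real.exp_le_one_iff.2 (by linarith))
          ((div_le_one hR0).2 (by linarith)) (div_nonneg (sub_pos.2 hR).le hR0.le) zero_le_one
      _ = 1 := one_mul 1
  have hfin : (ENNReal.ofReal ξ * ν univ) ≠ ∞ :=
    ENNReal.mul_ne_top ENNReal.ofReal_ne_top (measure_ne_top _ _)
  have : IsFiniteMeasure ((ENNReal.ofReal ξ * ν univ) • μ) := by
    refine ⟨?_⟩
    simp [ENNReal.mul_lt_top_iff, measure_lt_top]
  have hle : (ENNReal.ofReal ξ * ν univ) • μ ≤ ν := by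
    refine Measure.le_intro fun A hA _ => ?_
    calc ((ENNReal.ofReal ξ * ν univ) • μ) A = ENNReal.ofReal ξ * (ν univ * μ A) := by
          simp [mul_assoc]
      _ ≤ ENNReal.ofReal ξ * (ENNReal.ofReal (Real.exp R₁) * ν A) := by
          exact mul_le_mul_right (hb.le_smul' h hA) _
      _ = ENNReal.ofReal (ξ * Real.exp R₁) * ν A := by
          rw [ENNReal.ofReal_mul hξ0, mul_assoc]
      _ ≤ 1 * ν A := by
          gcongr; exact ENNReal.ofReal_le_one.2 hξ1
      _ = ν A := one_mul _
  refine ⟨hle, ?_, fun A B hA hB hAY hBY δ hδ0 hδ1 hd => ?_⟩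
  · exact le_antisymm ((Measure.sub_le _).trans h.1.le) zero_le
  rw [Measure.sub_apply hA hle, Measure.sub_apply hB hle]
  have e1 := h.2 A B hA hB hAY hBY δ hδ0 hδ1 hd
  have e2 := hb.le_smul' h hB
  have hA' := hle A
  have hB' := hle B
  simp only [Measure.smul_apply, smul_eq_mul] at hA' hB' ⊢
  have f1 := measure_ne_top ν univ
  have f2 := measure_ne_top ν A
  have f3 := measure_ne_top ν B
  have f4 := measure_ne_top μ A
  have f5 := measure_ne_top μ B
  lift ν univ to NNReal using f1 with n
  lift ν A to NNReal using f2 with nA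
  lift ν B to NNReal using f3 with nB
  lift μ A to NNReal using f4 with mA
  lift μ B to NNReal using f5 with mB
  simp only [ENNReal.ofReal] at e1 e2 hA' hB' ⊢
  norm_cast at e1 e2 hA' hB' ⊢
  rw [← NNReal.coe_le_coe] at e1 e2 hA' hB' ⊢
  push_cast [NNReal.coe_sub, hA', hB'] at e1 e2 hA' hB' ⊢
  rw [NNReal.coe_sub (by exact_mod_cast hA'), NNReal.coe_sub (by exact_mod_cast hB')]
  push_cast
  simp only [Real.coe_toNNReal _ (Real.exp_pos _).le, Real.coe_toNNReal _ hξ0] at e1 e2 hA' hB' ⊢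
  -- The restriction `δ ≤ 1` in `LogLip` enters here: it bounds `exp (R * δ)` by `exp R`, uniformly
  -- in `δ`.
  have k1 : Real.exp (R * δ) - 1 ≤ R * δ * Real.exp R := by
    have h1 := Real.add_one_le_exp (-(R * δ))
    have h2 : Real.exp (-(R * δ)) * Real.exp (R * δ) = 1 := by rw [← Real.exp_add]; simp
    have h3 : Real.exp (R * δ) ≤ Real.exp R :=
      Real.exp_le_exp.2 (mul_le_of_le_one_right hR0.le hδ1)
    have h4 := mul_le_mul_of_nonneg_right h1 (Real.exp_pos (R * δ)).le
    have h5 := mul_le_mul_of_nonneg_left h3 (mul_nonneg hR0.le hδ0)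
    linarith
  have k2 : (R - R₁) * δ ≤ Real.exp (R * δ) - Real.exp (R₁ * δ) := by
    have h1 := Real.add_one_le_exp ((R - R₁) * δ)
    have h2 : Real.exp (R * δ) = Real.exp ((R - R₁) * δ) * Real.exp (R₁ * δ) := by
      rw [← Real.exp_add]; ring_nf
    have h3 : 1 ≤ Real.exp (R₁ * δ) := Real.one_le_exp (by positivity)
    have h4 : 0 ≤ (R - R₁) * δ := mul_nonneg (sub_pos.2 hR).le hδ0
    nlinarith
  -- Since `ν B ≥ exp (-R₁) * ν univ * μ B`, this scalar inequality is all that remains to be shown.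
  have k3 : ξ * Real.exp R₁ * (Real.exp (R * δ) - 1) ≤
      Real.exp (R * δ) - Real.exp (R₁ * δ) := by
    have e : ξ * Real.exp R₁ * (R * δ * Real.exp R) = (R - R₁) * δ := by
      have e' : Real.exp (-R₁ - R) = (Real.exp R₁)⁻¹ * (Real.exp R)⁻¹ := by
        rw [← Real.exp_neg, ← Real.exp_neg, ← Real.exp_add]; ring_nf
      rw [hξ, e']
      field_simp
    calc _ ≤ ξ * Real.exp R₁ * (R * δ * Real.exp R) := by gcongr
      _ = (R - R₁) * δ := e
      _ ≤ _ := k2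
  have k4 : 0 ≤ Real.exp (R * δ) - 1 := sub_nonneg.2 (Real.one_le_exp (by positivity))
  have k5 := mul_le_mul_of_nonneg_left e2 (mul_nonneg hξ0 k4)
  have k6 := mul_le_mul_of_nonneg_right k3 nB.coe_nonneg
  have k7 := mul_le_mul_of_nonneg_right (k5.trans (le_of_eq_of_le (by ring) k6)) mA.coe_nonneg
  linarith

end Regularity
-- Regeneration: splitting off `μ` at successive returns
section Splitting

/-- A part of the image measure lifts to a part of the source: weight `ρ` by the density of `η`
relative to the image, composed with `f`. That density is at most 1 because `η` lies below the
image. -/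
lemma exists_le_map_eq {M N : Type*} [MeasurableSpace M] [MeasurableSpace N] {f : M → N}
    (hf : Measurable f) (ρ : Measure M) [IsFiniteMeasure ρ] {η : Measure N} (h : η ≤ ρ.map f) :
    ∃ ρ' ≤ ρ, ρ'.map f = η := by
  have : IsFiniteMeasure η := isFiniteMeasure_of_le _ h
  have hg := Measure.measurable_rnDeriv η (ρ.map f)
  have hle : ∀ᵐ x ∂ρ, η.rnDeriv (ρ.map f) (f x) ≤ 1 :=
    ae_of_ae_map hf.aemeasurable (Measure.rnDeriv_le_one_of_le h)
  refine ⟨ρ.withDensity fun x => η.rnDeriv (ρ.map f) (f x), ?_, ?_⟩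
  · calc _ ≤ ρ.withDensity 1 := withDensity_mono hle
      _ = ρ := withDensity_one
  · conv_rhs => rw [← Measure.withDensity_rnDeriv_eq η (ρ.map f)
      (Measure.absolutelyContinuous_of_le h)]
    ext A hA
    rw [Measure.map_apply hf hA, withDensity_apply _ (hf hA), withDensity_apply _ hA,
      setLIntegral_map hA hg hf]

/-- The map `R ↦ K + R / lam` has fixed point `K * lam / (lam - 1)`; above it, it strictly decreases
`R`. -/
lemma splitRate_aux {lam K R : ℝ} (hlam : 1 < lam) (hR : K * lam / (lam - 1) < R) :
    K + R / lam < R := by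
  have h1 : 0 < lam - 1 := sub_pos.2 hlam
  have h0 : 0 < lam := zero_lt_one.trans hlam
  rw [div_lt_iff₀ h1] at hR
  have : K + R / lam = (K * lam + R) / lam := by field_simp
  rw [this, div_lt_iff₀ h0]
  linarith

lemma pos_of_lt {lam K R : ℝ} (hlam : 1 < lam) (hK : 0 ≤ K) (hR : K * lam / (lam - 1) < R) :
    0 < R := by
  have h1 : 0 < lam - 1 := sub_pos.2 hlam
  exact lt_of_le_of_lt (by positivity) hR

lemma splitRate_pos {lam K R : ℝ} (hlam : 1 < lam) (hK : 0 ≤ K)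
    (hR : K * lam / (lam - 1) < R) : 0 < splitRate lam K R := by
  have h1 := sub_pos.2 (splitRate_aux hlam hR)
  have h2 := pos_of_lt hlam hK hR
  unfold splitRate
  positivity

lemma splitRate_lt_one {lam K R : ℝ} (hlam : 1 < lam) (hK : 0 ≤ K)
    (hR : K * lam / (lam - 1) < R) : splitRate lam K R < 1 := by
  have h0 : 0 < lam := zero_lt_one.trans hlam
  have h1 := sub_pos.2 (splitRate_aux hlam hR)
  have h2 := pos_of_lt hlam hK hR
  have h3 : 0 ≤ K + R / lam := by positivity
  unfold splitRate
  rw [div_lt_one h2]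
  calc _ < 1 * (R - (K + R / lam)) :=
        mul_lt_mul_of_pos_right (Real.exp_lt_one_iff.2 (by linarith)) h1
    _ ≤ R := by linarith

variable {M : Type u} [MeasurableSpace M] [MetricSpace M]
  {μ : Measure M} {T : M → M} {τ : M → ℕ} {Y : Set M} {α : Set (Set M)} {lam K R : ℝ}

omit [MetricSpace M] in
lemma measurable_inducedMap (hT : Measurable T) (hτ : Measurable τ) :
    Measurable (inducedMap T τ) := by
  intro A hA
  have : inducedMap T τ ⁻¹' A = ⋃ n, τ ⁻¹' {n} ∩ T^[n] ⁻¹' A := by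
    ext x
    simp [inducedMap]
  rw [this]
  exact .iUnion fun n => (hτ (measurableSet_singleton n)).inter ((hT.iterate n) hA)

/-- Splitting off a multiple of `μ` from the part of a measure that returns at time `j`. -/
lemma exists_split (hb : IsMarkovBase μ Y (inducedMap T τ) α lam K)
    (hR : K * lam / (lam - 1) < R) (hT : Measurable T) (hτ : Measurable τ)
    (hconst : ∀ a ∈ α, ∃ n : ℕ, ∀ y ∈ a, τ y = n) (ρ : Measure M) [IsFiniteMeasure ρ] (n j : ℕ)
    (h : LogLip μ Y R (ρ.map T^[n])) :
    ∃ s u : Measure M, s + u = ρ.restrict (T^[n] ⁻¹' (τ ⁻¹' {j})) ∧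
      s.map T^[n + j] = (s univ) • μ ∧
      s univ = ENNReal.ofReal (splitRate lam K R) * ρ (T^[n] ⁻¹' (τ ⁻¹' {j})) ∧
      u univ = ENNReal.ofReal (1 - splitRate lam K R) * ρ (T^[n] ⁻¹' (τ ⁻¹' {j})) ∧
      LogLip μ Y R (u.map T^[n + j]) := by
  have hprob := hb.isProbabilityMeasure
  have hlam0 : 0 < lam := zero_lt_one.trans hb.one_lt_lam
  have hR0 := pos_of_lt hb.one_lt_lam hb.K_nonneg hR
  have hξ0 := splitRate_pos hb.one_lt_lam hb.K_nonneg hR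
  have hξ1 := splitRate_lt_one hb.one_lt_lam hb.K_nonneg hR
  have hK := hb.K_nonneg
  set S := τ ⁻¹' {j}
  have hS : MeasurableSet S := hτ (measurableSet_singleton j)
  set ρj := ρ.restrict (T^[n] ⁻¹' S)
  have hmap : ρj.map T^[n + j] = ((ρ.map T^[n]).restrict S).map (inducedMap T τ) := by
    rw [add_comm, Function.iterate_add, ← Measure.map_map (hT.iterate j) (hT.iterate n),
      ← Measure.restrict_map (hT.iterate n) hS]
    refine Measure.map_congr ?_
    filter_upwards [ae_restrict_mem hS] with x hx
    have : τ x = j := hx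
    simp [inducedMap, this]
  have hreg : LogLip μ Y (K + R / lam) (ρj.map T^[n + j]) := by
    rw [hmap]
    refine hb.logLip_map_restrict_of_forall h fun a ha => ?_
    obtain ⟨m, hm⟩ := hconst a ha
    by_cases hmj : m = j
    · exact .inl fun x hx => (hm x hx).trans hmj
    · exact .inr (disjoint_left.2 fun x hx hxS => hmj ((hm x hx).symm.trans hxS))
  have huniv : ρj.map T^[n + j] univ = ρ (T^[n] ⁻¹' S) := by
    rw [Measure.map_apply (hT.iterate _) .univ, preimage_univ, Measure.restrict_apply_univ]
  obtain ⟨hle, hsub⟩ := hreg.sub_smul hb (ξ := splitRate lam K R) (by positivity)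
    (splitRate_aux hb.one_lt_lam hR) rfl
  -- The multiple of `μ` is found in the image at time `n + j`; it is pulled back so that the
  -- decomposition concerns the original measure.
  obtain ⟨s, hs, hsmap⟩ := exists_le_map_eq (hT.iterate (n + j)) ρj hle
  have : IsFiniteMeasure s := isFiniteMeasure_of_le _ hs
  have hsuniv : s univ = ENNReal.ofReal (splitRate lam K R) * ρ (T^[n] ⁻¹' S) := by
    have := congrArg (fun m => m univ) hsmap
    simpa [Measure.map_apply (hT.iterate _) .univ, huniv, ρj] using this
  have hadd : s + (ρj - s) = ρj := by rw [add_comm, Measure.sub_add_cancel_of_le hs]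
  refine ⟨s, ρj - s, hadd, ?_, hsuniv, ?_, ?_⟩
  · rw [hsmap, huniv, hsuniv]
  · rw [Measure.sub_apply .univ hs, hsuniv, Measure.restrict_apply_univ,
      ENNReal.ofReal_sub _ hξ0.le, ENNReal.ofReal_one, ENNReal.sub_mul, one_mul]
    exact fun _ _ => measure_ne_top _ _
  · convert hsub using 1
    rw [← hsmap]
    have e : ρj.map T^[n + j] = s.map T^[n + j] + (ρj - s).map T^[n + j] := by
      rw [← Measure.map_add _ _ (hT.iterate _), hadd]
    rw [e, add_comm (s.map _), Measure.add_sub_cancel]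

lemma tsum_fiber {ι κ : Type*} (g : ι → κ) (f : ι → ℝ≥0∞) :
    ∑' N, ∑' p : {p // g p = N}, f p = ∑' p, f p := by
  rw [← (Equiv.sigmaFiberEquiv g).tsum_eq, ENNReal.tsum_sigma']
  rfl

/-- One step of the regeneration scheme. The measure `Q n` has been pushed by `T^[n]` and is not
yet regenerated, `Q'` is what remains after one more return to the base and `S` is what
regenerates there; `P n j` is the mass of `Q n` that returns after `j` further iterates. -/
structure IsRegenerationStep (μ : Measure M) (T : M → M) (τ : M → ℕ) (Y : Set M) (R ξ : ℝ)
    (Q Q' S : ℕ → Measure M) (P : ℕ → ℕ → ℝ≥0∞) : Prop where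
  regular : ∀ n, LogLip μ Y R ((Q' n).map T^[n])
  sum_add : Measure.sum Q' + Measure.sum S = Measure.sum Q
  map_eq : ∀ n, (S n).map T^[n] = (S n univ) • μ
  tsum_P : ∀ n, ∑' j, P n j = Q n univ
  P_le : ∀ n j, P n j ≤ ENNReal.ofReal (Real.exp R) * (Q n univ * μ (τ ⁻¹' {j}))
  mass_remaining : ∀ w : ℕ → ℝ≥0∞, ∑' N, Q' N univ * w N =
    ENNReal.ofReal (1 - ξ) * ∑' n, ∑' j, P n j * w (n + j)
  mass_regenerated : ∀ w : ℕ → ℝ≥0∞, ∑' N, S N univ * w N =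
    ENNReal.ofReal ξ * ∑' n, ∑' j, P n j * w (n + j)

/-- Mass pushed by `T^[n]` whose next return takes `j` iterates is split by `exists_split` and both
pieces are filed under the total time `N = n + j`. Fixing a single `N` still mixes many pairs `(n,
j)`, which is harmless because regularity survives sums. -/
lemma exists_isRegenerationStep (hb : IsMarkovBase μ Y (inducedMap T τ) α lam K)
    (hR : K * lam / (lam - 1) < R) (hT : Measurable T) (hτ : Measurable τ)
    (hconst : ∀ a ∈ α, ∃ n : ℕ, ∀ y ∈ a, τ y = n) (Q : ℕ → Measure M)
    [IsFiniteMeasure (Measure.sum Q)] (h : ∀ n, LogLip μ Y R ((Q n).map T^[n])) :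
    ∃ (Q' S : ℕ → Measure M) (P : ℕ → ℕ → ℝ≥0∞),
      IsRegenerationStep μ T τ Y R (splitRate lam K R) Q Q' S P := by
  have hfin : ∀ n, IsFiniteMeasure (Q n) := fun n => isFiniteMeasure_of_le _ (Measure.le_sum Q n)
  choose s u hadd hsmap hs hu hureg using fun n j =>
    exists_split hb hR hT hτ hconst (Q n) n j (h n)
  have hτj : ∀ j, MeasurableSet (τ ⁻¹' {j}) := fun j => hτ (measurableSet_singleton j)
  have hmass : ∀ (m : ℕ → ℕ → Measure M) (c : ℝ≥0∞)
      (_ : ∀ n j, m n j univ = c * Q n (T^[n] ⁻¹' (τ ⁻¹' {j}))) (w : ℕ → ℝ≥0∞),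
      ∑' N, Measure.sum (fun p : {p : ℕ × ℕ // p.1 + p.2 = N} => m p.1.1 p.1.2) univ * w N =
        c * ∑' n, ∑' j, Q n (T^[n] ⁻¹' (τ ⁻¹' {j})) * w (n + j) := by
    intro m c hm w
    calc _ = ∑' N, ∑' p : {p : ℕ × ℕ // p.1 + p.2 = N},
          c * (Q p.1.1 (T^[p.1.1] ⁻¹' (τ ⁻¹' {p.1.2})) * w (p.1.1 + p.1.2)) := by
          refine tsum_congr fun N => ?_
          rw [Measure.sum_apply _ .univ, ← ENNReal.tsum_mul_right]
          refine tsum_congr fun p => ?_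
          rw [hm, p.2, mul_assoc]
      _ = ∑' p : ℕ × ℕ, c * (Q p.1 (T^[p.1] ⁻¹' (τ ⁻¹' {p.2})) * w (p.1 + p.2)) :=
          tsum_fiber (fun p : ℕ × ℕ => p.1 + p.2)
            fun p => c * (Q p.1 (T^[p.1] ⁻¹' (τ ⁻¹' {p.2})) * w (p.1 + p.2))
      _ = _ := by
          rw [ENNReal.tsum_mul_left,
            ENNReal.tsum_prod (f := fun n j => Q n (T^[n] ⁻¹' (τ ⁻¹' {j})) * w (n + j))]
  refine ⟨fun N => Measure.sum fun p : {p : ℕ × ℕ // p.1 + p.2 = N} => u p.1.1 p.1.2,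
    fun N => Measure.sum fun p : {p : ℕ × ℕ // p.1 + p.2 = N} => s p.1.1 p.1.2,
    fun n j => Q n (T^[n] ⁻¹' (τ ⁻¹' {j})), ?_, ?_, ?_, ?_, ?_, hmass u _ hu, hmass s _ hs⟩
  · intro N
    rw [Measure.map_sum (hT.iterate N).aemeasurable]
    refine .sum hb.measurableSet_base ?_
    rintro ⟨p, rfl⟩
    exact hureg p.1 p.2
  · ext A hA
    have e : ∀ m : ℕ → ℕ → Measure M, Measure.sum (fun N => Measure.sum
        fun p : {p : ℕ × ℕ // p.1 + p.2 = N} => m p.1.1 p.1.2) A = ∑' n, ∑' j, m n j A := by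
      intro m
      rw [Measure.sum_apply _ hA]
      simp_rw [Measure.sum_apply _ hA]
      rw [tsum_fiber (fun p : ℕ × ℕ => p.1 + p.2) fun p => m p.1 p.2 A,
        ENNReal.tsum_prod (f := fun n j => m n j A)]
    rw [Measure.add_apply, e, e, Measure.sum_apply _ hA, ← ENNReal.tsum_add]
    refine tsum_congr fun n => ?_
    rw [← ENNReal.tsum_add]
    calc ∑' j, (u n j A + s n j A) = ∑' j, Q n (A ∩ T^[n] ⁻¹' (τ ⁻¹' {j})) := by
          refine tsum_congr fun j => ?_
          rw [add_comm, ← Measure.add_apply, hadd, Measure.restrict_apply hA]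
      _ = Q n (⋃ j, A ∩ T^[n] ⁻¹' (τ ⁻¹' {j})) := by
          refine (measure_iUnion (fun i j hij => ?_)
            fun j => hA.inter ((hT.iterate n) (hτj j))).symm
          refine disjoint_left.2 fun x hx hx' => hij ?_
          exact (mem_singleton_iff.1 hx.2).symm.trans hx'.2
      _ = Q n A := by
          congr 1
          ext x
          simp
  · intro N
    rw [Measure.map_sum (hT.iterate N).aemeasurable]
    ext A hA
    rw [Measure.sum_apply _ hA, Measure.smul_apply, Measure.sum_apply _ .univ, smul_eq_mul,
      ← ENNReal.tsum_mul_right]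
    refine tsum_congr ?_
    rintro ⟨p, rfl⟩
    rw [hsmap, Measure.smul_apply, smul_eq_mul]
  · intro n
    rw [← measure_iUnion (fun i j hij => ?_) fun j => (hT.iterate n) (hτj j)]
    · congr 1
      ext x
      simp
    · refine disjoint_left.2 fun x hx hx' => hij ?_
      exact (mem_singleton_iff.1 hx).symm.trans hx'
  · intro n j
    -- Conditioning on the past costs only the factor `exp R`, since a regular measure is at most
    -- `exp R` times its mass times `μ`.
    have := hb.le_smul (h n) (τ ⁻¹' {j})
    rwa [Measure.map_apply (hT.iterate n) (hτj j), Measure.map_apply (hT.iterate n) .univ,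
      preimage_univ, Measure.smul_apply, smul_eq_mul, mul_assoc] at this

/-- Every finite measure that becomes regular after some number of iterates, depending on the
point, becomes a multiple of `μ` after a (larger, randomized) number of iterates. The remaining
conjuncts describe the law of that number by a recursion. -/
theorem exists_regeneration (hb : IsMarkovBase μ Y (inducedMap T τ) α lam K)
    (hR : K * lam / (lam - 1) < R) (hT : Measurable T) (hτ : Measurable τ)
    (hconst : ∀ a ∈ α, ∃ n : ℕ, ∀ y ∈ a, τ y = n) (Q : ℕ → Measure M)
    [IsFiniteMeasure (Measure.sum Q)] (h : ∀ n, LogLip μ Y R ((Q n).map T^[n])) :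
    ∃ (Θ : ℕ → Measure M) (q : ℕ → ℕ → ℝ≥0∞) (P : ℕ → ℕ → ℕ → ℝ≥0∞),
      Measure.sum Θ = Measure.sum Q ∧
      Measure.sum (fun n => (Θ n).map T^[n]) = (Measure.sum Q univ) • μ ∧
      (∀ n, q 0 n = Q n univ) ∧
      (∀ k n, ∑' j, P k n j = q k n) ∧
      (∀ k n j, P k n j ≤ ENNReal.ofReal (Real.exp R) * (q k n * μ (τ ⁻¹' {j}))) ∧
      (∀ k (w : ℕ → ℝ≥0∞), ∑' N, q (k + 1) N * w N =
        ENNReal.ofReal (1 - splitRate lam K R) * ∑' n, ∑' j, P k n j * w (n + j)) ∧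
      ∀ w : ℕ → ℝ≥0∞, ∑' N, Θ N univ * w N =
        ENNReal.ofReal (splitRate lam K R) * ∑' k, ∑' n, ∑' j, P k n j * w (n + j) := by
  have hξ0 := splitRate_pos hb.one_lt_lam hb.K_nonneg hR
  have hξ1 := splitRate_lt_one hb.one_lt_lam hb.K_nonneg hR
  set ξ := splitRate lam K R
  let X := {Q : ℕ → Measure M //
    IsFiniteMeasure (Measure.sum Q) ∧ ∀ n, LogLip μ Y R ((Q n).map T^[n])}
  have step : ∀ Q : X, ∃ (Q' : X) (S : ℕ → Measure M) (P : ℕ → ℕ → ℝ≥0∞),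
      IsRegenerationStep μ T τ Y R ξ Q.1 Q'.1 S P := by
    rintro ⟨Q, hQ, hreg⟩
    obtain ⟨Q', S, P, hstep⟩ := exists_isRegenerationStep hb hR hT hτ hconst Q hreg
    refine ⟨⟨Q', ?_, hstep.regular⟩, S, P, hstep⟩
    refine isFiniteMeasure_of_le (Measure.sum Q) ?_
    rw [← hstep.sum_add]
    exact Measure.le_add_right le_rfl
  choose next S P hstep using step
  let q : ℕ → X := fun k => next^[k] ⟨Q, inferInstance, h⟩
  have hq : ∀ k, q (k + 1) = next (q k) := fun k => Function.iterate_succ_apply' _ _ _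
  have hst : ∀ k, IsRegenerationStep μ T τ Y R ξ (q k).1 (q (k + 1)).1 (S (q k)) (P (q k)) :=
    fun k => by rw [hq]; exact hstep _
  have hmass : ∀ w : ℕ → ℝ≥0∞, ∑' N, Measure.sum (fun k => S (q k) N) univ * w N =
      ENNReal.ofReal ξ * ∑' k, ∑' n, ∑' j, P (q k) n j * w (n + j) := by
    intro w
    rw [← ENNReal.tsum_mul_left]
    simp_rw [← (hst _).mass_regenerated]
    rw [ENNReal.tsum_comm]
    refine tsum_congr fun N => ?_
    rw [Measure.sum_apply _ .univ, ENNReal.tsum_mul_right]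
  -- Each step keeps exactly the fraction `1 - ξ` of the mass, so the number of returns before
  -- regeneration is geometric.
  have htot : ∀ k, ∑' n, (q k).1 n univ = ENNReal.ofReal (1 - ξ) ^ k * Measure.sum Q univ := by
    intro k
    induction k with
    | zero => simp [q, Measure.sum_apply]
    | succ k ih =>
      have := (hst k).mass_remaining 1
      simp only [Pi.one_apply, mul_one, (hst k).tsum_P] at this
      rw [this, ih, pow_succ']
      ring
  have hle : ∀ k (A : Set M), Measure.sum (q k).1 A +
      ∑ i ∈ Finset.range k, Measure.sum (S (q i)) A = Measure.sum Q A := by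
    intro k A
    induction k with
    | zero => simp [q]
    | succ k ih =>
      rw [← ih, ← (hst k).sum_add, Measure.add_apply, Finset.sum_range_succ]
      abel
  have hsum1 : Measure.sum (fun N => Measure.sum fun k => S (q k) N) =
      Measure.sum fun k => Measure.sum (S (q k)) := Measure.sum_comm _
  have hone := hmass 1
  simp only [Pi.one_apply, mul_one, (hst _).tsum_P, htot] at hone
  rw [ENNReal.tsum_mul_right, ENNReal.tsum_geometric, ← ENNReal.ofReal_one,
    ← ENNReal.ofReal_sub _ (sub_nonneg.2 hξ1.le), sub_sub_cancel, ← mul_assoc,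
    ENNReal.mul_inv_cancel (by simpa using hξ0) ENNReal.ofReal_ne_top, one_mul] at hone
  refine ⟨fun N => Measure.sum fun k => S (q k) N, fun k n => (q k).1 n univ, fun k => P (q k),
    ?_, ?_, fun n => rfl, fun k => (hst k).tsum_P, fun k => (hst k).P_le,
    fun k => (hst k).mass_remaining, hmass⟩
  -- The regenerated pieces lie below the original measure at every stage and have the full total
  -- mass by the geometric series, so nothing is lost in the limit.
  · have hfin : IsFiniteMeasure (Measure.sum fun N => Measure.sum fun k => S (q k) N) := by
      refine ⟨?_⟩
      rw [Measure.sum_apply _ .univ, hone]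
      exact measure_lt_top _ _
    refine Measure.eq_of_le_of_measure_univ_eq ?_ (by rw [Measure.sum_apply _ .univ, hone])
    rw [hsum1]
    refine Measure.le_intro fun A hA _ => ?_
    rw [Measure.sum_apply _ hA]
    refine ENNReal.tsum_le_of_sum_range_le fun k => ?_
    rw [← hle k]
    exact le_add_self
  · have : ∀ N, (Measure.sum fun k => S (q k) N).map T^[N] =
        ((Measure.sum fun k => S (q k) N) univ) • μ := by
      intro N
      rw [Measure.map_sum (hT.iterate N).aemeasurable]
      ext A hA
      rw [Measure.sum_apply _ hA, Measure.smul_apply, Measure.sum_apply _ .univ, smul_eq_mul,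
        ← ENNReal.tsum_mul_right]
      exact tsum_congr fun k => by rw [(hst k).map_eq, Measure.smul_apply, smul_eq_mul]
    simp_rw [this]
    ext A hA
    rw [Measure.sum_apply _ hA, Measure.smul_apply, ← hone, smul_eq_mul, ← ENNReal.tsum_mul_right]
    rfl

end Splitting
-- Moments of a geometric sum of return times
section Moments

/-- The recursion satisfied by the law `θ` of a sum of a geometric number of return times:
`q₀` is the law of the initial delay, the probability of stopping at each return is `ξ`,
and conditionally on the past the law of the next return time is at most `b • p`. -/
def IsRegenerationLaw (ξ : ℝ) (b : ℝ≥0∞) (p q₀ θ : ℕ → ℝ≥0∞) : Prop :=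
  ∃ (q : ℕ → ℕ → ℝ≥0∞) (P : ℕ → ℕ → ℕ → ℝ≥0∞),
    (∀ n, q 0 n = q₀ n) ∧
    (∀ k n, ∑' j, P k n j = q k n) ∧
    (∀ k n j, P k n j ≤ b * (q k n * p j)) ∧
    (∀ k (w : ℕ → ℝ≥0∞), ∑' N, q (k + 1) N * w N =
      ENNReal.ofReal (1 - ξ) * ∑' n, ∑' j, P k n j * w (n + j)) ∧
    ∀ w : ℕ → ℝ≥0∞, ∑' N, θ N * w N =
      ENNReal.ofReal ξ * ∑' k, ∑' n, ∑' j, P k n j * w (n + j)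

variable {ξ : ℝ} {b : ℝ≥0∞} {p q₀ θ : ℕ → ℝ≥0∞}

/-- Moments of a regeneration law for a family of weights that is subadditive up to constants. -/
lemma IsRegenerationLaw.tsum_le (h : IsRegenerationLaw ξ b p q₀ θ) (hq₀ : ∑' n, q₀ n ≤ 1)
    (hξ1 : ξ ≤ 1) {𝒲 : Set (ℕ → ℝ≥0∞)} {A B c ϑ : ℝ≥0∞} (hϑ : ENNReal.ofReal (1 - ξ) = ϑ ^ 2)
    (hϑ1 : ϑ ≤ 1) (hA : ϑ ^ 2 * A ≤ ϑ)
    (h𝒲 : ∀ w ∈ 𝒲, ∃ w₁ ∈ 𝒲, ∃ w₂ ∈ 𝒲, ∀ n j, w (n + j) ≤ A * w₁ n + B * w₂ j)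
    (hq : ∀ w ∈ 𝒲, ∑' n, q₀ n * w n ≤ c) (hp : ∀ w ∈ 𝒲, ∑' n, p n * w n ≤ c)
    {w : ℕ → ℝ≥0∞} (hw : w ∈ 𝒲) :
    ∑' n, θ n * w n ≤ (A * (c + B * b * c * (1 - ϑ)⁻¹) + B * b * c) * (1 - ϑ)⁻¹ := by
  obtain ⟨q, P, h0, hP, hPle, hrec, htot⟩ := h
  have hmass : ∀ k, ∑' n, q k n ≤ ϑ ^ (2 * k) := by
    intro k
    induction k with
    | zero => simpa [h0] using hq₀
    | succ k ih =>
      have := hrec k 1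
      simp only [Pi.one_apply, mul_one, hP] at this
      rw [this, hϑ, mul_add, pow_add, mul_comm]
      exact mul_le_mul_left ih _
  -- The part of the weight that depends on `n` is summed over `j` exactly; the domination by `b •
  -- p` is spent only on the part that depends on `j`.
  have hstep : ∀ k, ∀ w ∈ 𝒲, ∃ w₁ ∈ 𝒲, ∑' n, ∑' j, P k n j * w (n + j) ≤
      A * ∑' n, q k n * w₁ n + B * b * c * ϑ ^ (2 * k) := by
    intro k w hw
    obtain ⟨w₁, hw₁, w₂, hw₂, hle⟩ := h𝒲 w hw
    refine ⟨w₁, hw₁, ?_⟩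
    calc ∑' n, ∑' j, P k n j * w (n + j)
        ≤ ∑' n, ∑' j, (P k n j * (A * w₁ n) + B * b * q k n * (p j * w₂ j)) := by
          refine ENNReal.tsum_le_tsum fun n => ENNReal.tsum_le_tsum fun j => ?_
          calc _ ≤ P k n j * (A * w₁ n + B * w₂ j) := by gcongr; exact hle n j
            _ = P k n j * (A * w₁ n) + P k n j * (B * w₂ j) := mul_add _ _ _
            _ ≤ P k n j * (A * w₁ n) + b * (q k n * p j) * (B * w₂ j) := by
              gcongr; exact hPle k n j
            _ = _ := by ring
      _ = A * ∑' n, q k n * w₁ n + B * b * (∑' n, q k n) * ∑' j, p j * w₂ j := by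
          simp_rw [ENNReal.tsum_add, ENNReal.tsum_mul_left, ENNReal.tsum_mul_right, hP,
            ENNReal.tsum_mul_left]
          congr 1
          rw [← ENNReal.tsum_mul_left]
          exact tsum_congr fun n => by ring
      _ ≤ A * ∑' n, q k n * w₁ n + B * b * ϑ ^ (2 * k) * c := by
          gcongr
          · exact hmass k
          · exact hp w₂ hw₂
      _ = _ := by ring
  have hgeo : ∀ k : ℕ, ∑ i ∈ Finset.range k, ϑ ^ (i + 1) ≤ (1 - ϑ)⁻¹ := fun k => by
    rw [← ENNReal.tsum_geometric]
    calc _ ≤ ∑ i ∈ Finset.range k, ϑ ^ i :=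
          Finset.sum_le_sum fun i _ => pow_le_pow_right_of_le_one' hϑ1 i.le_succ
      _ ≤ _ := ENNReal.sum_le_tsum _
  -- A step multiplies the mass by `ϑ ^ 2` and inflates the weight by `A ≤ ϑ⁻¹`, a net contraction
  -- by `ϑ`. The weight may change at each step, so the induction runs over the whole class `𝒲`.
  have hind : ∀ k, ∀ w ∈ 𝒲, ∑' n, q k n * w n ≤
      ϑ ^ k * (c + B * b * c * ∑ i ∈ Finset.range k, ϑ ^ (i + 1)) := by
    intro k
    induction k with
    | zero => intro w hw; simpa [h0] using hq w hw
    | succ k ih =>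
      intro w hw
      obtain ⟨w₁, hw₁, hle⟩ := hstep k w hw
      rw [hrec, hϑ, Finset.sum_range_succ]
      calc _ ≤ ϑ ^ 2 * (A * (ϑ ^ k * (c + B * b * c * ∑ i ∈ Finset.range k, ϑ ^ (i + 1))) +
            B * b * c * ϑ ^ (2 * k)) := by
            gcongr
            refine hle.trans ?_
            gcongr
            exact ih w₁ hw₁
        _ = (ϑ ^ 2 * A) * (ϑ ^ k * (c + B * b * c * ∑ i ∈ Finset.range k, ϑ ^ (i + 1))) +
            ϑ ^ 2 * (B * b * c * ϑ ^ (2 * k)) := by ring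
        _ ≤ ϑ * (ϑ ^ k * (c + B * b * c * ∑ i ∈ Finset.range k, ϑ ^ (i + 1))) +
            ϑ ^ 2 * (B * b * c * ϑ ^ (2 * k)) := by gcongr
        _ = _ := by ring
  have hfin : ∀ k, ∑' n, ∑' j, P k n j * w (n + j) ≤
      (A * (c + B * b * c * (1 - ϑ)⁻¹) + B * b * c) * ϑ ^ k := by
    intro k
    obtain ⟨w₁, hw₁, hle⟩ := hstep k w hw
    calc _ ≤ A * (ϑ ^ k * (c + B * b * c * (1 - ϑ)⁻¹)) + B * b * c * ϑ ^ k := by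
          refine hle.trans ?_
          gcongr ?_ + _ * ?_
          · refine mul_le_mul_right ((hind k w₁ hw₁).trans ?_) _
            gcongr
            exact hgeo k
          · exact pow_le_pow_right_of_le_one' hϑ1 (by omega)
      _ = _ := by ring
  rw [htot]
  calc _ ≤ 1 * ∑' k, (A * (c + B * b * c * (1 - ϑ)⁻¹) + B * b * c) * ϑ ^ k := by
        gcongr with k
        · exact ENNReal.ofReal_le_one.2 hξ1
        · exact hfin k
    _ = _ := by rw [one_mul, ENNReal.tsum_mul_left, ENNReal.tsum_geometric]

/-- Moments of a regeneration law for a submultiplicative weight. -/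
lemma IsRegenerationLaw.tsum_le_of_submultiplicative (h : IsRegenerationLaw ξ b p q₀ θ)
    (hξ0 : 0 < ξ) (hξ1 : ξ ≤ 1) {c : ℝ≥0∞} {w : ℕ → ℝ≥0∞} (hw1 : ∀ n, 1 ≤ w n)
    (hw : ∀ n j, w (n + j) ≤ w n * w j) (hq : ∑' n, q₀ n * w n ≤ c)
    (hp : b * ∑' n, p n * (w n - 1) ≤ ENNReal.ofReal ξ) :
    ∑' n, θ n * w n ≤ ENNReal.ofReal (2 / ξ) * c := by
  obtain ⟨q, P, h0, hP, hPle, hrec, htot⟩ := h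
  -- Writing `w j = 1 + (w j - 1)` keeps the factor `b` off the constant part, so one return
  -- multiplies the weighted sum by at most `1 + ξ`; survival contributes `1 - ξ`, and the product
  -- is below 1.
  have hstep : ∀ k, ∑' n, ∑' j, P k n j * w (n + j) ≤
      ENNReal.ofReal (1 + ξ) * ∑' n, q k n * w n := by
    intro k
    rw [← ENNReal.tsum_mul_left]
    refine ENNReal.tsum_le_tsum fun n => ?_
    calc ∑' j, P k n j * w (n + j)
        ≤ ∑' j, w n * (P k n j + q k n * (b * (p j * (w j - 1)))) := by
          refine ENNReal.tsum_le_tsum fun j => ?_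
          calc _ ≤ P k n j * (w n * w j) := by gcongr; exact hw n j
            _ = w n * (P k n j * (1 + (w j - 1))) := by
                rw [add_tsub_cancel_of_le (hw1 j)]; ring
            _ = w n * (P k n j + P k n j * (w j - 1)) := by ring
            _ ≤ w n * (P k n j + b * (q k n * p j) * (w j - 1)) := by
                gcongr; exact hPle k n j
            _ = _ := by ring
      _ = w n * (q k n + q k n * (b * ∑' j, p j * (w j - 1))) := by
          rw [ENNReal.tsum_mul_left, ENNReal.tsum_add, hP, ENNReal.tsum_mul_left,
            ENNReal.tsum_mul_left]
      _ ≤ w n * (q k n + q k n * ENNReal.ofReal ξ) := by gcongr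
      _ = _ := by rw [ENNReal.ofReal_add zero_le_one hξ0.le, ENNReal.ofReal_one]; ring
  have hind : ∀ k, ∑' n, q k n * w n ≤ ENNReal.ofReal (1 - ξ ^ 2) ^ k * c := by
    intro k
    induction k with
    | zero => simpa [h0] using hq
    | succ k ih =>
      rw [hrec]
      calc _ ≤ ENNReal.ofReal (1 - ξ) * (ENNReal.ofReal (1 + ξ) *
            (ENNReal.ofReal (1 - ξ ^ 2) ^ k * c)) := by
            gcongr
            refine (hstep k).trans ?_
            gcongr
        _ = ENNReal.ofReal (1 - ξ ^ 2) ^ (k + 1) * c := by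
            rw [← mul_assoc, ← ENNReal.ofReal_mul (by linarith), pow_succ]
            ring_nf
  have h2 : 0 < ξ ^ 2 := by positivity
  have h3 : ξ ^ 2 ≤ 1 := pow_le_one₀ hξ0.le hξ1
  rw [htot]
  calc _ ≤ ENNReal.ofReal ξ * ∑' k, ENNReal.ofReal (1 + ξ) *
        (ENNReal.ofReal (1 - ξ ^ 2) ^ k * c) := by
        gcongr with k
        refine (hstep k).trans ?_
        gcongr
        exact hind k
    _ = ENNReal.ofReal ((1 + ξ) / ξ) * c := by
        rw [ENNReal.tsum_mul_left, ENNReal.tsum_mul_right, ENNReal.tsum_geometric,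
          ← ENNReal.ofReal_one, ← ENNReal.ofReal_sub _ (sub_nonneg.2 h3), sub_sub_cancel,
          ← ENNReal.ofReal_inv_of_pos h2, ← mul_assoc, ← mul_assoc,
          ← ENNReal.ofReal_mul hξ0.le, ← ENNReal.ofReal_mul (by positivity)]
        congr 2
        field_simp
    _ ≤ _ := by
        gcongr
        linarith

end Moments

/-! ### Polynomial and stretched exponential weights -/

section Weights

/-- The fraction of a sum of two times that is attributed to the first one. -/
noncomputable def timeShare (ξ β : ℝ) : ℝ := (Real.sqrt (1 - ξ)) ^ (1 / β)

/-- The constant in the polynomial moment bounds for regeneration times. -/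
noncomputable def polyConst (ξ R β c : ℝ) : ℝ :=
  ((Real.sqrt (1 - ξ))⁻¹ * (c + (1 - timeShare ξ β) ^ (-β) * Real.exp R * c *
    (1 - Real.sqrt (1 - ξ))⁻¹) + (1 - timeShare ξ β) ^ (-β) * Real.exp R * c) *
    (1 - Real.sqrt (1 - ξ))⁻¹

variable {ξ R β c : ℝ} {p q₀ θ : ℕ → ℝ≥0∞}

lemma sqrt_one_sub_pos (hξ1 : ξ < 1) : 0 < Real.sqrt (1 - ξ) :=
  Real.sqrt_pos.2 (sub_pos.2 hξ1)

lemma sqrt_one_sub_lt_one (hξ0 : 0 < ξ) : Real.sqrt (1 - ξ) < 1 := by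
  rw [Real.sqrt_lt' one_pos]; linarith

lemma timeShare_pos (hξ1 : ξ < 1) : 0 < timeShare ξ β :=
  Real.rpow_pos_of_pos (sqrt_one_sub_pos hξ1) _

lemma timeShare_lt_one (hξ0 : 0 < ξ) (hβ : 0 < β) : timeShare ξ β < 1 :=
  Real.rpow_lt_one (Real.sqrt_nonneg _) (sqrt_one_sub_lt_one hξ0) (by positivity)

/-- The share is defined by this identity: giving the past nearly all of the total time inflates its
weight by `(1 - ξ) ^ (-1/2)` only, half of the geometric gain in exponent. -/
lemma timeShare_rpow_neg (hβ : 0 < β) :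
    timeShare ξ β ^ (-β) = (Real.sqrt (1 - ξ))⁻¹ := by
  rw [timeShare, ← Real.rpow_mul (Real.sqrt_nonneg _), ← Real.rpow_neg_one]
  congr 1
  field_simp

lemma IsRegenerationLaw.tsum_le_polyConst
    (h : IsRegenerationLaw ξ (ENNReal.ofReal (Real.exp R)) p q₀ θ)
    (hq₀ : ∑' n, q₀ n ≤ 1) (hξ0 : 0 < ξ) (hξ1 : ξ < 1) (hβ : 0 < β) (hc : 0 ≤ c)
    {𝒲 : Set (ℕ → ℝ≥0∞)}
    (h𝒲 : ∀ w ∈ 𝒲, ∀ s t : ℝ, 0 < s → 0 < t → s + t = 1 → ∃ w₁ ∈ 𝒲, ∃ w₂ ∈ 𝒲,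
      ∀ n j, w (n + j) ≤ ENNReal.ofReal (s ^ (-β)) * w₁ n + ENNReal.ofReal (t ^ (-β)) * w₂ j)
    (hq : ∀ w ∈ 𝒲, ∑' n, q₀ n * w n ≤ ENNReal.ofReal c)
    (hp : ∀ w ∈ 𝒲, ∑' n, p n * w n ≤ ENNReal.ofReal c)
    {w : ℕ → ℝ≥0∞} (hw : w ∈ 𝒲) : ∑' n, θ n * w n ≤ ENNReal.ofReal (polyConst ξ R β c) := by
  have s0 := sqrt_one_sub_pos hξ1
  have s1 := sqrt_one_sub_lt_one hξ0
  have t0 := timeShare_pos (β := β) hξ1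
  have t1 := timeShare_lt_one hξ0 hβ
  have s2 := sub_pos.2 s1
  have t2 := sub_pos.2 t1
  refine (h.tsum_le hq₀ hξ1.le (𝒲 := 𝒲) (A := ENNReal.ofReal (timeShare ξ β ^ (-β)))
    (B := ENNReal.ofReal ((1 - timeShare ξ β) ^ (-β))) (c := ENNReal.ofReal c)
    (ϑ := ENNReal.ofReal (Real.sqrt (1 - ξ))) ?_ ?_ ?_ ?_ hq hp hw).trans_eq ?_
  · rw [← ENNReal.ofReal_pow s0.le, Real.sq_sqrt (sub_pos.2 hξ1).le]
  · exact ENNReal.ofReal_le_one.2 s1.le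
  · rw [timeShare_rpow_neg hβ, ← ENNReal.ofReal_pow s0.le, ← ENNReal.ofReal_mul (by positivity)]
    refine (congrArg _ ?_).le
    field_simp
  · exact fun w hw => h𝒲 w hw _ _ t0 t2 (by ring)
  · rw [timeShare_rpow_neg hβ, ← ENNReal.ofReal_one, ← ENNReal.ofReal_sub _ s0.le,
      ← ENNReal.ofReal_inv_of_pos s2, polyConst]
    have hB : 0 ≤ (1 - timeShare ξ β) ^ (-β) := Real.rpow_nonneg t2.le _
    rw [ENNReal.ofReal_mul (by positivity), ENNReal.ofReal_add (by positivity) (by positivity),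
      ENNReal.ofReal_mul (by positivity), ENNReal.ofReal_add hc (by positivity),
      ENNReal.ofReal_mul (by positivity), ENNReal.ofReal_mul (by positivity),
      ENNReal.ofReal_mul hB]

/-- The weights defining weak polynomial moments. -/
noncomputable def tailWeight (β x : ℝ) (n : ℕ) : ℝ≥0∞ :=
  if x ≤ n then ENNReal.ofReal (x ^ β) else 0

/-- If `n + j ≥ x` then `n ≥ s * x` or `j ≥ t * x`. The level changes, so weak moments must be
treated at all levels simultaneously. -/
lemma tailWeight_add_le {x s t : ℝ} (hx : 0 < x) (hs : 0 < s) (ht : 0 < t) (hst : s + t = 1)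
    (n j : ℕ) : tailWeight β x (n + j) ≤
      ENNReal.ofReal (s ^ (-β)) * tailWeight β (s * x) n +
        ENNReal.ofReal (t ^ (-β)) * tailWeight β (t * x) j := by
  have key : ∀ {r : ℝ}, 0 < r →
      ENNReal.ofReal (x ^ β) = ENNReal.ofReal (r ^ (-β)) * ENNReal.ofReal ((r * x) ^ β) := by
    intro r hr
    rw [← ENNReal.ofReal_mul (by positivity), Real.mul_rpow hr.le hx.le, ← mul_assoc,
      ← Real.rpow_add hr]
    simp
  by_cases hxn : x ≤ (n + j : ℕ)
  · by_cases hn : s * x ≤ n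
    · rw [tailWeight, tailWeight, if_pos hxn, if_pos hn, ← key hs]
      exact le_self_add
    · have hj : t * x ≤ j := by
        push_cast at hxn
        push Not at hn
        have : t = 1 - s := by linarith
        rw [this]; linarith
      rw [tailWeight, tailWeight, tailWeight, if_pos hxn, if_pos hj, ← key ht]
      exact le_add_self
  · rw [tailWeight, if_neg hxn]
    exact zero_le

/-- One of the summands carries at least its share of the total. No convexity is involved, and the
coefficient of the first term can be brought arbitrarily close to 1. -/
lemma natCast_add_rpow_le {s t : ℝ} (hβ : 0 < β) (hs : 0 < s) (ht : 0 < t) (hst : s + t = 1)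
    (n j : ℕ) : ((n + j : ℕ) : ℝ≥0∞) ^ β ≤
      ENNReal.ofReal (s ^ (-β)) * (n : ℝ≥0∞) ^ β + ENNReal.ofReal (t ^ (-β)) * (j : ℝ≥0∞) ^ β := by
  have key : ∀ {r : ℝ} {m : ℕ}, 0 < r → r * ((n + j : ℕ) : ℝ) ≤ m →
      ((n + j : ℕ) : ℝ≥0∞) ^ β ≤ ENNReal.ofReal (r ^ (-β)) * (m : ℝ≥0∞) ^ β := by
    intro r m hr hm
    have e : ∀ i : ℕ, (i : ℝ≥0∞) ^ β = ENNReal.ofReal ((i : ℝ) ^ β) := fun i => by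
      rw [← ENNReal.ofReal_natCast, ENNReal.ofReal_rpow_of_nonneg (Nat.cast_nonneg _) hβ.le]
    rw [e, e, ← ENNReal.ofReal_mul (by positivity)]
    refine ENNReal.ofReal_le_ofReal ?_
    rw [Real.rpow_neg hr.le, ← Real.inv_rpow hr.le, ← Real.mul_rpow (by positivity) (by positivity)]
    refine Real.rpow_le_rpow (by positivity) ?_ hβ.le
    rwa [le_inv_mul_iff₀ hr]
  by_cases hn : s * ((n + j : ℕ) : ℝ) ≤ n
  · exact (key hs hn).trans le_self_add
  · refine (key ht ?_).trans le_add_self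
    push_cast at hn ⊢
    push Not at hn
    have : t = 1 - s := by linarith
    rw [this]; linarith

/-- The constant bounding a stretched exponential series. -/
noncomputable def expSum (a γ : ℝ) : ℝ :=
  2 * ((2 / γ) ^ (2 / γ) * (2 / a) ^ (2 / γ))

/-- The exponential rate of the regeneration times. -/
noncomputable def expRate (ξ R a γ c : ℝ) : ℝ :=
  a / 2 * (ξ * Real.exp (-R) / (1 + c * expSum a γ))

variable {a γ : ℝ}

lemma expSum_nonneg (ha : 0 < a) (hγ : 0 < γ) : 0 ≤ expSum a γ := by
  unfold expSum; positivity

/-- Raise `u / p ≤ exp (u / p)` to the power `p`. -/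
lemma exp_neg_le_rpow {u p : ℝ} (hu : 0 < u) (hp : 0 < p) :
    Real.exp (-u) ≤ p ^ p * u ^ (-p) := by
  have h1 : u / p ≤ Real.exp (u / p) := by linarith [Real.add_one_le_exp (u / p)]
  have h2 : (u / p) ^ p ≤ Real.exp u := by
    calc (u / p) ^ p ≤ Real.exp (u / p) ^ p := Real.rpow_le_rpow (by positivity) h1 hp.le
      _ = Real.exp u := by rw [← Real.exp_mul]; congr 1; field_simp
  rw [Real.div_rpow hu.le hp.le, div_le_iff₀ (by positivity)] at h2
  rw [Real.exp_neg, Real.rpow_neg hu.le, ← div_eq_mul_inv, inv_eq_one_div,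
    div_le_div_iff₀ (Real.exp_pos _) (by positivity)]
  linarith

/-- Half of the exponential rate is spent on the weight; the other half dominates `n ^ (-2)` via
`exp_neg_le_rpow` with exponent `2 / γ`. The weight vanishes at `n = 0`, where the tail hypothesis
says nothing. -/
lemma tsum_mul_exp_le (ha : 0 < a) (hγ : 0 < γ) (hc : 0 < c) {l : ℕ → ℝ≥0∞}
    (hl : ∀ n, 1 ≤ n → l n ≤ ENNReal.ofReal (c * Real.exp (-a * (n : ℝ) ^ γ))) :
    ∑' n : ℕ, l n * (if n = 0 then 0 else ENNReal.ofReal (Real.exp (a / 2 * (n : ℝ) ^ γ))) ≤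
      ENNReal.ofReal (c * expSum a γ) := by
  set D := c * ((2 / γ) ^ (2 / γ) * (2 / a) ^ (2 / γ)) with hD
  have hD0 : 0 ≤ D := by positivity
  have hz := hasSum_zeta_two
  calc _ ≤ ∑' n : ℕ, ENNReal.ofReal (D * (1 / (n : ℝ) ^ 2)) := by
        refine ENNReal.tsum_le_tsum fun n => ?_
        rcases Nat.eq_zero_or_pos n with rfl | hn
        · simp
        have hn0 : (0 : ℝ) < n := Nat.cast_pos.2 hn
        rw [if_neg hn.ne']
        calc _ ≤ ENNReal.ofReal (c * Real.exp (-a * (n : ℝ) ^ γ)) *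
              ENNReal.ofReal (Real.exp (a / 2 * (n : ℝ) ^ γ)) := by gcongr; exact hl n hn
          _ = ENNReal.ofReal (c * Real.exp (-(a / 2 * (n : ℝ) ^ γ))) := by
              rw [← ENNReal.ofReal_mul (by positivity), mul_assoc, ← Real.exp_add]
              ring_nf
          _ ≤ _ := by
              refine ENNReal.ofReal_le_ofReal ?_
              have h1 := exp_neg_le_rpow (u := a / 2 * (n : ℝ) ^ γ) (p := 2 / γ)
                (by positivity) (by positivity)
              have h2 : (a / 2 * (n : ℝ) ^ γ) ^ (-(2 / γ)) =
                  (2 / a) ^ (2 / γ) * (1 / (n : ℝ) ^ 2) := by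
                rw [Real.mul_rpow (by positivity) (by positivity), ← Real.rpow_mul hn0.le,
                  Real.rpow_neg (by positivity), ← Real.inv_rpow (by positivity), inv_div]
                congr 1
                rw [show γ * -(2 / γ) = -2 by field_simp, Real.rpow_neg hn0.le]
                simp
              rw [h2] at h1
              calc _ ≤ c * ((2 / γ) ^ (2 / γ) * ((2 / a) ^ (2 / γ) * (1 / (n : ℝ) ^ 2))) := by
                    gcongr
                _ = _ := by rw [hD]; ring
    _ = ENNReal.ofReal (D * (Real.pi ^ 2 / 6)) := by
        rw [← (hz.mul_left D).tsum_eq, ENNReal.ofReal_tsum_of_nonneg]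
        · intro n; positivity
        · exact (hz.mul_left D).summable
    _ ≤ _ := by
        refine ENNReal.ofReal_le_ofReal ?_
        -- This is the origin of the factor 2 in `expSum`.
        have hpi : Real.pi ^ 2 / 6 ≤ 2 := by nlinarith [Real.pi_lt_d2, Real.pi_pos]
        calc D * (Real.pi ^ 2 / 6) ≤ D * 2 := by gcongr
          _ = _ := by rw [hD, expSum]; ring

lemma expRate_pos (hξ0 : 0 < ξ) (ha : 0 < a) (hγ : 0 < γ) (hc : 0 < c) :
    0 < expRate ξ R a γ c := by
  have := expSum_nonneg ha hγ
  unfold expRate; positivity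

lemma expRate_le (hξ0 : 0 < ξ) (hξ1 : ξ < 1) (hR : 0 ≤ R) (ha : 0 < a) (hγ : 0 < γ) (hc : 0 < c) :
    expRate ξ R a γ c ≤ a / 2 := by
  have := expSum_nonneg ha hγ
  unfold expRate
  refine mul_le_of_le_one_right (by positivity) ?_
  rw [div_le_one (by positivity)]
  have h1 : Real.exp (-R) ≤ 1 := Real.exp_le_one_iff.2 (by linarith)
  nlinarith [Real.exp_pos (-R), mul_nonneg hc.le this]

/-- For `γ ≤ 1` the function `n ↦ n ^ γ` is subadditive, so its exponential is submultiplicative.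
The rate is small enough for the excess over 1, averaged over a return time and multiplied by `exp
R`, to stay below `ξ`. -/
lemma IsRegenerationLaw.tsum_exp_le
    (h : IsRegenerationLaw ξ (ENNReal.ofReal (Real.exp R)) p q₀ θ)
    (hq₀ : ∑' n, q₀ n ≤ 1) (hξ0 : 0 < ξ) (hξ1 : ξ < 1) (hR : 0 ≤ R) (ha : 0 < a)
    (hγ : 0 < γ) (hγ1 : γ ≤ 1) (hc : 0 < c)
    (hq : ∀ n, 1 ≤ n → q₀ n ≤ ENNReal.ofReal (c * Real.exp (-a * (n : ℝ) ^ γ)))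
    (hp : ∀ n, 1 ≤ n → p n ≤ ENNReal.ofReal (c * Real.exp (-a * (n : ℝ) ^ γ))) :
    ∑' n, θ n * ENNReal.ofReal (Real.exp (expRate ξ R a γ c * (n : ℝ) ^ γ)) ≤
      ENNReal.ofReal (2 / ξ * (1 + c * expSum a γ)) := by
  set A := expRate ξ R a γ c with hA
  have hA0 : 0 < A := expRate_pos hξ0 ha hγ hc
  have hA1 : A ≤ a / 2 := expRate_le hξ0 hξ1 hR ha hγ hc
  have hG := expSum_nonneg ha hγ
  have hcG : 0 ≤ c * expSum a γ := by positivity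
  rw [ENNReal.ofReal_mul (by positivity)]
  refine h.tsum_le_of_submultiplicative hξ0 hξ1.le (fun n => ?_) (fun n j => ?_) ?_ ?_
  · exact ENNReal.one_le_ofReal.2 (Real.one_le_exp (by positivity))
  · rw [← ENNReal.ofReal_mul (Real.exp_pos _).le, ← Real.exp_add, ← mul_add]
    refine ENNReal.ofReal_le_ofReal (Real.exp_le_exp.2 ?_)
    gcongr
    push_cast
    exact Real.rpow_add_le_add_rpow (Nat.cast_nonneg _) (Nat.cast_nonneg _) hγ.le hγ1
  · rw [ENNReal.ofReal_add zero_le_one hcG, ENNReal.ofReal_one]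
    refine le_trans ?_ (add_le_add hq₀ (tsum_mul_exp_le ha hγ hc hq))
    rw [← ENNReal.tsum_add]
    refine ENNReal.tsum_le_tsum fun n => ?_
    rcases Nat.eq_zero_or_pos n with rfl | hn
    · simp [Real.zero_rpow hγ.ne']
    · rw [if_neg hn.ne']
      refine le_trans ?_ le_add_self
      gcongr
  · have hterm : ∀ n : ℕ, p n * (ENNReal.ofReal (Real.exp (A * (n : ℝ) ^ γ)) - 1) ≤
        ENNReal.ofReal (2 * A / a) * (p n *
          (if n = 0 then 0 else ENNReal.ofReal (Real.exp (a / 2 * (n : ℝ) ^ γ)))) := by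
      intro n
      rcases Nat.eq_zero_or_pos n with rfl | hn
      · simp [Real.zero_rpow hγ.ne']
      rw [if_neg hn.ne', mul_left_comm]
      gcongr
      rw [← ENNReal.ofReal_one, ← ENNReal.ofReal_sub _ zero_le_one,
        ← ENNReal.ofReal_mul (by positivity)]
      refine ENNReal.ofReal_le_ofReal ?_
      have hs0 : 0 ≤ 2 * A / a := by positivity
      have hs1 : 2 * A / a ≤ 1 := by rw [div_le_one ha]; linarith
      -- Convexity between `0` and `u = a / 2 * n ^ γ` gives `exp (s u) - 1 ≤ s (exp u - 1)` with `s
      -- = 2 * A / a`; the gain `s` is what makes a small rate effective.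
      have := convexOn_exp.2 (mem_univ (a / 2 * (n : ℝ) ^ γ)) (mem_univ (0 : ℝ)) hs0
        (sub_nonneg.2 hs1) (by ring)
      simp only [smul_eq_mul, mul_zero, add_zero, Real.exp_zero, mul_one] at this
      rw [show 2 * A / a * (a / 2 * (n : ℝ) ^ γ) = A * (n : ℝ) ^ γ by field_simp] at this
      linarith
    calc _ ≤ ENNReal.ofReal (Real.exp R) * (ENNReal.ofReal (2 * A / a) *
          ENNReal.ofReal (c * expSum a γ)) := by
          gcongr
          refine (ENNReal.tsum_le_tsum hterm).trans ?_
          rw [ENNReal.tsum_mul_left]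
          gcongr
          exact tsum_mul_exp_le ha hγ hc hp
      _ = ENNReal.ofReal (ξ * ((c * expSum a γ) / (1 + c * expSum a γ))) := by
          rw [← ENNReal.ofReal_mul (by positivity), ← ENNReal.ofReal_mul (by positivity), hA,
            expRate, Real.exp_neg]
          congr 1
          field_simp
      _ ≤ _ := by
          refine ENNReal.ofReal_le_ofReal (mul_le_of_le_one_right hξ0.le ?_)
          rw [div_le_one (by positivity)]
          linarith

end Weights
-- Gluing Birkhoff processes along the regenerated process
section Coupling

lemma norm_birkhoffSum_le {M E : Type*} [SeminormedAddCommGroup E] {T : M → M} {v : M → E} {V : ℝ}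
    (hv : ∀ x, ‖v x‖ ≤ V) (n : ℕ) (x : M) : ‖birkhoffSum T v n x‖ ≤ n * V := by
  refine (norm_sum_le _ _).trans ((Finset.sum_le_card_nsmul _ _ V fun i _ => hv _).trans ?_)
  simp

/-- The two sums overlap except for `n` terms at each end. The bound is therefore independent of
`k`, which makes the supremum over time finite. -/
lemma norm_birkhoffSum_sub_le {M E : Type*} [SeminormedAddCommGroup E] {T : M → M} {v : M → E}
    {V : ℝ} (hv : ∀ x, ‖v x‖ ≤ V) (n k : ℕ) (x : M) :
    ‖birkhoffSum T v k x - birkhoffSum T v k (T^[n] x)‖ ≤ 2 * V * n := by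
  have h1 := birkhoffSum_add T v n k x
  have h2 := birkhoffSum_add T v k n x
  have e : birkhoffSum T v k x - birkhoffSum T v k (T^[n] x) =
      birkhoffSum T v n x - birkhoffSum T v n (T^[k] x) := by
    rw [sub_eq_sub_iff_add_eq_add, ← h1, ← h2.trans (add_comm _ _ |>.trans (add_comm _ _)), add_comm]
  rw [e]
  refine (norm_sub_le _ _).trans ?_
  have := norm_birkhoffSum_le hv (T := T) n x
  have := norm_birkhoffSum_le hv (T := T) n (T^[k] x)
  linarith

lemma measurable_birkhoffSum {M E : Type*} [MeasurableSpace M] [AddCommMonoid E]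
    [MeasurableSpace E] [MeasurableAdd₂ E] {T : M → M} {v : M → E} (hT : Measurable T)
    (hv : Measurable v) (n : ℕ) : Measurable fun x => birkhoffSum T v n x :=
  Finset.measurable_sum _ fun i _ => hv.comp (hT.iterate i)

/-- Gluing of two measures along a common marginal. -/
lemma exists_glue {S A B : Type} [MeasurableSpace S] [MeasurableSpace A] [MeasurableSpace B]
    [StandardBorelSpace A] [StandardBorelSpace B] [Nonempty A] [Nonempty B]
    (π₁ : Measure (S × A)) (π₂ : Measure (S × B)) [IsProbabilityMeasure π₁]
    [IsProbabilityMeasure π₂] (h : π₁.fst = π₂.fst) :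
    ∃ P : Measure (S × (A × B)), IsProbabilityMeasure P ∧
      P.map (fun ω => (ω.1, ω.2.1)) = π₁ ∧ P.map (fun ω => (ω.1, ω.2.2)) = π₂ := by
  -- The second coordinates are made conditionally independent given the first. Disintegration needs
  -- them in standard Borel spaces; path space and `ℕ` qualify, while `M` need not, hence the
  -- passage to laws of Birkhoff sums.
  refine ⟨π₁.fst ⊗ₘ (π₁.condKernel ×ₖ π₂.condKernel), inferInstance, ?_, ?_⟩
  · conv_rhs => rw [← π₁.disintegrate π₁.condKernel]
    have : π₁.condKernel = (π₁.condKernel ×ₖ π₂.condKernel).map Prod.fst :=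
      by
      rw [← Kernel.fst_eq, Kernel.fst_prod]
    conv_rhs => rw [this]
    rw [Measure.compProd_map measurable_fst]
    rfl
  · conv_rhs => rw [← π₂.disintegrate π₂.condKernel, ← h]
    have : π₂.condKernel = (π₁.condKernel ×ₖ π₂.condKernel).map Prod.snd :=
      by
      rw [← Kernel.snd_eq, Kernel.snd_prod]
    conv_rhs => rw [this]
    rw [Measure.compProd_map measurable_snd]
    rfl

variable {M : Type u} [MeasurableSpace M] {T : M → M} {μ : Measure M} {d : ℕ}
  {v : M → EuclideanSpace ℝ (Fin d)} {V : ℝ}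

/-- The joint law of the Birkhoff sums after regeneration, the regeneration time and
the Birkhoff sums. -/
noncomputable def jointLaw (T : M → M) (v : M → EuclideanSpace ℝ (Fin d)) (Θ : ℕ → Measure M) :
    Measure ((ℕ → EuclideanSpace ℝ (Fin d)) × (ℕ × (ℕ → EuclideanSpace ℝ (Fin d)))) :=
  Measure.sum fun n => (Θ n).map fun x =>
    ((fun k => birkhoffSum T v k (T^[n] x)), (n, fun k => birkhoffSum T v k x))

lemma measurable_pathMap (hT : Measurable T) (hv : Measurable v) :
    Measurable fun x k => birkhoffSum T v k x :=
  measurable_pi_lambda _ fun k => measurable_birkhoffSum hT hv k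

lemma measurable_jointMap (hT : Measurable T) (hv : Measurable v) (n : ℕ) :
    Measurable fun x => ((fun k => birkhoffSum T v k (T^[n] x)),
      (n, fun k => birkhoffSum T v k x)) :=
  ((measurable_pathMap hT hv).comp (hT.iterate n)).prodMk
    (measurable_const.prodMk (measurable_pathMap hT hv))

lemma map_jointLaw (hT : Measurable T) (hv : Measurable v) (Θ : ℕ → Measure M) {β : Type*}
    [MeasurableSpace β] {g : (ℕ → EuclideanSpace ℝ (Fin d)) × (ℕ × (ℕ → EuclideanSpace ℝ (Fin d))) → β}
    (hg : Measurable g) :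
    (jointLaw T v Θ).map g = Measure.sum fun n => (Θ n).map fun x =>
      g ((fun k => birkhoffSum T v k (T^[n] x)), (n, fun k => birkhoffSum T v k x)) := by
  rw [jointLaw, Measure.map_sum hg.aemeasurable]
  congr 1
  ext1 n
  rw [Measure.map_map hg (measurable_jointMap hT hv n)]
  rfl

/-- Started at the regeneration point, the process has the law it has under `μ`. This marginal does
not depend on the initial measure, so two joint laws can be glued along it. -/
lemma jointLaw_fst (hT : Measurable T) (hv : Measurable v) {Θ : ℕ → Measure M}
    (h : Measure.sum (fun n => (Θ n).map T^[n]) = μ) :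
    (jointLaw T v Θ).fst = μ.map fun x k => birkhoffSum T v k x := by
  rw [Measure.fst, map_jointLaw hT hv Θ measurable_fst, ← h,
    Measure.map_sum (measurable_pathMap hT hv).aemeasurable]
  congr 1
  ext1 n
  rw [Measure.map_map (measurable_pathMap hT hv) (hT.iterate n)]
  rfl

lemma ae_jointLaw (hT : Measurable T) (hv : Measurable v) (hV : ∀ x, ‖v x‖ ≤ V)
    (Θ : ℕ → Measure M) :
    ∀ᵐ p ∂jointLaw T v Θ, ∀ k, ‖p.2.2 k - p.1 k‖ ≤ 2 * V * p.2.1 := by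
  have hm : MeasurableSet {p : (ℕ → EuclideanSpace ℝ (Fin d)) ×
      (ℕ × (ℕ → EuclideanSpace ℝ (Fin d))) | ∀ k, ‖p.2.2 k - p.1 k‖ ≤ 2 * V * p.2.1} := by
    rw [ofPred_forall]
    refine .iInter fun k => measurableSet_le ?_ ?_ <;> fun_prop
  rw [jointLaw, ae_iff, Measure.sum_apply]
  · refine ENNReal.tsum_eq_zero.2 fun n => ?_
    rw [← ae_iff, ae_map_iff (measurable_jointMap hT hv n).aemeasurable]
    · exact ae_of_all _ fun x k => norm_birkhoffSum_sub_le hV n k x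
    · exact hm
  · rw [← compl_ofPred]
    exact hm.compl

/-- The coupling of two Birkhoff sum processes whose initial laws regenerate to the same measure:
after the regeneration times the two processes have the same increments. -/
theorem exists_coupling (hT : Measurable T) (hv : Measurable v) (hV : ∀ x, ‖v x‖ ≤ V)
    {ρ₁ ρ₂ : Measure M} [IsProbabilityMeasure ρ₁] [IsProbabilityMeasure ρ₂]
    {Θ₁ Θ₂ : ℕ → Measure M} (h₁ : Measure.sum Θ₁ = ρ₁) (h₂ : Measure.sum Θ₂ = ρ₂)
    (h₁' : Measure.sum (fun n => (Θ₁ n).map T^[n]) = μ)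
    (h₂' : Measure.sum (fun n => (Θ₂ n).map T^[n]) = μ) :
    ∃ (Ω : Type) (_ : MeasurableSpace Ω) (P : Measure Ω)
      (X₁ X₂ : ℕ → Ω → EuclideanSpace ℝ (Fin d)) (N₁ N₂ : Ω → ℕ),
      IsProbabilityMeasure P ∧
      IdentDistrib (fun ω n => X₁ n ω) (fun x n => birkhoffSum T v n x) P ρ₁ ∧
      IdentDistrib (fun ω n => X₂ n ω) (fun x n => birkhoffSum T v n x) P ρ₂ ∧
      Measurable N₁ ∧ Measurable N₂ ∧
      (∀ n, P (N₁ ⁻¹' {n}) = Θ₁ n univ) ∧ (∀ n, P (N₂ ⁻¹' {n}) = Θ₂ n univ) ∧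
      ∀ᵐ ω ∂P, supDist X₁ X₂ ω ≤ ENNReal.ofReal (2 * V * (N₁ ω + N₂ ω)) := by
  have huniv : ∀ {Θ : ℕ → Measure M} {ρ : Measure M} [IsProbabilityMeasure ρ],
      Measure.sum Θ = ρ → IsProbabilityMeasure (jointLaw T v Θ) := by
    intro Θ ρ hρ h
    refine ⟨?_⟩
    rw [jointLaw, Measure.sum_apply _ .univ]
    simp_rw [Measure.map_apply (measurable_jointMap hT hv _) .univ, preimage_univ]
    rw [← Measure.sum_apply _ .univ, h, measure_univ]
  have hp₁ := huniv h₁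
  have hp₂ := huniv h₂
  obtain ⟨P, hP, hP₁, hP₂⟩ := exists_glue (jointLaw T v Θ₁) (jointLaw T v Θ₂)
    (by rw [jointLaw_fst hT hv h₁', jointLaw_fst hT hv h₂'])
  have hlaw : ∀ {Θ : ℕ → Measure M} {ρ : Measure M}, Measure.sum Θ = ρ →
      (jointLaw T v Θ).map (fun p => p.2.2) = ρ.map fun x k => birkhoffSum T v k x := by
    intro Θ ρ h
    rw [map_jointLaw hT hv Θ (by fun_prop), ← h,
      Measure.map_sum (measurable_pathMap hT hv).aemeasurable]
  have htime : ∀ {Θ : ℕ → Measure M} n, jointLaw T v Θ {p | p.2.1 = n} = Θ n univ := by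
    intro Θ n
    have hm : MeasurableSet {p : (ℕ → EuclideanSpace ℝ (Fin d)) ×
        (ℕ × (ℕ → EuclideanSpace ℝ (Fin d))) | p.2.1 = n} :=
      measurableSet_eq_fun (by fun_prop) measurable_const
    rw [jointLaw, Measure.sum_apply _ hm, tsum_eq_single n]
    · rw [Measure.map_apply (measurable_jointMap hT hv n) hm]
      simp
    · intro m hmn
      rw [Measure.map_apply (measurable_jointMap hT hv m) hm]
      simp [hmn]
  have hm₁ : Measurable fun ω : (ℕ → EuclideanSpace ℝ (Fin d)) ×
      ((ℕ × (ℕ → EuclideanSpace ℝ (Fin d))) × (ℕ × (ℕ → EuclideanSpace ℝ (Fin d)))) =>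
      (ω.1, ω.2.1) := by fun_prop
  have hm₂ : Measurable fun ω : (ℕ → EuclideanSpace ℝ (Fin d)) ×
      ((ℕ × (ℕ → EuclideanSpace ℝ (Fin d))) × (ℕ × (ℕ → EuclideanSpace ℝ (Fin d)))) =>
      (ω.1, ω.2.2) := by fun_prop
  refine ⟨_, inferInstance, P, fun n ω => ω.2.1.2 n, fun n ω => ω.2.2.2 n, fun ω => ω.2.1.1,
    fun ω => ω.2.2.1, hP, ⟨by fun_prop, (measurable_pathMap hT hv).aemeasurable, ?_⟩,
    ⟨by fun_prop, (measurable_pathMap hT hv).aemeasurable, ?_⟩, by fun_prop, by fun_prop,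
    fun n => ?_, fun n => ?_, ?_⟩
  · rw [← hlaw h₁, ← hP₁, Measure.map_map (by fun_prop) hm₁]
    rfl
  · rw [← hlaw h₂, ← hP₂, Measure.map_map (by fun_prop) hm₂]
    rfl
  · rw [← htime n, ← hP₁, Measure.map_apply hm₁]
    · rfl
    · exact measurableSet_eq_fun (by fun_prop) measurable_const
  · rw [← htime n, ← hP₂, Measure.map_apply hm₂]
    · rfl
    · exact measurableSet_eq_fun (by fun_prop) measurable_const
  · have a₁ := ae_jointLaw hT hv hV Θ₁
    have a₂ := ae_jointLaw hT hv hV Θ₂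
    rw [← hP₁] at a₁
    rw [← hP₂] at a₂
    filter_upwards [ae_of_ae_map hm₁.aemeasurable a₁, ae_of_ae_map hm₂.aemeasurable a₂]
      with ω e₁ e₂
    refine iSup_le fun k => ?_
    rw [← ofReal_norm]
    refine ENNReal.ofReal_le_ofReal ?_
    -- Both processes are compared at time `k` with the shared regenerated process `ω.1`.
    have := norm_sub_le_norm_sub_add_norm_sub (ω.2.1.2 k) (ω.1 k) (ω.2.2.2 k)
    have h₁ := e₁ k
    have h₂ := e₂ k
    rw [norm_sub_rev] at h₂
    linarith

end Coupling
-- From forward regular measures to regeneration times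
section ForwardRegular

variable {M : Type u} [MeasurableSpace M] [MetricSpace M]
  {m μ ρ : Measure M} {T F : M → M} {τ : M → ℕ} {Y : Set M} {α : Set (Set M)} {lam K R Khat : ℝ}

/-- Pointwise comparability of the density on the two sets is integrated over their product; for
this, `φ` need not be measurable. -/
lemma logLip_withDensity (h0 : μ Yᶜ = 0) (hR : 0 ≤ R) {φ : M → ℝ} (hpos : ∀ x ∈ Y, 0 < φ x)
    (hlip : ∀ x ∈ Y, ∀ y ∈ Y, |Real.log (φ x) - Real.log (φ y)| ≤ R * dist x y) :
    LogLip μ Y R (μ.withDensity fun x => ENNReal.ofReal (φ x)) := by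
  refine ⟨withDensity_absolutelyContinuous _ _ h0, fun A B hA hB hAY hBY δ hδ0 _ hd => ?_⟩
  rw [withDensity_apply _ hA, withDensity_apply _ hB, mul_comm (∫⁻ x in B, _ ∂μ)]
  refine setLIntegral_mul_le hA hB ENNReal.ofReal_ne_top fun x hx y hy => ?_
  rw [← ENNReal.ofReal_mul (Real.exp_pos _).le]
  refine ENNReal.ofReal_le_ofReal ?_
  have h1 := (abs_le.1 (hlip x (hAY hx) y (hBY hy))).2
  have h2 := mul_le_mul_of_nonneg_left (hd x hx y hy) hR
  have hx0 := hpos x (hAY hx)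
  have hy0 := hpos y (hBY hy)
  calc φ x = Real.exp (Real.log (φ x)) := (Real.exp_log hx0).symm
    _ ≤ Real.exp (R * δ + Real.log (φ y)) := Real.exp_le_exp.2 (by linarith)
    _ = _ := by rw [Real.exp_add, Real.exp_log hy0]

lemma IsRegular.logLip (h0 : μ Yᶜ = 0) (hR : 0 ≤ R) (h : IsRegular μ Y R ρ) :
    LogLip μ Y R ρ := by
  obtain ⟨-, -, φ, hpos, hlip, rfl⟩ := h
  exact logLip_withDensity h0 hR hpos hlip

lemma LogLip.bind {E : Type*} [MeasurableSpace E] (hY : MeasurableSet Y) {ϰ : Measure E}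
    {κ : Kernel E M} (h : ∀ᵐ z ∂ϰ, LogLip μ Y R (κ z)) : LogLip μ Y R (ϰ.bind κ) := by
  refine ⟨?_, fun A B hA hB hAY hBY δ h0 h1 hd => ?_⟩
  · rw [Measure.bind_apply hY.compl κ.aemeasurable, lintegral_congr_ae (h.mono fun z hz => hz.1)]
    simp
  · rw [Measure.bind_apply hA κ.aemeasurable, Measure.bind_apply hB κ.aemeasurable,
      ← lintegral_mul_const _ (κ.measurable_coe hA), ← lintegral_mul_const _ (κ.measurable_coe hB),
      ← lintegral_const_mul _ ((κ.measurable_coe hB).mul_const _)]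
    exact lintegral_mono_ae (h.mono fun z hz => hz.2 A B hA hB hAY hBY δ h0 h1 hd)

/-- A forward regular measure has a regeneration time for the measure `μ`. -/
theorem IsForwardRegular.exists_regeneration (hb : IsMarkovBase μ Y (inducedMap T τ) α lam K)
    (hR : K * lam / (lam - 1) < R) (hT : Measurable T) (hτ : Measurable τ)
    (hconst : ∀ a ∈ α, ∃ n : ℕ, ∀ y ∈ a, τ y = n) {E : Type*} [MeasurableSpace E] {ϰ : Measure E}
    {ρz : Kernel E M} {r : E → ℕ} (h : IsForwardRegular T μ Y R ρ ϰ ρz r) :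
    ∃ Θ : ℕ → Measure M, Measure.sum Θ = ρ ∧ Measure.sum (fun n => (Θ n).map T^[n]) = μ ∧
      IsRegenerationLaw (splitRate lam K R) (ENNReal.ofReal (Real.exp R))
        (fun j => μ (τ ⁻¹' {j})) (fun n => ϰ (r ⁻¹' {n})) fun n => Θ n univ := by
  have hϰ := h.isProbabilityMeasure
  have hρz := h.isMarkovKernel
  have hr : ∀ n, MeasurableSet (r ⁻¹' {n}) := fun n => h.measurable_jump (measurableSet_singleton n)
  -- The part of `ρ` with jump `n`: at time `n` it is a mixture of regular measures, hence regular
  -- by `LogLip.bind`.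
  let Q : ℕ → Measure M := fun n => (ϰ.restrict (r ⁻¹' {n})).bind ρz
  have hQ : Measure.sum Q = ρ := by
    ext A hA
    rw [Measure.sum_apply _ hA, h.disintegration, Measure.bind_apply hA ρz.aemeasurable]
    simp_rw [Q, fun n => Measure.bind_apply (m := ϰ.restrict (r ⁻¹' {n})) hA ρz.aemeasurable]
    rw [← lintegral_iUnion hr]
    · congr 2
      rw [show ⋃ n, r ⁻¹' {n} = univ by ext; simp, Measure.restrict_univ]
    · intro i j hij
      exact (disjoint_singleton.2 hij).preimage r
  have hρ : IsProbabilityMeasure ρ := by rw [h.disintegration]; infer_instance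
  have hfin : IsFiniteMeasure (Measure.sum Q) := by rw [hQ]; infer_instance
  have hreg : ∀ n, LogLip μ Y R ((Q n).map T^[n]) := by
    intro n
    have e : (Q n).map T^[n] = (ϰ.restrict (r ⁻¹' {n})).bind (ρz.map T^[n]) := by
      ext A hA
      rw [Measure.map_apply (hT.iterate n) hA, Measure.bind_apply (hT.iterate n hA) ρz.aemeasurable,
        Measure.bind_apply hA (Kernel.aemeasurable _)]
      simp_rw [Kernel.map_apply' _ (hT.iterate n) _ hA]
    rw [e]
    refine LogLip.bind hb.measurableSet_base ?_
    filter_upwards [ae_restrict_mem (hr n)] with z hz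
    rw [Kernel.map_apply _ (hT.iterate n)]
    have := (h.regular z).logLip hb.supported (pos_of_lt hb.one_lt_lam hb.K_nonneg hR).le
    rwa [show r z = n from hz] at this
  obtain ⟨Θ, q, P, hΘ, hΘμ, hq, hP⟩ := NUE.exists_regeneration hb hR hT hτ hconst Q hreg
  refine ⟨Θ, hΘ.trans hQ, ?_, q, P, fun n => ?_, hP⟩
  · rw [hΘμ, hQ, measure_univ, one_smul]
  · rw [hq, Measure.bind_apply .univ ρz.aemeasurable]
    simp

/-- Absolutely continuous probability measures on `Y` with bounded distortion are reference
measures of the induced map. -/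
lemma IsNonuniformlyExpanding.isMarkovBase (hNE : IsNonuniformlyExpanding m T Y α τ lam Khat)
    (hprob : IsProbabilityMeasure μ) (hsupp : μ Yᶜ = 0) (hac : μ ≪ m) (hK : 0 ≤ K)
    (hd : HasDistortion μ (inducedMap T τ) α K) :
    IsMarkovBase μ Y (inducedMap T τ) α lam K where
  isProbabilityMeasure := hprob
  measurableSet_base := hNE.measurableSet_base
  supported := hsupp
  dist_le_one := hNE.dist_le_one
  countable_partition := hNE.countable_partition
  measurableSet_of_mem := hNE.measurableSet_of_mem
  subset_base := hNE.subset_base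
  pairwiseDisjoint := hNE.pairwiseDisjoint
  cover := hac hNE.cover
  measurable_map := measurable_inducedMap hNE.nonsingular.measurable hNE.measurable_return
  mapsTo := hNE.mapsTo
  image_ae := fun a ha => by
    obtain ⟨a', Y', haa', -, -, -, -, hY', hbij, -⟩ := hNE.bijOn a ha
    refine measure_mono_null ?_ (hac hY')
    refine sdiff_subset_sdiff_right ?_
    rw [← hbij.image_eq]
    exact image_mono haa'
  one_lt_lam := hNE.one_lt_lam
  K_nonneg := hK
  expanding := hNE.expanding
  distortion := hd

end ForwardRegular

/-! ### Translation between tails, integrals and weighted sums -/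

section Tails

variable {E : Type*} [MeasurableSpace E] {P : Measure E} {f : E → ℕ}

lemma tsum_measure_preimage_mul (hf : Measurable f) (w : ℕ → ℝ≥0∞) :
    ∑' n, P (f ⁻¹' {n}) * w n = ∫⁻ z, w (f z) ∂P := by
  rw [← lintegral_map (measurable_of_countable w) hf, lintegral_countable']
  refine tsum_congr fun n => ?_
  rw [Measure.map_apply hf (measurableSet_singleton n), mul_comm]

lemma measure_preimage_singleton_le (n : ℕ) : P (f ⁻¹' {n}) ≤ P {z | n ≤ f z} :=
  measure_mono fun _ hz => (mem_singleton_iff.1 hz).ge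

lemma lintegral_tailWeight (hf : Measurable f) (β x : ℝ) :
    ∫⁻ z, tailWeight β x (f z) ∂P = ENNReal.ofReal (x ^ β) * P {z | x ≤ f z} := by
  have hm : MeasurableSet {z | x ≤ f z} :=
    measurableSet_le measurable_const (measurable_from_nat.comp hf)
  rw [← lintegral_indicator_const hm]
  refine lintegral_congr fun z => ?_
  by_cases h : x ≤ f z <;> simp [tailWeight, h]

/-- An integer-valued function exceeds `x` exactly when it exceeds `⌈x⌉₊`, so tails at positive
integers control all real levels `x > 0` with the same constant. -/
lemma tsum_tailWeight_le (hf : Measurable f) {β c x : ℝ} (hβ : 0 < β) (hx : 0 < x) (hc : 0 ≤ c)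
    (h : ∀ n : ℕ, 1 ≤ n → P {z | n ≤ f z} ≤ ENNReal.ofReal (c * (n : ℝ) ^ (-β))) :
    ∑' n, P (f ⁻¹' {n}) * tailWeight β x n ≤ ENNReal.ofReal c := by
  rw [tsum_measure_preimage_mul hf, lintegral_tailWeight hf]
  have h1 := h ⌈x⌉₊ (Nat.ceil_pos.2 hx)
  have e : {z | x ≤ f z} = {z | ⌈x⌉₊ ≤ f z} := by
    ext z; exact (Nat.ceil_le (a := x) (n := f z)).symm
  have hcx : x ≤ ⌈x⌉₊ := Nat.le_ceil x
  rw [e]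
  calc _ ≤ ENNReal.ofReal (x ^ β) * ENNReal.ofReal (c * (⌈x⌉₊ : ℝ) ^ (-β)) := by gcongr
    _ ≤ ENNReal.ofReal c := by
        rw [← ENNReal.ofReal_mul (by positivity)]
        refine ENNReal.ofReal_le_ofReal ?_
        have : (⌈x⌉₊ : ℝ) ^ (-β) ≤ x ^ (-β) := Real.rpow_le_rpow_of_nonpos hx hcx (by linarith)
        calc _ ≤ x ^ β * (c * x ^ (-β)) := by gcongr
          _ = c := by
            rw [Real.rpow_neg hx.le]
            field_simp

lemma measure_le_of_tsum_tailWeight (hf : Measurable f) {β D x : ℝ} (hx : 0 < x)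
    (h : ∑' n, P (f ⁻¹' {n}) * tailWeight β x n ≤ ENNReal.ofReal D) :
    P {z | x ≤ f z} ≤ ENNReal.ofReal (D * x ^ (-β)) := by
  rw [tsum_measure_preimage_mul hf, lintegral_tailWeight hf] at h
  have hxβ : 0 < x ^ β := Real.rpow_pos_of_pos hx β
  rw [Real.rpow_neg hx.le, ← div_eq_mul_inv, ENNReal.ofReal_div_of_pos hxβ,
    ENNReal.le_div_iff_mul_le (.inl (by simpa using hxβ)) (.inl ENNReal.ofReal_ne_top), mul_comm]
  exact h

lemma measure_le_of_tsum_exp (hf : Measurable f) {A γ D x : ℝ} (hA : 0 ≤ A) (hγ : 0 ≤ γ)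
    (hx : 0 < x) (h : ∑' n, P (f ⁻¹' {n}) * ENNReal.ofReal (Real.exp (A * (n : ℝ) ^ γ)) ≤
      ENNReal.ofReal D) :
    P {z | x ≤ f z} ≤ ENNReal.ofReal (D * Real.exp (-A * x ^ γ)) := by
  rw [tsum_measure_preimage_mul hf] at h
  have hm : MeasurableSet {z | x ≤ f z} :=
    measurableSet_le measurable_const (measurable_from_nat.comp hf)
  have h1 : ENNReal.ofReal (Real.exp (A * x ^ γ)) * P {z | x ≤ f z} ≤ ENNReal.ofReal D := by
    rw [← lintegral_indicator_const hm]
    refine (lintegral_mono fun z => ?_).trans h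
    by_cases hz : x ≤ f z
    · simp only [indicator, mem_ofPred_eq, hz, if_true]
      gcongr
    · simp [indicator, hz]
  have hpos := Real.exp_pos (A * x ^ γ)
  rw [neg_mul, Real.exp_neg, ← div_eq_mul_inv, ENNReal.ofReal_div_of_pos hpos,
    ENNReal.le_div_iff_mul_le (.inl (by simpa using hpos)) (.inl ENNReal.ofReal_ne_top), mul_comm]
  exact h1

end Tails

/-! ### Explicit constants and their continuity -/

section Constants

/-- The constant in the polynomial moment bounds of the coupling. -/
noncomputable def couplingPolyConst (p : ℝ × ℝ × ℝ × ℝ × ℝ × ℝ) : ℝ :=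
  2 * ((4 * (p.2.2.2.2.2 + 1)) ^ p.2.2.2.1 *
    polyConst (splitRate p.1 p.2.1 p.2.2.1) p.2.2.1 p.2.2.2.1 p.2.2.2.2.1)

/-- The multiplicative constant in the exponential moment bound of the coupling. -/
noncomputable def couplingExpConst (p : ℝ × ℝ × ℝ × ℝ × ℝ × ℝ × ℝ) : ℝ :=
  2 * (2 / splitRate p.1 p.2.1 p.2.2.1 *
    (1 + p.2.2.2.2.2.1 * expSum p.2.2.2.1 p.2.2.2.2.1))

/-- The rate in the exponential moment bound of the coupling. -/
noncomputable def couplingExpRate (p : ℝ × ℝ × ℝ × ℝ × ℝ × ℝ × ℝ) : ℝ :=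
  expRate (splitRate p.1 p.2.1 p.2.2.1) p.2.2.1 p.2.2.2.1 p.2.2.2.2.1 p.2.2.2.2.2.1 *
    (4 * (p.2.2.2.2.2.2 + 1)) ^ (-p.2.2.2.2.1)

lemma continuousOn_splitRate :
    ContinuousOn (fun p : ℝ × ℝ × ℝ => splitRate p.1 p.2.1 p.2.2)
      {p | 1 < p.1 ∧ 0 < p.2.2} := by
  unfold splitRate
  fun_prop (disch := rintro p ⟨h1, h2⟩; linarith)

lemma continuousOn_couplingPolyConst : ContinuousOn couplingPolyConst polyParams := by
  have key : ∀ p ∈ polyParams, 1 < p.1 ∧ 0 < p.2.2.1 ∧ 1 < p.2.2.2.1 ∧ 0 ≤ p.2.2.2.2.2 ∧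
      0 < splitRate p.1 p.2.1 p.2.2.1 ∧ splitRate p.1 p.2.1 p.2.2.1 < 1 := by
    rintro ⟨lam, K, R, β, c, V⟩ ⟨h1, h2, h3, h4, h5, h6⟩
    exact ⟨h1, pos_of_lt h1 h2 h3, h4, h6, splitRate_pos h1 h2 h3, splitRate_lt_one h1 h2 h3⟩
  have hξ : ContinuousOn (fun p : ℝ × ℝ × ℝ × ℝ × ℝ × ℝ => splitRate p.1 p.2.1 p.2.2.1)
      polyParams := continuousOn_splitRate.comp (f := fun p : ℝ × ℝ × ℝ × ℝ × ℝ × ℝ =>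
        (p.1, p.2.1, p.2.2.1)) (by fun_prop) fun p hp => ⟨(key p hp).1, (key p hp).2.1⟩
  have hs : ContinuousOn (fun p : ℝ × ℝ × ℝ × ℝ × ℝ × ℝ =>
      Real.sqrt (1 - splitRate p.1 p.2.1 p.2.2.1)) polyParams := by fun_prop
  have hβ : ContinuousOn (fun p : ℝ × ℝ × ℝ × ℝ × ℝ × ℝ => p.2.2.2.1) polyParams := by fun_prop
  have hs0 : ∀ p ∈ polyParams, 0 < Real.sqrt (1 - splitRate p.1 p.2.1 p.2.2.1) :=
    fun p hp => sqrt_one_sub_pos (key p hp).2.2.2.2.2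
  have hs1 : ∀ p ∈ polyParams, 0 < 1 - Real.sqrt (1 - splitRate p.1 p.2.1 p.2.2.1) :=
    fun p hp => sub_pos.2 (sqrt_one_sub_lt_one (key p hp).2.2.2.2.1)
  have ht : ContinuousOn (fun p : ℝ × ℝ × ℝ × ℝ × ℝ × ℝ =>
      timeShare (splitRate p.1 p.2.1 p.2.2.1) p.2.2.2.1) polyParams :=
    hs.rpow (continuousOn_const.div hβ fun p hp => by linarith [(key p hp).2.2.1])
      fun p hp => .inl (hs0 p hp).ne'
  have ht1 : ContinuousOn (fun p : ℝ × ℝ × ℝ × ℝ × ℝ × ℝ =>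
      (1 - timeShare (splitRate p.1 p.2.1 p.2.2.1) p.2.2.2.1) ^ (-p.2.2.2.1)) polyParams :=
    (continuousOn_const.sub ht).rpow hβ.neg fun p hp => .inl
      (sub_pos.2 (timeShare_lt_one (key p hp).2.2.2.2.1 (by linarith [(key p hp).2.2.1]))).ne'
  have hi0 := hs.inv₀ fun p hp => (hs0 p hp).ne'
  have hi1 := (continuousOn_const (c := (1 : ℝ)).sub hs).inv₀ fun p hp => (hs1 p hp).ne'
  have hV : ContinuousOn (fun p : ℝ × ℝ × ℝ × ℝ × ℝ × ℝ =>
      (4 * (p.2.2.2.2.2 + 1)) ^ p.2.2.2.1) polyParams :=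
    ContinuousOn.rpow (by fun_prop) hβ fun p hp => .inl (by linarith [(key p hp).2.2.2.1])
  have hc : ContinuousOn (fun p : ℝ × ℝ × ℝ × ℝ × ℝ × ℝ => p.2.2.2.2.1) polyParams := by fun_prop
  have hB : ContinuousOn (fun p : ℝ × ℝ × ℝ × ℝ × ℝ × ℝ =>
      (1 - timeShare (splitRate p.1 p.2.1 p.2.2.1) p.2.2.2.1) ^ (-p.2.2.2.1) *
        Real.exp p.2.2.1 * p.2.2.2.2.1) polyParams := by fun_prop
  exact continuousOn_const.mul (hV.mul (((hi0.mul (hc.add (hB.mul hi1))).add hB).mul hi1))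

lemma expParams_aux {p : ℝ × ℝ × ℝ × ℝ × ℝ × ℝ × ℝ} (hp : p ∈ expParams) :
    1 < p.1 ∧ 0 < p.2.2.1 ∧ 0 < p.2.2.2.1 ∧ 0 < p.2.2.2.2.1 ∧ 0 < p.2.2.2.2.2.1 ∧
      0 ≤ p.2.2.2.2.2.2 ∧ 0 < splitRate p.1 p.2.1 p.2.2.1 ∧
      0 ≤ expSum p.2.2.2.1 p.2.2.2.2.1 := by
  obtain ⟨lam, K, R, a, γ, c, V⟩ := p
  obtain ⟨h1, h2, h3, h4, h5, h6, h7, h8⟩ := hp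
  exact ⟨h1, pos_of_lt h1 h2 h3, h4, h5, h7, h8, splitRate_pos h1 h2 h3, expSum_nonneg h4 h5⟩

lemma continuousOn_splitRate_expParams :
    ContinuousOn (fun p : ℝ × ℝ × ℝ × ℝ × ℝ × ℝ × ℝ => splitRate p.1 p.2.1 p.2.2.1)
      expParams :=
  continuousOn_splitRate.comp (f := fun p : ℝ × ℝ × ℝ × ℝ × ℝ × ℝ × ℝ =>
    (p.1, p.2.1, p.2.2.1)) (by fun_prop) fun _ hp => ⟨(expParams_aux hp).1, (expParams_aux hp).2.1⟩

lemma continuousOn_expSum_expParams :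
    ContinuousOn (fun p : ℝ × ℝ × ℝ × ℝ × ℝ × ℝ × ℝ => expSum p.2.2.2.1 p.2.2.2.2.1)
      expParams := by
  have h1 : ContinuousOn (fun p : ℝ × ℝ × ℝ × ℝ × ℝ × ℝ × ℝ => 2 / p.2.2.2.2.1) expParams :=
    continuousOn_const.div (by fun_prop) fun p hp => (expParams_aux hp).2.2.2.1.ne'
  have h2 : ContinuousOn (fun p : ℝ × ℝ × ℝ × ℝ × ℝ × ℝ × ℝ => 2 / p.2.2.2.1) expParams :=
    continuousOn_const.div (by fun_prop) fun p hp => (expParams_aux hp).2.2.1.ne'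
  exact continuousOn_const.mul ((h1.rpow h1 fun p hp => .inl
    (div_pos two_pos (expParams_aux hp).2.2.2.1).ne').mul (h2.rpow h1 fun p hp => .inl
    (div_pos two_pos (expParams_aux hp).2.2.1).ne'))

lemma continuousOn_couplingExpConst : ContinuousOn couplingExpConst expParams := by
  have h1 := continuousOn_splitRate_expParams
  have h2 := continuousOn_expSum_expParams
  have h3 := continuousOn_const (c := (2 : ℝ)).div h1 fun p hp => (expParams_aux hp).2.2.2.2.2.2.1.ne'
  exact continuousOn_const.mul (h3.mul (by fun_prop))

lemma continuousOn_couplingExpRate : ContinuousOn couplingExpRate expParams := by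
  have h1 := continuousOn_splitRate_expParams
  have h2 := continuousOn_expSum_expParams
  have h3 : ContinuousOn (fun p : ℝ × ℝ × ℝ × ℝ × ℝ × ℝ × ℝ =>
      splitRate p.1 p.2.1 p.2.2.1 * Real.exp (-p.2.2.1) /
        (1 + p.2.2.2.2.2.1 * expSum p.2.2.2.1 p.2.2.2.2.1)) expParams := by
    refine ContinuousOn.div (by fun_prop) (by fun_prop) fun p hp => ?_
    obtain ⟨-, -, -, -, hc, -, -, hs⟩ := expParams_aux hp
    positivity
  have h4 : ContinuousOn (fun p : ℝ × ℝ × ℝ × ℝ × ℝ × ℝ × ℝ =>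
      (4 * (p.2.2.2.2.2.2 + 1)) ^ (-p.2.2.2.2.1)) expParams :=
    ContinuousOn.rpow (by fun_prop) (by fun_prop) fun p hp =>
      .inl (by linarith [(expParams_aux hp).2.2.2.2.2.1])
  unfold couplingExpRate expRate
  fun_prop

lemma couplingExpConst_pos {p : ℝ × ℝ × ℝ × ℝ × ℝ × ℝ × ℝ} (hp : p ∈ expParams) :
    0 < couplingExpConst p := by
  obtain ⟨-, -, -, -, hc, -, hξ, hs⟩ := expParams_aux hp
  unfold couplingExpConst
  positivity

lemma couplingExpRate_pos {p : ℝ × ℝ × ℝ × ℝ × ℝ × ℝ × ℝ} (hp : p ∈ expParams) :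
    0 < couplingExpRate p := by
  obtain ⟨-, -, ha, hγ, hc, hV, hξ, hs⟩ := expParams_aux hp
  have := expRate_pos (R := p.2.2.1) hξ ha hγ hc
  unfold couplingExpRate
  positivity

end Constants

/-! ### Assembly of the coupling theorem -/

section MainCoupling

variable {M : Type u} [MetricSpace M] [MeasurableSpace M]
  {m μ : Measure M} {T : M → M} {Y : Set M} {α : Set (Set M)} {τ : M → ℕ} {lam Khat K R : ℝ}

/-- If `2 V (N₁ + N₂) ≥ x`, one of the times is at least `x / (4 (V + 1))`. Replacing `V` by `V + 1`
avoids division by zero and keeps the constants continuous at `V = 0`. -/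
lemma measure_le_add_of_supDist {Ω : Type*} [MeasurableSpace Ω] {P : Measure Ω} {d : ℕ}
    {X₁ X₂ : ℕ → Ω → EuclideanSpace ℝ (Fin d)} {N₁ N₂ : Ω → ℕ} {V x : ℝ} (hV : 0 ≤ V)
    (h : ∀ᵐ ω ∂P, supDist X₁ X₂ ω ≤ ENNReal.ofReal (2 * V * (N₁ ω + N₂ ω))) :
    P {ω | ENNReal.ofReal x ≤ supDist X₁ X₂ ω} ≤
      P {ω | x / (4 * (V + 1)) ≤ N₁ ω} + P {ω | x / (4 * (V + 1)) ≤ N₂ ω} := by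
  refine le_trans ?_ (measure_union_le _ _)
  refine measure_mono_ae ?_
  filter_upwards [h] with ω hω hxω
  have h1 : ENNReal.ofReal x ≤ ENNReal.ofReal (2 * V * (N₁ ω + N₂ ω)) := hxω.trans hω
  rw [ENNReal.ofReal_le_ofReal_iff (by positivity)] at h1
  by_contra hcon
  obtain ⟨h2, h3⟩ : ¬ (x / (4 * (V + 1)) ≤ N₁ ω) ∧ ¬ (x / (4 * (V + 1)) ≤ N₂ ω) := by
    exact not_or.1 hcon
  push Not at h2 h3
  rw [lt_div_iff₀ (by positivity)] at h2 h3
  have : (0 : ℝ) ≤ N₁ ω := Nat.cast_nonneg _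
  have : (0 : ℝ) ≤ N₂ ω := Nat.cast_nonneg _
  nlinarith

lemma supDist_rpow_le {Ω : Type*} {d : ℕ}
    {X₁ X₂ : ℕ → Ω → EuclideanSpace ℝ (Fin d)} {n₁ n₂ : ℕ} {V β : ℝ} (hV : 0 ≤ V) (hβ : 0 < β)
    {ω : Ω} (h : supDist X₁ X₂ ω ≤ ENNReal.ofReal (2 * V * (n₁ + n₂))) :
    supDist X₁ X₂ ω ^ β ≤
      ENNReal.ofReal ((4 * (V + 1)) ^ β) * ((n₁ : ℝ≥0∞) ^ β + (n₂ : ℝ≥0∞) ^ β) := by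
  have key : ∀ n : ℕ, 2 * V * (n₁ + n₂ : ℝ) ≤ 4 * (V + 1) * n → supDist X₁ X₂ ω ^ β ≤
      ENNReal.ofReal ((4 * (V + 1)) ^ β) * (n : ℝ≥0∞) ^ β := by
    intro n hn
    rw [← ENNReal.ofReal_rpow_of_nonneg (by positivity) hβ.le,
      ← ENNReal.mul_rpow_of_nonneg _ _ hβ.le, ← ENNReal.ofReal_natCast,
      ← ENNReal.ofReal_mul (by positivity)]
    exact ENNReal.rpow_le_rpow (h.trans (ENNReal.ofReal_le_ofReal hn)) hβ.le
  rw [mul_add]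
  have h1 : (0 : ℝ) ≤ n₁ := Nat.cast_nonneg _
  have h2 : (0 : ℝ) ≤ n₂ := Nat.cast_nonneg _
  rcases le_total (n₁ : ℝ) n₂ with h12 | h12
  · exact (key n₂ (by nlinarith)).trans le_add_self
  · exact (key n₁ (by nlinarith)).trans le_self_add

/-- The coupling is constructed before any moment parameters are chosen, so the same one satisfies
all three families of bounds. -/
theorem exists_forwardRegular_coupling (hNE : IsNonuniformlyExpanding m T Y α τ lam Khat)
    (hμ : IsACIP m Y (inducedMap T τ) μ) (hK : 0 ≤ K)
    (hdist : HasDistortion μ (inducedMap T τ) α K) (hR : K * lam / (lam - 1) < R)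
    {E₁ : Type w₁} [MeasurableSpace E₁] {E₂ : Type w₂} [MeasurableSpace E₂]
    {ρ₁ ρ₂ : Measure M} {ϰ₁ : Measure E₁} {ϰ₂ : Measure E₂}
    {ρz₁ : Kernel E₁ M} {ρz₂ : Kernel E₂ M} {r₁ : E₁ → ℕ} {r₂ : E₂ → ℕ}
    (hρ₁ : IsForwardRegular T μ Y R ρ₁ ϰ₁ ρz₁ r₁) (hρ₂ : IsForwardRegular T μ Y R ρ₂ ϰ₂ ρz₂ r₂)
    {d : ℕ} {v : M → EuclideanSpace ℝ (Fin d)} (hv : Measurable v)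
    (hbdd : BddAbove (Set.range fun x => ‖v x‖)) :
    ∃ (Ω : Type) (_ : MeasurableSpace Ω) (P : Measure Ω)
        (X₁ X₂ : ℕ → Ω → EuclideanSpace ℝ (Fin d)),
        IsProbabilityMeasure P ∧
        IdentDistrib (fun ω n => X₁ n ω) (fun x n => birkhoffSum T v n x) P ρ₁ ∧
        IdentDistrib (fun ω n => X₂ n ω) (fun x n => birkhoffSum T v n x) P ρ₂ ∧
        (∀ᵐ ω ∂P, NUE.supDist X₁ X₂ ω < ∞) ∧
        (∀ β c : ℝ, 1 < β → 0 < c →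
          (∀ n : ℕ, 1 ≤ n → ϰ₁ {z | n ≤ r₁ z} ≤ ENNReal.ofReal (c * (n : ℝ) ^ (-β))) →
          (∀ n : ℕ, 1 ≤ n → ϰ₂ {z | n ≤ r₂ z} ≤ ENNReal.ofReal (c * (n : ℝ) ^ (-β))) →
          (∀ n : ℕ, 1 ≤ n → μ {y | n ≤ τ y} ≤ ENNReal.ofReal (c * (n : ℝ) ^ (-β))) →
          ∀ x : ℝ, 0 < x →
            P {ω | ENNReal.ofReal x ≤ NUE.supDist X₁ X₂ ω} ≤
              ENNReal.ofReal (couplingPolyConst (lam, K, R, β, c, ⨆ y, ‖v y‖) * x ^ (-β))) ∧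
        (∀ β c : ℝ, 1 < β → 0 < c →
          ∫⁻ z, (r₁ z : ℝ≥0∞) ^ β ∂ϰ₁ ≤ ENNReal.ofReal c →
          ∫⁻ z, (r₂ z : ℝ≥0∞) ^ β ∂ϰ₂ ≤ ENNReal.ofReal c →
          ∫⁻ y, (τ y : ℝ≥0∞) ^ β ∂μ ≤ ENNReal.ofReal c →
            ∫⁻ ω, NUE.supDist X₁ X₂ ω ^ β ∂P ≤
              ENNReal.ofReal (couplingPolyConst (lam, K, R, β, c, ⨆ y, ‖v y‖))) ∧
        (∀ a γ c : ℝ, 0 < a → 0 < γ → γ ≤ 1 → 0 < c →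
          (∀ n : ℕ, 1 ≤ n →
            ϰ₁ {z | n ≤ r₁ z} ≤ ENNReal.ofReal (c * Real.exp (-a * (n : ℝ) ^ γ))) →
          (∀ n : ℕ, 1 ≤ n →
            ϰ₂ {z | n ≤ r₂ z} ≤ ENNReal.ofReal (c * Real.exp (-a * (n : ℝ) ^ γ))) →
          (∀ n : ℕ, 1 ≤ n →
            μ {y | n ≤ τ y} ≤ ENNReal.ofReal (c * Real.exp (-a * (n : ℝ) ^ γ))) →
          ∀ x : ℝ, 0 < x →
            P {ω | ENNReal.ofReal x ≤ NUE.supDist X₁ X₂ ω} ≤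
              ENNReal.ofReal (couplingExpConst (lam, K, R, a, γ, c, ⨆ y, ‖v y‖) *
                Real.exp (-couplingExpRate (lam, K, R, a, γ, c, ⨆ y, ‖v y‖) * x ^ γ))) := by
  have hb := hNE.isMarkovBase hμ.isProbabilityMeasure hμ.supported hμ.absolutelyContinuous hK hdist
  have hlam := hNE.one_lt_lam
  have hT := hNE.nonsingular.measurable
  have hτ := hNE.measurable_return
  have hR0 := pos_of_lt hlam hK hR
  have hξ0 := splitRate_pos hlam hK hR
  have hξ1 := splitRate_lt_one hlam hK hR
  set V := ⨆ y, ‖v y‖ with hVdef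
  have hV : ∀ x, ‖v x‖ ≤ V := fun x => le_ciSup hbdd x
  have hV0 : 0 ≤ V := Real.iSup_nonneg fun x => norm_nonneg _
  have hϰ₁ := hρ₁.isProbabilityMeasure
  have hϰ₂ := hρ₂.isProbabilityMeasure
  have hz₁ := hρ₁.isMarkovKernel
  have hz₂ := hρ₂.isMarkovKernel
  have hp₁ : IsProbabilityMeasure ρ₁ := by rw [hρ₁.disintegration]; infer_instance
  have hp₂ : IsProbabilityMeasure ρ₂ := by rw [hρ₂.disintegration]; infer_instance
  obtain ⟨Θ₁, hΘ₁, hΘ₁', hlaw₁⟩ := hρ₁.exists_regeneration hb hR hT hτ hNE.return_const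
  obtain ⟨Θ₂, hΘ₂, hΘ₂', hlaw₂⟩ := hρ₂.exists_regeneration hb hR hT hτ hNE.return_const
  obtain ⟨Ω, mΩ, P, X₁, X₂, N₁, N₂, hP, hX₁, hX₂, hN₁, hN₂, hPN₁, hPN₂, hsup⟩ :=
    exists_coupling hT hv hV hΘ₁ hΘ₂ hΘ₁' hΘ₂'
  simp_rw [← hPN₁] at hlaw₁
  simp_rw [← hPN₂] at hlaw₂
  have hq₁ : ∑' n, ϰ₁ (r₁ ⁻¹' {n}) ≤ 1 := by
    simpa using (tsum_measure_preimage_mul (P := ϰ₁) hρ₁.measurable_jump 1).le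
  have hq₂ : ∑' n, ϰ₂ (r₂ ⁻¹' {n}) ≤ 1 := by
    simpa using (tsum_measure_preimage_mul (P := ϰ₂) hρ₂.measurable_jump 1).le
  refine ⟨Ω, mΩ, P, X₁, X₂, hP, hX₁, hX₂, ?_, ?_, ?_, ?_⟩
  · filter_upwards [hsup] with ω hω using hω.trans_lt ENNReal.ofReal_lt_top
  · intro β c hβ hc h₁ h₂ hτβ x hx
    have hβ0 : 0 < β := zero_lt_one.trans hβ
    have hy : 0 < x / (4 * (V + 1)) := by positivity
    have bound : ∀ {q₀ : ℕ → ℝ≥0∞} {N : Ω → ℕ}, Measurable N → ∑' n, q₀ n ≤ 1 →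
        (∀ y : ℝ, 0 < y → ∑' n, q₀ n * tailWeight β y n ≤ ENNReal.ofReal c) →
        IsRegenerationLaw (splitRate lam K R) (ENNReal.ofReal (Real.exp R))
          (fun j => μ (τ ⁻¹' {j})) q₀ (fun n => P (N ⁻¹' {n})) →
        P {ω | x / (4 * (V + 1)) ≤ N ω} ≤ ENNReal.ofReal
          (polyConst (splitRate lam K R) R β c * (x / (4 * (V + 1))) ^ (-β)) := by
      intro q₀ N hN hq₀ hqt hlaw
      refine measure_le_of_tsum_tailWeight hN hy ?_
      refine hlaw.tsum_le_polyConst hq₀ hξ0 hξ1 hβ0 hc.le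
        -- All levels at once, because splitting a tail event rescales its level.
        (𝒲 := {w | ∃ y : ℝ, 0 < y ∧ w = tailWeight β y}) ?_ ?_ ?_ ⟨_, hy, rfl⟩
      · rintro w ⟨y, hy, rfl⟩ s t hs ht hst
        exact ⟨_, ⟨s * y, by positivity, rfl⟩, _, ⟨t * y, by positivity, rfl⟩,
          tailWeight_add_le hy hs ht hst⟩
      · rintro w ⟨y, hy, rfl⟩
        exact hqt y hy
      · rintro w ⟨y, hy, rfl⟩
        exact tsum_tailWeight_le hτ hβ0 hy hc.le hτβ
    refine (measure_le_add_of_supDist hV0 hsup).trans ((add_le_add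
      (bound hN₁ hq₁ (fun y hy => tsum_tailWeight_le hρ₁.measurable_jump hβ0 hy hc.le h₁) hlaw₁)
      (bound hN₂ hq₂ (fun y hy => tsum_tailWeight_le hρ₂.measurable_jump hβ0 hy hc.le h₂)
        hlaw₂)).trans_eq ?_)
    rw [← two_mul, ← ENNReal.ofReal_ofNat, ← ENNReal.ofReal_mul (by positivity), couplingPolyConst,
      Real.div_rpow hx.le (by positivity), Real.rpow_neg (x := 4 * (V + 1)) (by positivity),
      div_inv_eq_mul]
    congr 1
    ring
  · intro β c hβ hc h₁ h₂ hτβ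
    have hβ0 : 0 < β := zero_lt_one.trans hβ
    have bound : ∀ {q₀ : ℕ → ℝ≥0∞} {N : Ω → ℕ}, Measurable N → ∑' n, q₀ n ≤ 1 →
        (∑' n, q₀ n * (n : ℝ≥0∞) ^ β ≤ ENNReal.ofReal c) →
        IsRegenerationLaw (splitRate lam K R) (ENNReal.ofReal (Real.exp R))
          (fun j => μ (τ ⁻¹' {j})) q₀ (fun n => P (N ⁻¹' {n})) →
        ∫⁻ ω, (N ω : ℝ≥0∞) ^ β ∂P ≤
          ENNReal.ofReal (polyConst (splitRate lam K R) R β c) := by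
      intro q₀ N hN hq₀ hqt hlaw
      rw [← tsum_measure_preimage_mul hN fun n : ℕ => (n : ℝ≥0∞) ^ β]
      refine hlaw.tsum_le_polyConst hq₀ hξ0 hξ1 hβ0 hc.le
        -- Splitting a power reproduces the same power, so a single weight suffices.
        (𝒲 := {fun n : ℕ => (n : ℝ≥0∞) ^ β}) ?_ ?_ ?_ rfl
      · rintro w rfl s t hs ht hst
        exact ⟨_, rfl, _, rfl, natCast_add_rpow_le hβ0 hs ht hst⟩
      · rintro w rfl
        exact hqt
      · rintro w rfl
        rw [tsum_measure_preimage_mul hτ fun n : ℕ => (n : ℝ≥0∞) ^ β]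
        exact hτβ
    have b₁ := bound hN₁ hq₁ (by
      rw [tsum_measure_preimage_mul hρ₁.measurable_jump fun n : ℕ => (n : ℝ≥0∞) ^ β]
      exact h₁) hlaw₁
    have b₂ := bound hN₂ hq₂ (by
      rw [tsum_measure_preimage_mul hρ₂.measurable_jump fun n : ℕ => (n : ℝ≥0∞) ^ β]
      exact h₂) hlaw₂
    calc ∫⁻ ω, supDist X₁ X₂ ω ^ β ∂P
        ≤ ∫⁻ ω, ENNReal.ofReal ((4 * (V + 1)) ^ β) *
            ((N₁ ω : ℝ≥0∞) ^ β + (N₂ ω : ℝ≥0∞) ^ β) ∂P := by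
          refine lintegral_mono_ae ?_
          filter_upwards [hsup] with ω hω using supDist_rpow_le hV0 hβ0 hω
      _ = ENNReal.ofReal ((4 * (V + 1)) ^ β) *
          (∫⁻ ω, (N₁ ω : ℝ≥0∞) ^ β ∂P + ∫⁻ ω, (N₂ ω : ℝ≥0∞) ^ β ∂P) := by
          rw [lintegral_const_mul' _ _ ENNReal.ofReal_ne_top, lintegral_add_left]
          exact (measurable_of_countable fun n : ℕ => (n : ℝ≥0∞) ^ β).comp hN₁
      _ ≤ _ := by
          refine (mul_le_mul_right (add_le_add b₁ b₂) _).trans_eq ?_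
          rw [← two_mul, couplingPolyConst, ENNReal.ofReal_mul zero_le_two,
            ENNReal.ofReal_mul (by positivity), ENNReal.ofReal_ofNat]
          ring
  · intro a γ c ha hγ hγ1 hc h₁ h₂ hτa x hx
    have hy : 0 < x / (4 * (V + 1)) := by positivity
    have bound : ∀ {q₀ : ℕ → ℝ≥0∞} {N : Ω → ℕ}, Measurable N → ∑' n, q₀ n ≤ 1 →
        (∀ n, 1 ≤ n → q₀ n ≤ ENNReal.ofReal (c * Real.exp (-a * (n : ℝ) ^ γ))) →
        IsRegenerationLaw (splitRate lam K R) (ENNReal.ofReal (Real.exp R))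
          (fun j => μ (τ ⁻¹' {j})) q₀ (fun n => P (N ⁻¹' {n})) →
        P {ω | x / (4 * (V + 1)) ≤ N ω} ≤ ENNReal.ofReal
          (2 / splitRate lam K R * (1 + c * expSum a γ) *
            Real.exp (-expRate (splitRate lam K R) R a γ c * (x / (4 * (V + 1))) ^ γ)) := by
      intro q₀ N hN hq₀ hqt hlaw
      exact measure_le_of_tsum_exp hN (expRate_pos hξ0 ha hγ hc).le hγ.le hy
        (hlaw.tsum_exp_le hq₀ hξ0 hξ1 hR0.le ha hγ hγ1 hc hqt
          fun n hn => (measure_preimage_singleton_le n).trans (hτa n hn))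
    refine (measure_le_add_of_supDist hV0 hsup).trans ((add_le_add
      (bound hN₁ hq₁ (fun n hn => (measure_preimage_singleton_le n).trans (h₁ n hn)) hlaw₁)
      (bound hN₂ hq₂ (fun n hn => (measure_preimage_singleton_le n).trans (h₂ n hn)) hlaw₂)).trans_eq ?_)
    rw [← two_mul, ← ENNReal.ofReal_ofNat, ← ENNReal.ofReal_mul (by positivity), couplingExpConst,
      couplingExpRate, Real.div_rpow hx.le (by positivity),
      Real.rpow_neg (x := 4 * (V + 1)) (by positivity)]
    congr 1
    rw [mul_assoc 2]
    congr 3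
    ring_nf

end MainCoupling
-- Existence of the invariant measure and ergodicity
section InvariantMeasure

variable {M : Type u} [MeasurableSpace M] [MetricSpace M]
  {m μ ν : Measure M} {T F : M → M} {τ : M → ℕ} {Y : Set M} {α : Set (Set M)}
  {lam K R Khat : ℝ}

/-- The push-forward of a regular measure splits off a fixed proportion of the reference measure. -/
lemma IsMarkovBase.map_split (hb : IsMarkovBase μ Y F α lam K) (hR : K * lam / (lam - 1) < R)
    [IsFiniteMeasure ν] (h : LogLip μ Y R ν) :
    ∃ ν' : Measure M, ν.map F = (ENNReal.ofReal (splitRate lam K R) * ν univ) • μ + ν' ∧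
      ν' univ = ENNReal.ofReal (1 - splitRate lam K R) * ν univ ∧ LogLip μ Y R ν' := by
  have hprob := hb.isProbabilityMeasure
  have hlam : 0 < lam := zero_lt_one.trans hb.one_lt_lam
  have hR0 := pos_of_lt hb.one_lt_lam hb.K_nonneg hR
  have hK := hb.K_nonneg
  have hξ0 := splitRate_pos hb.one_lt_lam hb.K_nonneg hR
  have hreg := hb.logLip_map_restrict_of_forall h (S := univ) fun a _ => .inl (subset_univ a)
  rw [Measure.restrict_univ] at hreg
  have huniv : ν.map F univ = ν univ := by
    rw [Measure.map_apply hb.measurable_map .univ, preimage_univ]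
  obtain ⟨hle, hsub⟩ := hreg.sub_smul hb (ξ := splitRate lam K R) (by positivity)
    (splitRate_aux hb.one_lt_lam hR) rfl
  rw [huniv] at hle hsub
  have hfin : IsFiniteMeasure ((ENNReal.ofReal (splitRate lam K R) * ν univ) • μ) :=
    isFiniteMeasure_of_le _ hle
  refine ⟨_, ?_, ?_, hsub⟩
  · rw [add_comm, Measure.sub_add_cancel_of_le hle]
  · rw [Measure.sub_apply .univ hle, huniv, ENNReal.ofReal_sub _ hξ0.le, ENNReal.ofReal_one,
      ENNReal.sub_mul fun _ _ => measure_ne_top _ _]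
    simp

/-- Existence of an invariant probability measure that is regular with respect to the reference
measure. -/
theorem IsMarkovBase.exists_invariant (hb : IsMarkovBase μ Y F α lam K)
    (hR : K * lam / (lam - 1) < R) :
    ∃ ν : Measure M, IsProbabilityMeasure ν ∧ MeasurePreserving F ν ν ∧ LogLip μ Y R ν := by
  have hprob := hb.isProbabilityMeasure
  have hR0 := pos_of_lt hb.one_lt_lam hb.K_nonneg hR
  have hξ0 := splitRate_pos hb.one_lt_lam hb.K_nonneg hR
  have hξ1 := splitRate_lt_one hb.one_lt_lam hb.K_nonneg hR
  set ξ := splitRate lam K R with hξ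
  let X := {ν : Measure M // IsFiniteMeasure ν ∧ LogLip μ Y R ν}
  have step : ∀ ν : X, ∃ ν' : X, ν.1.map F = (ENNReal.ofReal ξ * ν.1 univ) • μ + ν'.1 ∧
      ν'.1 univ = ENNReal.ofReal (1 - ξ) * ν.1 univ := by
    rintro ⟨ν, hν, hreg⟩
    obtain ⟨ν', h1, h2, h3⟩ := hb.map_split hR hreg
    refine ⟨⟨ν', ⟨?_⟩, h3⟩, h1, h2⟩
    rw [h2]
    exact ENNReal.mul_lt_top ENNReal.ofReal_lt_top (measure_lt_top _ _)
  choose next hmap hmass using step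
  let η : ℕ → X := fun k => next^[k] ⟨μ, inferInstance, logLip_self hb.supported hR0.le⟩
  have hη : ∀ k, η (k + 1) = next (η k) := fun k => Function.iterate_succ_apply' _ _ _
  have hηuniv : ∀ k, (η k).1 univ = ENNReal.ofReal (1 - ξ) ^ k := by
    intro k
    induction k with
    | zero => simp [η]
    | succ k ih => rw [hη, hmass, ih, pow_succ']
  have hgeo : ENNReal.ofReal ξ * ∑' k : ℕ, ENNReal.ofReal (1 - ξ) ^ k = 1 := by
    rw [ENNReal.tsum_geometric, ← ENNReal.ofReal_one, ← ENNReal.ofReal_sub _ (sub_nonneg.2 hξ1.le),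
      sub_sub_cancel, ENNReal.mul_inv_cancel (by simpa using hξ0) ENNReal.ofReal_ne_top,
      ENNReal.ofReal_one]
  -- Pushing the series forward shifts the remainders by one index, and the multiples of `μ` split
  -- off along the way have total mass 1, which restores the missing term `η 0 = μ`.
  refine ⟨ENNReal.ofReal ξ • Measure.sum fun k => (η k).1, ⟨?_⟩, ⟨hb.measurable_map, ?_⟩,
    (LogLip.sum hb.measurableSet_base fun k => (η k).2.2).smul _⟩
  · rw [Measure.smul_apply, Measure.sum_apply _ .univ, smul_eq_mul]
    simp_rw [hηuniv]
    exact hgeo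
  · rw [Measure.map_smul, Measure.map_sum hb.measurable_map.aemeasurable]
    congr 1
    ext A hA
    rw [Measure.sum_apply _ hA, Measure.sum_apply _ hA, tsum_eq_zero_add' (f := fun k => (η k).1 A) ENNReal.summable]
    simp_rw [hmap, ← hη, Measure.add_apply, hηuniv, Measure.smul_apply, smul_eq_mul]
    rw [ENNReal.tsum_add, ENNReal.tsum_mul_right, ENNReal.tsum_mul_left, hgeo, one_mul]
    rfl

/-- As `ν A = ν.map F A`, repeated splitting replaces all but a fraction `(1 - ξ) ^ n` of `ν` by
multiples of `μ` without changing the mass of `A`; then `n` tends to infinity. -/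
lemma IsMarkovBase.measure_invariant_le (hb : IsMarkovBase μ Y F α lam K)
    (hR : K * lam / (lam - 1) < R) [IsFiniteMeasure ν] (h : LogLip μ Y R ν) {A : Set M}
    (hA : MeasurableSet A) (hFA : F ⁻¹' A = A) : ν A ≤ ν univ * μ A := by
  have hξ0 := splitRate_pos hb.one_lt_lam hb.K_nonneg hR
  have hξ1 := splitRate_lt_one hb.one_lt_lam hb.K_nonneg hR
  set ξ := splitRate lam K R with hξ
  have hsum : ENNReal.ofReal ξ + ENNReal.ofReal (1 - ξ) = 1 := by
    rw [← ENNReal.ofReal_add hξ0.le (sub_nonneg.2 hξ1.le)]; simp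
  have key : ∀ n : ℕ, ∀ ν : Measure M, IsFiniteMeasure ν → LogLip μ Y R ν →
      ν A ≤ ν univ * (μ A + ENNReal.ofReal (1 - ξ) ^ n) := by
    intro n
    induction n with
    | zero =>
      intro ν _ _
      calc ν A ≤ ν univ * 1 := by rw [mul_one]; exact measure_mono (subset_univ A)
        _ ≤ _ := by gcongr; simp
    | succ n ih =>
      intro ν _ hν
      obtain ⟨ν', h1, h2, h3⟩ := hb.map_split hR hν
      have hfin : IsFiniteMeasure ν' :=
        ⟨by rw [h2]; exact ENNReal.mul_lt_top ENNReal.ofReal_lt_top (measure_lt_top _ _)⟩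
      have e : ν A = ν.map F A := by rw [Measure.map_apply hb.measurable_map hA, hFA]
      rw [e, h1, Measure.add_apply, Measure.smul_apply, smul_eq_mul]
      calc _ ≤ ENNReal.ofReal ξ * ν univ * μ A +
            ν' univ * (μ A + ENNReal.ofReal (1 - ξ) ^ n) := by gcongr; exact ih ν' hfin h3
        _ = (ENNReal.ofReal ξ + ENNReal.ofReal (1 - ξ)) * ν univ * μ A +
            ν univ * ENNReal.ofReal (1 - ξ) ^ (n + 1) := by rw [h2, pow_succ']; ring
        _ = _ := by rw [hsum]; ring
  have hlim : Filter.Tendsto (fun n : ℕ => ν univ * (μ A + ENNReal.ofReal (1 - ξ) ^ n))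
      Filter.atTop (nhds (ν univ * (μ A + 0))) := by
    refine ENNReal.Tendsto.const_mul (.add tendsto_const_nhds ?_) (.inr (measure_ne_top _ _))
    exact ENNReal.tendsto_pow_atTop_nhds_zero_of_lt_one
      (ENNReal.ofReal_lt_one.2 (by linarith))
  rw [add_zero] at hlim
  exact ge_of_tendsto' hlim fun n => key n ν inferInstance h

/-- The induced map is ergodic. -/
theorem IsMarkovBase.ergodic [BorelSpace M] (hb : IsMarkovBase μ Y F α lam K)
    (hinv : MeasurePreserving F μ μ) : Ergodic F μ := by
  have hprob := hb.isProbabilityMeasure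
  refine ⟨hinv, ⟨fun A hA hFA => ?_⟩⟩
  -- An invariant set is at most as likely given any closed set as it is outright. The indicator of
  -- `B` is the limit of `exp (-n * infDist x B)`, whose logarithm is `n`-Lipschitz.
  have closed : ∀ B : Set M, IsClosed B → μ (A ∩ B) ≤ μ B * μ A := by
    intro B hB
    rcases B.eq_empty_or_nonempty with rfl | hne
    · simp
    let φ : ℕ → M → ℝ := fun n x => Real.exp (-(n * Metric.infDist x B))
    have hφ : ∀ n, Measurable (φ n) := fun n => by fun_prop
    have hφ1 : ∀ n x, φ n x ≤ 1 := fun n x => Real.exp_le_one_iff.2 (by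
      have := Metric.infDist_nonneg (x := x) (s := B)
      have : (0 : ℝ) ≤ n * Metric.infDist x B := by positivity
      linarith)
    have hlim : ∀ x, Filter.Tendsto (fun n => ENNReal.ofReal (φ n x)) Filter.atTop
        (nhds (B.indicator 1 x)) := by
      intro x
      by_cases hx : x ∈ B
      · simp [φ, Metric.infDist_zero_of_mem hx, hx]
      · have hd : 0 < Metric.infDist x B := (hB.notMem_iff_infDist_pos hne).1 hx
        rw [indicator_of_notMem hx, ← ENNReal.ofReal_zero]
        refine ENNReal.tendsto_ofReal ?_
        refine Real.tendsto_exp_neg_atTop_nhds_zero.comp ?_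
        exact tendsto_natCast_atTop_atTop.atTop_mul_const hd
    have hle : ∀ n : ℕ, ∫⁻ x in A, ENNReal.ofReal (φ n x) ∂μ ≤
        (∫⁻ x, ENNReal.ofReal (φ n x) ∂μ) * μ A := by
      intro n
      -- The split rate degenerates as `n` grows, but it does not appear in the inequality obtained,
      -- so the limit can be taken.
      set R' : ℝ := max n (K * lam / (lam - 1) + 1)
      have hreg : LogLip μ Y R' (μ.withDensity fun x => ENNReal.ofReal (φ n x)) := by
        refine logLip_withDensity hb.supported ((Nat.cast_nonneg n).trans (le_max_left _ _))
          (fun x _ => Real.exp_pos _) fun x _ y _ => ?_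
        simp only [φ, Real.log_exp]
        have h1 := Metric.infDist_le_infDist_add_dist (s := B) (x := x) (y := y)
        have h2 := Metric.infDist_le_infDist_add_dist (s := B) (x := y) (y := x)
        rw [dist_comm y x] at h2
        have h3 : |Metric.infDist y B - Metric.infDist x B| ≤ dist x y :=
          abs_sub_le_iff.2 ⟨by linarith, by linarith⟩
        calc |-(n * Metric.infDist x B) - -(n * Metric.infDist y B)|
            = n * |Metric.infDist y B - Metric.infDist x B| := by
              rw [← abs_of_nonneg (Nat.cast_nonneg (α := ℝ) n), ← abs_mul,
                abs_of_nonneg (Nat.cast_nonneg (α := ℝ) n)]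
              ring_nf
          _ ≤ R' * dist x y := by
              gcongr
              exact le_max_left _ _
      have hfin : IsFiniteMeasure (μ.withDensity fun x => ENNReal.ofReal (φ n x)) := by
        refine ⟨?_⟩
        rw [withDensity_apply _ .univ]
        refine (lintegral_mono fun x => ENNReal.ofReal_le_one.2 (hφ1 n x)).trans_lt ?_
        simp
      have := hb.measure_invariant_le ((lt_add_one _).trans_le (le_max_right _ _)) hreg hA hFA
      rwa [withDensity_apply _ hA, withDensity_apply _ .univ, Measure.restrict_univ] at this
    have l1 := tendsto_lintegral_of_dominated_convergence (μ := μ.restrict A) (fun _ => 1)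
      (fun n => (hφ n).ennreal_ofReal) (fun n => ae_of_all _ fun x =>
        ENNReal.ofReal_le_one.2 (hφ1 n x)) (by simp) (ae_of_all _ hlim)
    have l2 := tendsto_lintegral_of_dominated_convergence (μ := μ) (fun _ => 1)
      (fun n => (hφ n).ennreal_ofReal) (fun n => ae_of_all _ fun x =>
        ENNReal.ofReal_le_one.2 (hφ1 n x)) (by simp) (ae_of_all _ hlim)
    have l3 := le_of_tendsto_of_tendsto' l1
      (ENNReal.Tendsto.mul_const l2 (.inr (measure_ne_top μ A))) hle
    rwa [lintegral_indicator_one hB.measurableSet, lintegral_indicator_one hB.measurableSet,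
      Measure.restrict_apply hB.measurableSet, inter_comm] at l3
  rw [Filter.eventuallyConst_set']
  rcases eq_or_ne (μ A) 0 with h0 | h0
  · exact .inl (ae_eq_empty.2 h0)
  · right
    -- With `B ⊆ A` closed of positive measure, the inequality reads `μ B ≤ μ B * μ A`, forcing `μ A
    -- = 1`.
    obtain ⟨B, hBA, hB, hBpos⟩ := hA.exists_lt_isClosed_of_ne_top (measure_ne_top μ A)
      (pos_iff_ne_zero.2 h0)
    have h1 := closed B hB
    rw [inter_eq_right.2 hBA] at h1
    have h2 : 1 ≤ μ A := by
      refine (ENNReal.mul_le_mul_iff_right hBpos.ne' (measure_ne_top μ B)).1 ?_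
      rwa [mul_one]
    exact (ae_eq_univ_iff_measure_eq hA.nullMeasurableSet).2
      (le_antisymm (measure_mono (subset_univ A)) (by rwa [measure_univ]))

end InvariantMeasure
-- A pointwise log-Lipschitz density
section Density

variable {M : Type u} [MeasurableSpace M] [MetricSpace M]
  {m μ ν : Measure M} {T F : M → M} {τ : M → ℕ} {Y : Set M} {α : Set (Set M)}
  {lam K R Khat : ℝ}

lemma IsMarkovBase.measure_mul_le (hb : IsMarkovBase μ Y F α lam K) (h : LogLip μ Y R ν)
    (hR : 0 ≤ R) {A B : Set M} (hA : MeasurableSet A) (hB : MeasurableSet B) (hAY : A ⊆ Y)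
    (hBY : B ⊆ Y) {δ : ℝ} (hδ : 0 ≤ δ) (hd : ∀ x ∈ A, ∀ y ∈ B, dist x y ≤ δ) :
    ν A * μ B ≤ ENNReal.ofReal (Real.exp (R * δ)) * (ν B * μ A) := by
  refine (h.2 A B hA hB hAY hBY (min δ 1) (le_min hδ zero_le_one) (min_le_right _ _)
    fun x hx y hy => le_min (hd x hx y hy) (hb.dist_le_one x (hAY hx) y (hBY hy))).trans ?_
  gcongr
  exact min_le_left _ _

/-- The cylinders of rank `n` cover the base up to a null set and have small diameter. -/
lemma IsMarkovBase.exists_cylinders (hb : IsMarkovBase μ Y F α lam K) (n : ℕ) :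
    ∃ 𝒞 : Set (Set M), 𝒞.Countable ∧ (∀ C ∈ 𝒞, MeasurableSet C ∧ C ⊆ Y) ∧
      𝒞.PairwiseDisjoint id ∧ μ (Y \ ⋃₀ 𝒞) = 0 ∧
      ∀ C ∈ 𝒞, ∀ x ∈ C, ∀ y ∈ C, dist x y ≤ (lam ^ n)⁻¹ := by
  have hlam : 0 < lam := zero_lt_one.trans hb.one_lt_lam
  induction n with
  | zero =>
    refine ⟨{Y}, countable_singleton Y, ?_, pairwiseDisjoint_singleton _ _, by simp, ?_⟩
    · rintro C rfl
      exact ⟨hb.measurableSet_base, subset_rfl⟩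
    · rintro C rfl
      simpa using hb.dist_le_one
  | succ n ih =>
    obtain ⟨𝒞, hc, hm, hdisj, hcov, hdiam⟩ := ih
    -- Pulling cylinders back through the branches divides the diameter bound by `lam`.
    refine ⟨image2 (fun a C => a ∩ F ⁻¹' C) α 𝒞, hb.countable_partition.image2 hc _, ?_, ?_, ?_, ?_⟩
    · rintro _ ⟨a, ha, C, hC, rfl⟩
      exact ⟨(hb.measurableSet_of_mem a ha).inter (hb.measurable_map (hm C hC).1),
        inter_subset_left.trans (hb.subset_base a ha)⟩
    · rintro _ ⟨a, ha, C, hC, rfl⟩ _ ⟨a', ha', C', hC', rfl⟩ hne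
      by_cases haa : a = a'
      · subst haa
        have hCC : C ≠ C' := fun h => hne (by rw [h])
        exact ((hdisj hC hC' hCC).preimage F).mono inter_subset_right inter_subset_right
      · exact (hb.pairwiseDisjoint ha ha' haa).mono inter_subset_left inter_subset_left
    -- By bounded distortion, a branch pulls null sets back to null sets.
    · have hN : ∀ a ∈ α, μ (a ∩ F ⁻¹' (Y \ ⋃₀ 𝒞)) = 0 := by
        intro a ha
        have hmN := hb.measurableSet_base.diff (MeasurableSet.sUnion hc fun C hC => (hm C hC).1)
        have := hb.measure_preimage_mul_le ha hmN hb.measurableSet_base sdiff_subset subset_rfl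
          (δ := 1) fun x hx y hy => hb.dist_le_one x hx.1 y hy
        rw [hcov, hb.measure_base] at this
        simpa using this
      refine measure_mono_null (t := (Y \ ⋃₀ α) ∪ ⋃ a ∈ α, a ∩ F ⁻¹' (Y \ ⋃₀ 𝒞)) ?_
        (measure_union_null hb.cover ((measure_biUnion_null_iff hb.countable_partition).2 hN))
      rintro x ⟨hxY, hx⟩
      by_cases hxα : x ∈ ⋃₀ α
      · obtain ⟨a, ha, hxa⟩ := hxα
        refine .inr (mem_biUnion ha ⟨hxa, hb.mapsTo a ha hxa, ?_⟩)
        rintro ⟨C, hC, hxC⟩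
        exact hx ⟨_, ⟨a, ha, C, hC, rfl⟩, hxa, hxC⟩
      · exact .inl ⟨hxY, hxα⟩
    · rintro _ ⟨a, ha, C, hC, rfl⟩ x hx y hy
      have h1 := (hb.expanding a ha x hx.1 y hy.1).trans (hdiam C hC _ hx.2 _ hy.2)
      rwa [pow_succ', mul_inv, ← div_eq_inv_mul, le_div_iff₀' hlam]

omit [MetricSpace M] in
lemma measure_le_of_forall_cover {μ₁ μ₂ : Measure M} {𝒞 : Set (Set M)} {c : ℝ≥0∞}
    (hc : 𝒞.Countable) (hm : ∀ C ∈ 𝒞, MeasurableSet C) (hdisj : 𝒞.PairwiseDisjoint id)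
    (hcov : μ₁ (⋃₀ 𝒞)ᶜ = 0)
    (h : ∀ C ∈ 𝒞, ∀ A ⊆ C, MeasurableSet A → μ₁ A ≤ c * μ₂ A) {A : Set M}
    (hA : MeasurableSet A) : μ₁ A ≤ c * μ₂ A := by
  have hAU : μ₁ A = μ₁ (A ∩ ⋃₀ 𝒞) := (measure_inter_conull hcov).symm
  have e : ∀ μ' : Measure M, μ' (A ∩ ⋃₀ 𝒞) = ∑' C : 𝒞, μ' (A ∩ C) := by
    intro μ'
    rw [sUnion_eq_biUnion, inter_iUnion₂, measure_biUnion hc]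
    · exact hdisj.mono_on fun C _ => inter_subset_right
    · exact fun C hC => hA.inter (hm C hC)
  calc μ₁ A = ∑' C : 𝒞, μ₁ (A ∩ C) := by rw [hAU, e]
    _ ≤ ∑' C : 𝒞, c * μ₂ (A ∩ C) := ENNReal.tsum_le_tsum fun C =>
        h C C.2 _ inter_subset_right (hA.inter (hm C C.2))
    _ = c * μ₂ (A ∩ ⋃₀ 𝒞) := by rw [ENNReal.tsum_mul_left, e]
    _ ≤ c * μ₂ A := by gcongr; exact inter_subset_left

/-- A regular measure has a positive density with respect to the reference measure whose logarithm
is Lipschitz at all points. -/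
theorem IsMarkovBase.exists_density [BorelSpace M] (hb : IsMarkovBase μ Y F α lam K)
    (hR : 0 ≤ R) [IsProbabilityMeasure ν] (h : LogLip μ Y R ν) :
    ∃ φ : M → ℝ, Measurable φ ∧ (∀ x, 0 < φ x) ∧
      (∀ x y, |Real.log (φ x) - Real.log (φ y)| ≤ R * dist x y) ∧
      ν = μ.withDensity fun x => ENNReal.ofReal (φ x) := by
  have hprob := hb.isProbabilityMeasure
  have hlam : 0 < lam := zero_lt_one.trans hb.one_lt_lam
  choose 𝒞 hcount hm hdisj hcov hdiam using hb.exists_cylinders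
  let ε : ℕ → ℝ := fun n => (lam ^ n)⁻¹
  have hε : ∀ n, 0 < ε n := fun n => by positivity
  let ι := Σ n, {C : Set M // C ∈ 𝒞 n ∧ μ C ≠ 0}
  let q : Set M → ℝ := fun C => ν.real C / μ.real C
  have hμpos : ∀ i : ι, 0 < μ.real i.2.1 := fun i =>
    ENNReal.toReal_pos i.2.2.2 (measure_ne_top _ _)
  have hνpos : ∀ i : ι, 0 < ν.real i.2.1 := fun i => by
    refine ENNReal.toReal_pos (fun h0 => i.2.2.2 ?_) (measure_ne_top _ _)
    have := hb.le_smul' h (hm i.1 i.2.1 i.2.2.1).1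
    rw [h0] at this
    simpa using this
  have hq : ∀ i : ι, 0 < q i.2.1 := fun i => div_pos (hνpos i) (hμpos i)
  have hne : ∀ i : ι, (i.2.1).Nonempty := fun i => nonempty_of_measure_ne_zero i.2.2.2
  choose p hp using hne
  have hreal : ∀ {A B : Set M}, MeasurableSet A → MeasurableSet B → A ⊆ Y → B ⊆ Y →
      ∀ {δ : ℝ}, 0 ≤ δ → (∀ x ∈ A, ∀ y ∈ B, dist x y ≤ δ) →
      ν.real A * μ.real B ≤ Real.exp (R * δ) * (ν.real B * μ.real A) := by
    intro A B hA hB hAY hBY δ hδ hd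
    have := ENNReal.toReal_mono (by finiteness) (hb.measure_mul_le h hR hA hB hAY hBY hδ hd)
    simpa [ENNReal.toReal_mul, Measure.real, ENNReal.toReal_ofReal (Real.exp_pos _).le] using this
  -- Points of cylinder `j` and cylinder `i` are within `ε j + dist x (p j) + ε i`, so `LogLip`
  -- compares the two average densities.
  have hcomp : ∀ (i j : ι) (x : M), x ∈ i.2.1 →
      Real.log (q j.2.1) - R * (dist x (p j) + ε j.1) ≤ Real.log (q i.2.1) + R * ε i.1 := by
    intro i j x hx
    have h1 := hreal (hm _ _ j.2.2.1).1 (hm _ _ i.2.2.1).1 (hm _ _ j.2.2.1).2 (hm _ _ i.2.2.1).2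
      (δ := ε j.1 + dist x (p j) + ε i.1)
      (by have := hε j.1; have := hε i.1; positivity) fun z hz y hy => by
        have h1 := hdiam _ _ j.2.2.1 z hz (p j) (hp j)
        have h2 := hdiam _ _ i.2.2.1 x hx y hy
        have h3 := dist_triangle4 z (p j) x y
        rw [dist_comm (p j) x] at h3
        linarith
    have h2 : q j.2.1 ≤ Real.exp (R * (ε j.1 + dist x (p j) + ε i.1)) * q i.2.1 := by
      rw [div_le_iff₀ (hμpos j), mul_assoc, div_mul_eq_mul_div, mul_div_assoc', le_div_iff₀ (hμpos i)]
      exact h1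
    have h3 := Real.log_le_log (hq j) h2
    rw [Real.log_mul (Real.exp_pos _).ne' (hq i).ne', Real.log_exp] at h3
    linarith
  have hcov' : ∀ n, (ν (⋃₀ 𝒞 n)ᶜ = 0) ∧ μ (⋃₀ 𝒞 n)ᶜ = 0 := by
    intro n
    have : μ (⋃₀ 𝒞 n)ᶜ = 0 := by
      refine measure_mono_null (t := Yᶜ ∪ Y \ ⋃₀ 𝒞 n) (fun x hx => ?_)
        (measure_union_null hb.supported (hcov n))
      by_cases hxY : x ∈ Y
      · exact .inr ⟨hxY, hx⟩
      · exact .inl hxY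
    exact ⟨hb.absolutelyContinuous h this, this⟩
  have hι : Nonempty ι := by
    by_contra hcon
    have hz : ∀ C ∈ 𝒞 0, μ C = 0 := fun C hC => by
      by_contra h0
      exact hcon ⟨⟨0, C, hC, h0⟩⟩
    have h1 : μ (⋃₀ 𝒞 0) = 0 := by
      rw [sUnion_eq_biUnion]
      exact (measure_biUnion_null_iff (hcount 0)).2 hz
    have h2 : μ univ = 0 := by
      rw [← union_compl_self (⋃₀ 𝒞 0)]
      exact measure_union_null h1 (hcov' 0).2
    simp at h2
  -- A McShane-type construction: the supremum over all cylinders of the log-average minus a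
  -- Lipschitz penalty is `R`-Lipschitz on all of `M`, and on each cylinder it recovers the
  -- log-average up to a multiple of the diameter bound.
  let t : M → ι → ℝ := fun x j => Real.log (q j.2.1) - R * (dist x (p j) + ε j.1)
  have htlip : ∀ x y j, t x j ≤ t y j + R * dist x y := by
    intro x y j
    have := mul_le_mul_of_nonneg_left (dist_triangle y x (p j)) hR
    rw [dist_comm y x] at this
    simp only [t]
    linarith
  have hbdd : ∀ x, BddAbove (range (t x)) := by
    intro x
    obtain ⟨i⟩ := hι
    refine ⟨Real.log (q i.2.1) + R * ε i.1 + R * dist x (p i), ?_⟩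
    rintro _ ⟨j, rfl⟩
    have h1 : t (p i) j ≤ _ := hcomp i j (p i) (hp i)
    linarith [htlip x (p i) j]
  let g : M → ℝ := fun x => ⨆ j, t x j
  have hglip : ∀ x y, g x - g y ≤ R * dist x y := by
    intro x y
    have : g x ≤ g y + R * dist x y :=
      ciSup_le fun j => (htlip x y j).trans (by gcongr; exact le_ciSup (hbdd y) j)
    linarith
  have habs : ∀ x y, |g x - g y| ≤ R * dist x y := fun x y =>
    abs_sub_le_iff.2 ⟨hglip x y, by rw [dist_comm]; exact hglip y x⟩
  have hgcont : Continuous g := by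
    have : LipschitzWith R.toNNReal g := LipschitzWith.of_dist_le_mul fun x y => by
      rw [Real.dist_eq, Real.coe_toNNReal _ hR]
      exact habs x y
    exact this.continuous
  have hφm : Measurable fun x => Real.exp (g x) := (Real.continuous_exp.comp hgcont).measurable
  have hup : ∀ (i : ι), ∀ x ∈ i.2.1, Real.exp (g x) ≤ Real.exp (R * ε i.1) * q i.2.1 := by
    intro i x hx
    rw [← Real.exp_log (hq i), ← Real.exp_add, Real.exp_le_exp, add_comm]
    exact ciSup_le fun j => hcomp i j x hx
  have hlow : ∀ (i : ι), ∀ x ∈ i.2.1, q i.2.1 ≤ Real.exp (2 * (R * ε i.1)) * Real.exp (g x) := by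
    intro i x hx
    rw [← Real.exp_log (hq i), ← Real.exp_add, Real.exp_le_exp]
    have h1 : t x i ≤ g x := le_ciSup (hbdd x) i
    have h2 := mul_le_mul_of_nonneg_left (hdiam _ _ i.2.2.1 x hx (p i) (hp i)) hR
    simp only [t] at h1
    simp only [ε] at h1 ⊢
    linarith
  let ω := μ.withDensity fun x => ENNReal.ofReal (Real.exp (g x))
  -- The exponent 3 combines one `R * ε n` from comparing averages inside a cylinder and two from
  -- the lower bound `hlow`. The cylinders of rank `n` are then added up.
  have hνω : ∀ n, ∀ A, MeasurableSet A →
      ν A ≤ ENNReal.ofReal (Real.exp (3 * (R * ε n))) * ω A := by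
    intro n A hA
    refine measure_le_of_forall_cover (hcount n) (fun C hC => (hm n C hC).1) (hdisj n)
      (hcov' n).1 (fun C hC A hAC hA => ?_) hA
    rcases eq_or_ne (μ C) 0 with h0 | h0
    · rw [hb.absolutelyContinuous h (measure_mono_null hAC h0)]; exact zero_le
    let i : ι := ⟨n, C, hC, h0⟩
    have h1 := hreal hA (hm n C hC).1 (hAC.trans (hm n C hC).2) (hm n C hC).2 (hε n).le
      fun x hx y hy => hdiam n C hC x (hAC hx) y hy
    have h2 : ν.real A ≤ Real.exp (R * ε n) * q C * μ.real A := by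
      rw [mul_assoc, div_mul_eq_mul_div, mul_div_assoc', le_div_iff₀ (hμpos i)]
      exact h1
    calc ν A = ENNReal.ofReal (ν.real A) := by simp
      _ ≤ ENNReal.ofReal (Real.exp (R * ε n) * q C * μ.real A) := ENNReal.ofReal_le_ofReal h2
      _ = ∫⁻ _ in A, ENNReal.ofReal (Real.exp (R * ε n) * q C) ∂μ := by
          rw [setLIntegral_const,
            ENNReal.ofReal_mul (p := _ * q C) (mul_nonneg (Real.exp_pos _).le (hq i).le)]
          simp
      _ ≤ ∫⁻ x in A, ENNReal.ofReal (Real.exp (3 * (R * ε n))) *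
            ENNReal.ofReal (Real.exp (g x)) ∂μ := by
          refine setLIntegral_mono' hA fun x hx => ?_
          rw [← ENNReal.ofReal_mul (Real.exp_pos _).le]
          refine ENNReal.ofReal_le_ofReal ?_
          calc _ ≤ Real.exp (R * ε n) * (Real.exp (2 * (R * ε n)) * Real.exp (g x)) := by
                gcongr; exact hlow i x (hAC hx)
            _ = _ := by rw [← mul_assoc, ← Real.exp_add]; ring_nf
      _ = _ := by
          rw [lintegral_const_mul' _ _ ENNReal.ofReal_ne_top, withDensity_apply _ hA]
  have hων : ∀ n, ∀ A, MeasurableSet A →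
      ω A ≤ ENNReal.ofReal (Real.exp (3 * (R * ε n))) * ν A := by
    intro n A hA
    refine measure_le_of_forall_cover (hcount n) (fun C hC => (hm n C hC).1) (hdisj n)
      (withDensity_absolutelyContinuous _ _ (hcov' n).2) (fun C hC A hAC hA => ?_) hA
    rcases eq_or_ne (μ C) 0 with h0 | h0
    · rw [withDensity_absolutelyContinuous _ _ (measure_mono_null hAC h0)]; exact zero_le
    let i : ι := ⟨n, C, hC, h0⟩
    have h1 := hreal (hm n C hC).1 hA (hm n C hC).2 (hAC.trans (hm n C hC).2) (hε n).le
      fun x hx y hy => hdiam n C hC x hx y (hAC hy)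
    have h2 : q C * μ.real A ≤ Real.exp (R * ε n) * ν.real A := by
      rw [div_mul_eq_mul_div, div_le_iff₀ (hμpos i), mul_assoc]
      exact h1
    calc ω A = ∫⁻ x in A, ENNReal.ofReal (Real.exp (g x)) ∂μ := withDensity_apply _ hA
      _ ≤ ∫⁻ _ in A, ENNReal.ofReal (Real.exp (R * ε n) * q C) ∂μ :=
          setLIntegral_mono' hA fun x hx => ENNReal.ofReal_le_ofReal (hup i x (hAC hx))
      _ = ENNReal.ofReal (Real.exp (R * ε n) * q C * μ.real A) := by
          rw [setLIntegral_const,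
            ENNReal.ofReal_mul (p := _ * q C) (mul_nonneg (Real.exp_pos _).le (hq i).le)]
          simp
      _ ≤ ENNReal.ofReal (Real.exp (3 * (R * ε n)) * ν.real A) := by
          refine ENNReal.ofReal_le_ofReal ?_
          have hn : 0 ≤ ν.real A := measureReal_nonneg
          have hRε : 0 ≤ R * ε n := mul_nonneg hR (hε n).le
          calc _ ≤ Real.exp (R * ε n) * (Real.exp (R * ε n) * ν.real A) := by
                rw [mul_assoc]; gcongr
            _ = Real.exp (2 * (R * ε n)) * ν.real A := by
                rw [← mul_assoc, ← Real.exp_add]; ring_nf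
            _ ≤ _ := by gcongr; norm_num
      _ = _ := by rw [ENNReal.ofReal_mul (Real.exp_pos _).le]; simp
  have hlim : Filter.Tendsto (fun n => ENNReal.ofReal (Real.exp (3 * (R * ε n)))) Filter.atTop
      (nhds 1) := by
    have h1 : Filter.Tendsto ε Filter.atTop (nhds 0) :=
      (tendsto_pow_atTop_atTop_of_one_lt hb.one_lt_lam).inv_tendsto_atTop
    have h2 := (Real.continuous_exp.tendsto _).comp ((h1.const_mul R).const_mul 3)
    have h3 := ENNReal.tendsto_ofReal h2
    simpa using h3
  refine ⟨fun x => Real.exp (g x), hφm, fun x => Real.exp_pos _, fun x y => ?_, ?_⟩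
  · rw [Real.log_exp, Real.log_exp]
    exact habs x y
  · have lim : ∀ c : ℝ≥0∞, Filter.Tendsto
        (fun n => ENNReal.ofReal (Real.exp (3 * (R * ε n))) * c) Filter.atTop (nhds c) := fun c => by
      simpa using ENNReal.Tendsto.mul_const hlim (.inl one_ne_zero) (b := c)
    ext A hA
    exact le_antisymm (ge_of_tendsto' (lim _) fun n => hνω n A hA)
      (ge_of_tendsto' (lim _) fun n => hων n A hA)

end Density
-- Distortion with respect to the invariant measure
section Jacobian

variable {M : Type u} [MeasurableSpace M] [MetricSpace M]
  {m μ ν : Measure M} {T F : M → M} {τ : M → ℕ} {Y : Set M} {α : Set (Set M)}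
  {lam K R Khat : ℝ}

/-- The inverse Jacobian with respect to a measure with a log-Lipschitz density. -/
theorem IsMarkovBase.hasDistortion_withDensity (hb : IsMarkovBase μ Y F α lam K) (hR : 0 ≤ R)
    (hbij : ∀ a ∈ α, MeasureBijOn μ F a Y) {φ : M → ℝ} (hφ : Measurable φ) (hpos : ∀ x, 0 < φ x)
    (hlip : ∀ x y, |Real.log (φ x) - Real.log (φ y)| ≤ R * dist x y) :
    HasDistortion (μ.withDensity fun x => ENNReal.ofReal (φ x)) F α (K + 2 * R) := by
  obtain ⟨ζ, hζ, hζα⟩ := hb.distortion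
  have hF := hb.measurable_map
  have hlam := hb.one_lt_lam
  -- Change of density in `dν / d(ν ∘ F)`: the numerator acquires `φ`, the denominator `φ ∘ F`.
  refine ⟨fun x => ζ x * (φ x / φ (F x)), hζ.mul (hφ.div (hφ.comp hF)), fun a ha => ?_⟩
  obtain ⟨⟨hζpos, hJ⟩, hd⟩ := hζα a ha
  have hma := hb.measurableSet_of_mem a ha
  have hinj : InjOn F a := fun x hx y hy hxy => by
    have := hb.expanding a ha x hx y hy
    rw [hxy, dist_self] at this
    have h0 := dist_nonneg (x := x) (y := y)
    exact dist_le_zero.1 (by nlinarith)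
  refine ⟨⟨fun x hx => mul_pos (hζpos x hx) (div_pos (hpos _) (hpos _)), fun A hAa hA => ?_⟩,
    fun x hx y hy => ?_⟩
  -- `F '' A` need not be measurable; up to null sets `A` is replaced by `A ∩ a'`, whose image is.
  · obtain ⟨a', Y', haa', -, hma', -, hnull, -, -, himg⟩ := hbij a ha
    have hA₁ : MeasurableSet (A ∩ a') := hA.inter hma'
    have hFA₁ : MeasurableSet (F '' (A ∩ a')) := himg _ inter_subset_right hA₁
    have hdiff : μ (A \ a') = 0 := measure_mono_null (sdiff_subset_sdiff_left hAa) hnull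
    have hAeq : (A ∩ a' : Set M) =ᵐ[μ] A := by
      refine ae_eq_set.2 ⟨?_, ?_⟩
      · rw [sdiff_eq_empty.2 inter_subset_left, measure_empty]
      · rwa [sdiff_self_inter]
    have hchange : ((μ.restrict a).withDensity fun x => ENNReal.ofReal (ζ x)⁻¹).map F = μ := by
      ext B hB
      rw [Measure.map_apply hF hB, withDensity_apply _ (hF hB), Measure.restrict_restrict (hF hB),
        inter_comm, ← hJ _ inter_subset_left (hma.inter (hF hB))]
      have e : a ∩ F ⁻¹' B = a ∩ F ⁻¹' (B ∩ Y) := by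
        ext x
        exact ⟨fun hx => ⟨hx.1, hx.2, hb.mapsTo a ha hx.1⟩, fun hx => ⟨hx.1, hx.2.1⟩⟩
      rw [e, hb.measure_image ha inter_subset_right, measure_inter_conull hb.supported]
    have himage : (μ.withDensity fun x => ENNReal.ofReal (φ x)) (F '' A) =
        (μ.withDensity fun x => ENNReal.ofReal (φ x)) (F '' (A ∩ a')) := by
      refine le_antisymm ?_ (measure_mono (image_mono inter_subset_left))
      have h0 : μ (F '' (A \ a')) = 0 := by
        rw [hJ _ (sdiff_subset.trans hAa) (hA.diff hma')]
        exact setLIntegral_measure_zero _ _ hdiff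
      calc _ ≤ (μ.withDensity fun x => ENNReal.ofReal (φ x)) (F '' (A ∩ a') ∪ F '' (A \ a')) := by
            rw [← image_union, inter_union_sdiff]
        _ ≤ _ := measure_union_le _ _
        _ = _ := by rw [withDensity_absolutelyContinuous _ _ h0, add_zero]
    have hpre : F ⁻¹' (F '' (A ∩ a')) ∩ a = A ∩ a' := by
      ext x
      refine ⟨fun ⟨⟨y, hy, hxy⟩, hx⟩ => ?_, fun hx => ⟨⟨x, hx, rfl⟩, haa' hx.2⟩⟩
      rwa [← hinj (haa' hy.2) hx hxy]
    rw [himage, withDensity_apply _ hFA₁]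
    conv_lhs => rw [← hchange]
    have hζ' : Measurable fun x => ENNReal.ofReal (ζ x)⁻¹ := hζ.inv.ennreal_ofReal
    have hφF : Measurable fun x => ENNReal.ofReal (φ (F x)) := (hφ.comp hF).ennreal_ofReal
    have hquot : Measurable fun x => ENNReal.ofReal (ζ x * (φ x / φ (F x)))⁻¹ :=
      (hζ.mul (hφ.div (hφ.comp hF))).inv.ennreal_ofReal
    rw [setLIntegral_map hFA₁ hφ.ennreal_ofReal hF,
      setLIntegral_withDensity_eq_setLIntegral_mul _ hζ' hφF (hF hFA₁), Measure.restrict_restrict (hF hFA₁), hpre,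
      setLIntegral_congr hAeq,
      setLIntegral_withDensity_eq_setLIntegral_mul _ hφ.ennreal_ofReal hquot hA]
    refine setLIntegral_congr_fun hA fun x hx => ?_
    have h1 := hζpos x (hAa hx)
    have h2 := hpos x
    have h3 := hpos (F x)
    simp only [Pi.mul_apply]
    rw [← ENNReal.ofReal_mul (inv_pos.2 h1).le, ← ENNReal.ofReal_mul h2.le]
    congr 1
    field_simp
  · have h1 := (hpos x).ne'
    have h2 := (hpos (F x)).ne'
    have h3 := (hpos y).ne'
    have h4 := (hpos (F y)).ne'
    rw [Real.log_mul (hζpos x hx).ne' (div_ne_zero h1 h2), Real.log_div h1 h2,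
      Real.log_mul (hζpos y hy).ne' (div_ne_zero h3 h4), Real.log_div h3 h4]
    have e1 := abs_le.1 (hd x hx y hy)
    have e2 := abs_le.1 (hlip x y)
    have e3 := abs_le.1 (hlip (F x) (F y))
    -- Both density terms are thus measured at the images; together they give the `2 * R`.
    have e4 : R * dist x y ≤ R * dist (F x) (F y) := by
      refine mul_le_mul_of_nonneg_left ?_ hR
      have := hb.expanding a ha x hx y hy
      nlinarith [dist_nonneg (x := x) (y := y)]
    refine abs_le.2 ⟨?_, ?_⟩ <;> linarith

end Jacobian

/-! ### Existence, uniqueness and bounds for the invariant measure -/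

section ACIP

variable {M : Type u} [MetricSpace M] [MeasurableSpace M]
  {m μ : Measure M} {T : M → M} {Y : Set M} {α : Set (Set M)} {τ : M → ℕ} {lam Khat : ℝ}

omit [MetricSpace M] in
lemma MeasureBijOn.mono_ac {F : M → M} {a : Set M} (h : MeasureBijOn m F a Y) (hac : μ ≪ m) :
    MeasureBijOn μ F a Y := by
  obtain ⟨a', Y', h1, h2, h3, h4, h5, h6, h7⟩ := h
  exact ⟨a', Y', h1, h2, h3, h4, hac h5, hac h6, h7⟩

/-- The normalized restriction of the reference measure to the base. -/
lemma IsNonuniformlyExpanding.isMarkovBase_cond [IsProbabilityMeasure m]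
    (hNE : IsNonuniformlyExpanding m T Y α τ lam Khat) :
    IsMarkovBase (cond m Y) Y (inducedMap T τ) α lam Khat := by
  have hY := hNE.measurableSet_base
  have h0 := hNE.base_pos.ne'
  refine hNE.isMarkovBase (cond_isProbabilityMeasure h0) ?_ cond_absolutelyContinuous
    hNE.Khat_nonneg ?_
  · rw [cond_apply hY]; simp
  -- Normalization scales both sides of the Jacobian relation equally, so `ζ` is unchanged.
  · obtain ⟨ζ, hζ, h⟩ := hNE.distortion
    refine ⟨ζ, hζ, fun a ha => ⟨⟨(h a ha).1.1, fun A hAa hA => ?_⟩, (h a ha).2⟩⟩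
    have hFA : inducedMap T τ '' A ⊆ Y :=
      image_subset_iff.2 fun x hx => hNE.mapsTo a ha (hAa hx)
    rw [cond_apply hY, inter_eq_right.2 hFA, (h a ha).1.2 A hAa hA, ProbabilityTheory.cond, Measure.restrict_smul,
      Measure.restrict_restrict hA, inter_eq_left.2 (hAa.trans (hNE.subset_base a ha)),
      lintegral_smul_measure, smul_eq_mul]

/-- A regularity constant that is preserved by the induced map. -/
noncomputable def regularityConst (p : ℝ × ℝ) : ℝ := p.2 * p.1 / (p.1 - 1) + 1

/-- The constant in the bounds for the density and the distortion of the invariant measure. -/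
noncomputable def acipConst (p : ℝ × ℝ) : ℝ :=
  p.2 + 2 * regularityConst p + Real.exp (regularityConst p)

lemma continuousOn_acipConst : ContinuousOn acipConst {p | 1 < p.1 ∧ 0 ≤ p.2} := by
  have h : ContinuousOn regularityConst {p | 1 < p.1 ∧ 0 ≤ p.2} :=
    ContinuousOn.add (ContinuousOn.div (by fun_prop) (by fun_prop)
      fun p hp => (sub_pos.2 hp.1).ne') continuousOn_const
  unfold acipConst
  fun_prop

/-- Existence, uniqueness and regularity of the absolutely continuous invariant probability
measure of the induced map. -/
theorem IsNonuniformlyExpanding.exists_acip [BorelSpace M] [IsProbabilityMeasure m]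
    (hNE : IsNonuniformlyExpanding m T Y α τ lam Khat) :
    ∃ μ : Measure M, IsACIP m Y (inducedMap T τ) μ ∧
      (∀ ν : Measure M, IsACIP m Y (inducedMap T τ) ν → ν = μ) ∧
      0 < acipConst (lam, Khat) ∧
      ENNReal.ofReal (acipConst (lam, Khat))⁻¹ • cond m Y ≤ μ ∧
      μ ≤ ENNReal.ofReal (acipConst (lam, Khat)) • cond m Y ∧
      HasDistortion μ (inducedMap T τ) α (acipConst (lam, Khat)) := by
  have hb := hNE.isMarkovBase_cond
  have hlam := sub_pos.2 hNE.one_lt_lam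
  have hK := hNE.Khat_nonneg
  set R := regularityConst (lam, Khat) with hRdef
  have hR : Khat * lam / (lam - 1) < R := lt_add_one _
  have hR0 : 0 < R := pos_of_lt hNE.one_lt_lam hK hR
  set C := acipConst (lam, Khat) with hC
  have hCR : C = Khat + 2 * R + Real.exp R := rfl
  have hexpC : Real.exp R ≤ C := by linarith
  have hC0 : 0 < C := (Real.exp_pos R).trans_le hexpC
  obtain ⟨μ, hμ, hinv, hreg⟩ := hb.exists_invariant hR
  have hle := hb.le_smul hreg
  rw [measure_univ, mul_one] at hle
  have hac : μ ≪ m := (hb.absolutelyContinuous hreg).trans cond_absolutelyContinuous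
  have hge : ∀ A, MeasurableSet A → cond m Y A ≤ ENNReal.ofReal (Real.exp R) * μ A := fun A hA => by
    simpa using hb.le_smul' hreg hA
  obtain ⟨φ, hφ, hφ0, hlip, hμφ⟩ := hb.exists_density hR0.le hreg
  have hdist₀ : HasDistortion μ (inducedMap T τ) α (Khat + 2 * R) := by
    rw [hμφ]
    exact hb.hasDistortion_withDensity hR0.le
      (fun a ha => (hNE.bijOn a ha).mono_ac cond_absolutelyContinuous) hφ hφ0 hlip
  have hdist : HasDistortion μ (inducedMap T τ) α C := by
    obtain ⟨ζ, hζ, h⟩ := hdist₀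
    refine ⟨ζ, hζ, fun a ha => ⟨(h a ha).1, fun x hx y hy => ((h a ha).2 x hx y hy).trans ?_⟩⟩
    gcongr
    linarith [Real.exp_pos R]
  -- Now `μ` itself becomes the reference measure, as ergodicity requires.
  have hbμ := hNE.isMarkovBase hμ hreg.1 hac hC0.le hdist
  have herg := hbμ.ergodic hinv
  refine ⟨μ, ⟨hμ, hreg.1, hac, hinv⟩, fun ν hν => ?_, hC0, ?_, ?_, hdist⟩
  · have hνp := hν.isProbabilityMeasure
    -- The density of `μ` is bounded below on `Y`, so any competitor is absolutely continuous with
    -- respect to `μ`; ergodicity then leaves only `μ`.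
    refine herg.eq_of_absolutelyContinuous hν.invariant (.mk fun A hA h0 => ?_)
    have h1 : cond m Y A = 0 := by
      have := hge A hA
      rwa [h0, mul_zero, nonpos_iff_eq_zero] at this
    rw [cond_apply hNE.measurableSet_base, mul_eq_zero] at h1
    have h2 : m (Y ∩ A) = 0 := h1.resolve_left (ENNReal.inv_ne_zero.2 (measure_ne_top _ _))
    have h3 := hν.absolutelyContinuous h2
    rwa [inter_comm, measure_inter_conull hν.supported] at h3
  · refine Measure.le_intro fun A hA _ => ?_
    rw [Measure.smul_apply, smul_eq_mul, ENNReal.ofReal_inv_of_pos hC0, ← ENNReal.div_eq_inv_mul]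
    refine ENNReal.div_le_of_le_mul' ((hge A hA).trans ?_)
    gcongr
  · refine hle.trans (Measure.le_intro fun A hA _ => ?_)
    simp only [Measure.smul_apply, smul_eq_mul]
    gcongr

end ACIP
end NUE

/-- The first conjunct: the absolutely continuous `F`-invariant probability measure `μ` exists, is
unique, and its density with respect to normalized `m` on `Y` and its distortion are controlled by
a constant `K` that depends only, and continuously, on `λ` and the distortion constant of `m`.
The second conjunct: the coupling theorem, for every `K` that bounds the distortion of `μ`. -/
theorem mainTheorem1 :
    (∃ K₀ : ℝ × ℝ → ℝ,
      ContinuousOn K₀ {p | 1 < p.1 ∧ 0 ≤ p.2} ∧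
      ∀ (M : Type u) [MetricSpace M] [MeasurableSpace M] [BorelSpace M]
        (m : Measure M) [IsProbabilityMeasure m] (T : M → M) (Y : Set M) (α : Set (Set M))
        (τ : M → ℕ) (lam Khat : ℝ),
        NUE.IsNonuniformlyExpanding m T Y α τ lam Khat →
        ∃ μ : Measure M,
          NUE.IsACIP m Y (NUE.inducedMap T τ) μ ∧
          (∀ ν : Measure M, NUE.IsACIP m Y (NUE.inducedMap T τ) ν → ν = μ) ∧
          0 < K₀ (lam, Khat) ∧
          ENNReal.ofReal (K₀ (lam, Khat))⁻¹ • ProbabilityTheory.cond m Y ≤ μ ∧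
          μ ≤ ENNReal.ofReal (K₀ (lam, Khat)) • ProbabilityTheory.cond m Y ∧
          NUE.HasDistortion μ (NUE.inducedMap T τ) α (K₀ (lam, Khat))) ∧
    ∃ Cweak Cstrong : ℝ × ℝ × ℝ × ℝ × ℝ × ℝ → ℝ,
    ∃ Cexp Aexp : ℝ × ℝ × ℝ × ℝ × ℝ × ℝ × ℝ → ℝ,
      ContinuousOn Cweak NUE.polyParams ∧
      ContinuousOn Cstrong NUE.polyParams ∧
      ContinuousOn Cexp NUE.expParams ∧
      ContinuousOn Aexp NUE.expParams ∧
      (∀ p ∈ NUE.expParams, 0 < Cexp p ∧ 0 < Aexp p) ∧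
      ∀ (M : Type u) [MetricSpace M] [MeasurableSpace M] [BorelSpace M]
        (m : Measure M) [IsProbabilityMeasure m] (T : M → M) (Y : Set M) (α : Set (Set M))
        (τ : M → ℕ) (lam Khat : ℝ),
        NUE.IsNonuniformlyExpanding m T Y α τ lam Khat →
      ∀ (μ : Measure M), NUE.IsACIP m Y (NUE.inducedMap T τ) μ →
      ∀ (K : ℝ), 0 ≤ K → NUE.HasDistortion μ (NUE.inducedMap T τ) α K →
      ∀ (R : ℝ), K * lam / (lam - 1) < R →
      ∀ (E₁ : Type w₁) [MeasurableSpace E₁] (E₂ : Type w₂) [MeasurableSpace E₂]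
        (ρ₁ ρ₂ : Measure M) (ϰ₁ : Measure E₁) (ϰ₂ : Measure E₂)
        (ρz₁ : Kernel E₁ M) (ρz₂ : Kernel E₂ M) (r₁ : E₁ → ℕ) (r₂ : E₂ → ℕ),
        NUE.IsForwardRegular T μ Y R ρ₁ ϰ₁ ρz₁ r₁ →
        NUE.IsForwardRegular T μ Y R ρ₂ ϰ₂ ρz₂ r₂ →
      ∀ (d : ℕ) (v : M → EuclideanSpace ℝ (Fin d)), Measurable v →
        BddAbove (Set.range fun x => ‖v x‖) →
      ∃ (Ω : Type) (_ : MeasurableSpace Ω) (P : Measure Ω)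
        (X₁ X₂ : ℕ → Ω → EuclideanSpace ℝ (Fin d)),
        IsProbabilityMeasure P ∧
        IdentDistrib (fun ω n => X₁ n ω) (fun x n => birkhoffSum T v n x) P ρ₁ ∧
        IdentDistrib (fun ω n => X₂ n ω) (fun x n => birkhoffSum T v n x) P ρ₂ ∧
        (∀ᵐ ω ∂P, NUE.supDist X₁ X₂ ω < ∞) ∧
        -- weak polynomial moments
        (∀ β c : ℝ, 1 < β → 0 < c →
          (∀ n : ℕ, 1 ≤ n → ϰ₁ {z | n ≤ r₁ z} ≤ ENNReal.ofReal (c * (n : ℝ) ^ (-β))) →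
          (∀ n : ℕ, 1 ≤ n → ϰ₂ {z | n ≤ r₂ z} ≤ ENNReal.ofReal (c * (n : ℝ) ^ (-β))) →
          (∀ n : ℕ, 1 ≤ n → μ {y | n ≤ τ y} ≤ ENNReal.ofReal (c * (n : ℝ) ^ (-β))) →
          ∀ x : ℝ, 0 < x →
            P {ω | ENNReal.ofReal x ≤ NUE.supDist X₁ X₂ ω} ≤
              ENNReal.ofReal (Cweak (lam, K, R, β, c, ⨆ y, ‖v y‖) * x ^ (-β))) ∧
        -- strong polynomial moments
        (∀ β c : ℝ, 1 < β → 0 < c →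
          ∫⁻ z, (r₁ z : ℝ≥0∞) ^ β ∂ϰ₁ ≤ ENNReal.ofReal c →
          ∫⁻ z, (r₂ z : ℝ≥0∞) ^ β ∂ϰ₂ ≤ ENNReal.ofReal c →
          ∫⁻ y, (τ y : ℝ≥0∞) ^ β ∂μ ≤ ENNReal.ofReal c →
            ∫⁻ ω, NUE.supDist X₁ X₂ ω ^ β ∂P ≤
              ENNReal.ofReal (Cstrong (lam, K, R, β, c, ⨆ y, ‖v y‖))) ∧
        -- exponential and stretched exponential moments
        (∀ a γ c : ℝ, 0 < a → 0 < γ → γ ≤ 1 → 0 < c →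
          (∀ n : ℕ, 1 ≤ n →
            ϰ₁ {z | n ≤ r₁ z} ≤ ENNReal.ofReal (c * Real.exp (-a * (n : ℝ) ^ γ))) →
          (∀ n : ℕ, 1 ≤ n →
            ϰ₂ {z | n ≤ r₂ z} ≤ ENNReal.ofReal (c * Real.exp (-a * (n : ℝ) ^ γ))) →
          (∀ n : ℕ, 1 ≤ n →
            μ {y | n ≤ τ y} ≤ ENNReal.ofReal (c * Real.exp (-a * (n : ℝ) ^ γ))) →
          ∀ x : ℝ, 0 < x →
            P {ω | ENNReal.ofReal x ≤ NUE.supDist X₁ X₂ ω} ≤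
              ENNReal.ofReal (Cexp (lam, K, R, a, γ, c, ⨆ y, ‖v y‖) *
                Real.exp (-Aexp (lam, K, R, a, γ, c, ⨆ y, ‖v y‖) * x ^ γ))) := by
  refine ⟨⟨NUE.acipConst, NUE.continuousOn_acipConst, ?_⟩, NUE.couplingPolyConst,
    NUE.couplingPolyConst, NUE.couplingExpConst, NUE.couplingExpRate,
    NUE.continuousOn_couplingPolyConst, NUE.continuousOn_couplingPolyConst,
    NUE.continuousOn_couplingExpConst, NUE.continuousOn_couplingExpRate,
    fun p hp => ⟨NUE.couplingExpConst_pos hp, NUE.couplingExpRate_pos hp⟩, ?_⟩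
  · intro M _ _ _ m _ T Y α τ lam Khat hNE
    exact hNE.exists_acip
  · intro M _ _ _ m _ T Y α τ lam Khat hNE μ hμ K hK hdist R hR E₁ _ E₂ _ ρ₁ ρ₂ ϰ₁ ϰ₂ ρz₁ ρz₂
      r₁ r₂ hρ₁ hρ₂ d v hv hbdd
    exact NUE.exists_forwardRegular_coupling hNE hμ hK hdist hR hρ₁ hρ₂ hv hbdd
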